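/- Let $k$ be a field of characteristic $0$. \textbf{The vacuum modules.} Let $V=k((t))$ and $V^*=k((t))\,dt$, with the residue pairing $\langle \omega,f\rangle=\operatorname{res}(f\omega)$. Let $D$ be the Heisenberg algebra generated by $V^*$ and $V$ with $[l,v]=\langle l,v\rangle$ (and $[v,v']=[l,l']=0$), let $C$ be the Clifford algebra generated by $V^*$ and $V$ with $[l,v]_+=\langle l,v\rangle$ (and $[v,v']_+=[l,l']_+=0$), and put $CD=C\otimes_k D$. Let $CD^+\subset CD$ be the right ideal generated by the elements of $k[[t]]\subset V$ and $k[[t]]\,dt\subset V^*$, placed in $D$ as well as in $C$, and let $Vac=CD/CD^+$. Let $\widetilde{CD}$, $\widetilde{CD}^+$ and $\widetilde{Vac}=\widetilde{CD}/\widetilde{CD}^+$ be defined in the same way with $k[t,t^{-1}]$, $k[t,t^{-1}]\,dt$, $k[t]$, $k[t]\,dt$ in place of $k((t))$, $k((t))\,dt$, $k[[t]]$, $k[[t]]\,dt$. \textbf{The de Rham complex.} The formal loop space $\mathcal L(\mathbb A^1)$ is the ind-pro-scheme formed by the schemes $$\mathcal L^{\varepsilon}_M=\operatorname{Spec} k[a_l;\,-N\le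 l\le M]/(a_l^{1+\varepsilon_l};\,-N\le l<0),\qquad M,N\ge 0,\ \varepsilon=(\varepsilon_l)_{-N\le l<0},\ \varepsilon_l\ge 0.$$ Let $Y_M^N=\operatorname{Spec} k[a_l;\,-N\le l\le M]$, and let $X_M=\{a_l=0,\ l<0\}\subset\mathcal L_M^\varepsilon\subset Y^N_M$, with embedding $i:X_M\to Y_M^N$. Consider the right $\mathcal D$-module $i_\bullet\omega_{X_M}=\omega_{X_M}\otimes_{\mathcal D_{X_M}}\mathcal D_{X_M\to Y_M^N}$ on $Y_M^N$, and let $(i_\bullet\omega_{X_M})^{\mathcal O}_\varepsilon$ be the $\mathcal O(\mathcal L^\varepsilon_M)$-module of its global sections annihilated by the ideal of $\mathcal L_M^\varepsilon$. The de Rham complex $DR(i_\bullet p^\bullet\omega_{\mathbb A^1})$ (where $\mathbb A^1\xleftarrow{p}\mathcal L^0(\mathbb A^1)\xrightarrow{i}\mathcal L(\mathbb A^1)$), that is, the complex of global sections of the chiral de Rham complex of $\mathbb A^1$, has in degree $r\in\mathbb Z$ the term $$DR^r=\varinjlim_{M}\ \varinjlim_{(N,\varepsilon)}T^{M-r}_{M,\varepsilon},\qquad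 T^{j}_{M,\varepsilon}=\operatorname{Hom}_{\mathcal O(\mathcal L^\varepsilon_M)}\bigl(\Omega^{j}_{\mathcal L^\varepsilon_M/k},\,(i_\bullet\omega_{X_M})^{\mathcal O}_\varepsilon\bigr)$$ (with $T^j=0$ for $j<0$), where the limit over $(N,\varepsilon)$ is taken along the closed embeddings $\mathcal L_M^\varepsilon\subset\mathcal L_M^{\varepsilon'}$ (restriction of forms, and inclusion of the sections of $i_\bullet\omega$), and the limit over $M$ along the maps $T^j_{M,\varepsilon}\to T^{j+1}_{M+1,\varepsilon}$, $\xi\mapsto da_{M+1}\otimes(\partial_{a_{M+1}}\wedge\xi)$, attached to the smooth projections $\mathcal L_{M+1}^\varepsilon\to\mathcal L_M^\varepsilon$. As a vector space, $DR(i_\bullet p^\bullet\omega_{\mathbb A^1})=\bigoplus_{r\in\mathbb Z}DR^r$. \textbf{Proposition.} (a) The natural map $\widetilde{Vac}\to Vac$, induced by $k[t,t^{-1}]\subset k((t))$, is an isomorphism. (b) There is an isomorphism of $k$-vector spaces $\Phi:DR(i_\bullet p^\bullet\omega_{\mathbb A^1})\to Vac$. More precisely, $\Phi$ can be chosen such that,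 for every $l\in\mathbb Z$, it takes multiplication by the coordinate function $a_l$ and contraction (from the right) with the form $da_l$ to right multiplication by $t^{-l-1}dt\in V^*$ in $D$ and in $C$, respectively; and it takes the right action of the constant vector field $\partial_{a_l}$ on $i_\bullet\omega$ and exterior multiplication (from the right) by $\partial_{a_l}$ to right multiplication by $-t^l$, $t^l\in V$ in $D$, and by $t^l\in V$ in $C$, respectively. -/

import Mathlib

open scoped TensorProduct KaehlerDifferential DirectSum

universe u

namespace ChiralDeRham

/-! ### The Heisenberg and Clifford algebras of a pairing, and the vacuum module -/

section Heisenberg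

variable {k V L : Type*} [Field k] [AddCommGroup V] [Module k V] [AddCommGroup L] [Module k L]

/-- The relations `x y - y x = ⟨l, v'⟩ - ⟨l', v⟩` for `x = (v, l)`, `y = (v', l')`; in particular
`[l, v] = ⟨l, v⟩`, `[v, v'] = 0` and `[l, l'] = 0`. -/
inductive HeisRel (B : L →ₗ[k] V →ₗ[k] k) :
    TensorAlgebra k (V × L) → TensorAlgebra k (V × L) → Prop
  | comm (x y : V × L) : HeisRel B
      (TensorAlgebra.ι k x * TensorAlgebra.ι k y)
      (TensorAlgebra.ι k y * TensorAlgebra.ι k x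
        + algebraMap k (TensorAlgebra k (V × L)) (B x.2 y.1 - B y.2 x.1))

/-- The Heisenberg algebra generated by `V` and `L` with `[l, v] = ⟨l, v⟩`. -/
abbrev Heis (B : L →ₗ[k] V →ₗ[k] k) : Type _ := RingQuot (HeisRel B)

/-- The generators of the Heisenberg algebra. -/
noncomputable def Heis.gen (B : L →ₗ[k] V →ₗ[k] k) : V × L →ₗ[k] Heis B :=
  (RingQuot.mkAlgHom k (HeisRel B)).toLinearMap ∘ₗ TensorAlgebra.ι k

/-- The quadratic form `(v, l) ↦ ⟨l, v⟩` on `V × L`. -/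
noncomputable def pairingForm (B : L →ₗ[k] V →ₗ[k] k) : QuadraticForm k (V × L) :=
  LinearMap.BilinMap.toQuadraticMap
    (B.compl₁₂ (LinearMap.snd k V L) (LinearMap.fst k V L))

/-- The Clifford algebra generated by `V` and `L` with `l v + v l = ⟨l, v⟩` and with
`v v' + v' v = 0`, `l l' + l' l = 0`. -/
abbrev Cliff (B : L →ₗ[k] V →ₗ[k] k) : Type _ := CliffordAlgebra (pairingForm B)

/-- The Heisenberg-Clifford algebra `C ⊗ D`. -/
abbrev HeisCliff (B : L →ₗ[k] V →ₗ[k] k) : Type _ := Cliff B ⊗[k] Heis B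

/-- The bosonic generators `V ⊕ L ⊂ D`. -/
noncomputable def HeisCliff.boson (B : L →ₗ[k] V →ₗ[k] k) (x : V × L) : HeisCliff B :=
  1 ⊗ₜ[k] Heis.gen B x

/-- The fermionic generators `V ⊕ L ⊂ C`. -/
noncomputable def HeisCliff.fermion (B : L →ₗ[k] V →ₗ[k] k) (x : V × L) : HeisCliff B :=
  CliffordAlgebra.ι (pairingForm B) x ⊗ₜ[k] 1

/-- The right ideal of `C ⊗ D` generated by the elements of subspaces `Vp ⊂ V`, `Lp ⊂ L`,
placed in `D` as well as in `C`. -/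
noncomputable def HeisCliff.plus (B : L →ₗ[k] V →ₗ[k] k) (Vp : Submodule k V) (Lp : Submodule k L) :
    Submodule k (HeisCliff B) :=
  Submodule.span k {z | ∃ x ∈ Vp.prod Lp, ∃ c : HeisCliff B,
    z = HeisCliff.boson B x * c ∨ z = HeisCliff.fermion B x * c}

/-- The quotient of `C ⊗ D` by the right ideal generated by `Vp` and `Lp`. -/
abbrev VacuumModule (B : L →ₗ[k] V →ₗ[k] k) (Vp : Submodule k V) (Lp : Submodule k L) : Type _ :=
  HeisCliff B ⧸ HeisCliff.plus B Vp Lp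

/-- The right action of `C ⊗ D` on the vacuum module. -/
noncomputable def VacuumModule.mulRight (B : L →ₗ[k] V →ₗ[k] k) (Vp : Submodule k V)
    (Lp : Submodule k L) (c : HeisCliff B) : Module.End k (VacuumModule B Vp Lp) :=
  Submodule.mapQ _ _ (LinearMap.mulRight k c) <| by
    refine Submodule.span_le.2 ?_
    rintro _ ⟨x, hx, c', rfl | rfl⟩
    · exact Submodule.subset_span ⟨x, hx, c' * c, Or.inl (by simp [mul_assoc])⟩
    · exact Submodule.subset_span ⟨x, hx, c' * c, Or.inr (by simp [mul_assoc])⟩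

variable {V' L' : Type*} [AddCommGroup V'] [Module k V'] [AddCommGroup L'] [Module k L']

/-- The algebra map of Heisenberg algebras induced by linear maps that respect the pairings. -/
noncomputable def Heis.map (B : L →ₗ[k] V →ₗ[k] k) (B' : L' →ₗ[k] V' →ₗ[k] k)
    (f : V →ₗ[k] V') (g : L →ₗ[k] L') (h : ∀ l v, B' (g l) (f v) = B l v) :
    Heis B →ₐ[k] Heis B' :=
  RingQuot.liftAlgHom k
    ⟨TensorAlgebra.lift k (Heis.gen B' ∘ₗ f.prodMap g), by
      rintro _ _ ⟨x, y⟩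
      have := congrArg (id : Heis B' → Heis B')
        (RingQuot.mkAlgHom_rel k (HeisRel.comm (B := B') (f.prodMap g x) (f.prodMap g y)))
      simpa [Heis.gen, h] using this⟩

theorem Heis.map_gen (B : L →ₗ[k] V →ₗ[k] k) (B' : L' →ₗ[k] V' →ₗ[k] k)
    (f : V →ₗ[k] V') (g : L →ₗ[k] L') (h : ∀ l v, B' (g l) (f v) = B l v) (x : V × L) :
    Heis.map B B' f g h (Heis.gen B x) = Heis.gen B' (f.prodMap g x) := by
  simp [Heis.map, Heis.gen]

/-- The algebra map of Clifford algebras induced by linear maps that respect the pairings. -/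
noncomputable def Cliff.map (B : L →ₗ[k] V →ₗ[k] k) (B' : L' →ₗ[k] V' →ₗ[k] k)
    (f : V →ₗ[k] V') (g : L →ₗ[k] L') (h : ∀ l v, B' (g l) (f v) = B l v) :
    Cliff B →ₐ[k] Cliff B' :=
  CliffordAlgebra.map (⟨f.prodMap g, fun x => by simp [pairingForm, h]⟩ :
    pairingForm B →qᵢ pairingForm B')

/-- The algebra map of Heisenberg-Clifford algebras induced by linear maps that respect the
pairings. -/
noncomputable def HeisCliff.map (B : L →ₗ[k] V →ₗ[k] k) (B' : L' →ₗ[k] V' →ₗ[k] k)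
    (f : V →ₗ[k] V') (g : L →ₗ[k] L') (h : ∀ l v, B' (g l) (f v) = B l v) :
    HeisCliff B →ₐ[k] HeisCliff B' :=
  Algebra.TensorProduct.map (Cliff.map B B' f g h) (Heis.map B B' f g h)

theorem HeisCliff.map_boson (B : L →ₗ[k] V →ₗ[k] k) (B' : L' →ₗ[k] V' →ₗ[k] k)
    (f : V →ₗ[k] V') (g : L →ₗ[k] L') (h : ∀ l v, B' (g l) (f v) = B l v) (x : V × L) :
    HeisCliff.map B B' f g h (HeisCliff.boson B x) = HeisCliff.boson B' (f.prodMap g x) := by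
  simp only [HeisCliff.map, HeisCliff.boson, Algebra.TensorProduct.map_tmul, map_one,
    Heis.map_gen]

theorem HeisCliff.map_fermion (B : L →ₗ[k] V →ₗ[k] k) (B' : L' →ₗ[k] V' →ₗ[k] k)
    (f : V →ₗ[k] V') (g : L →ₗ[k] L') (h : ∀ l v, B' (g l) (f v) = B l v) (x : V × L) :
    HeisCliff.map B B' f g h (HeisCliff.fermion B x) =
      HeisCliff.fermion B' (f.prodMap g x) := by
  simp only [HeisCliff.map, HeisCliff.fermion, Algebra.TensorProduct.map_tmul, map_one, Cliff.map,
    CliffordAlgebra.map_apply_ι]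
  rfl

theorem HeisCliff.plus_le_comap (B : L →ₗ[k] V →ₗ[k] k) (B' : L' →ₗ[k] V' →ₗ[k] k)
    (f : V →ₗ[k] V') (g : L →ₗ[k] L') (h : ∀ l v, B' (g l) (f v) = B l v)
    (Vp : Submodule k V') (Lp : Submodule k L') :
    HeisCliff.plus B (Vp.comap f) (Lp.comap g) ≤
      (HeisCliff.plus B' Vp Lp).comap (HeisCliff.map B B' f g h).toLinearMap := by
  refine Submodule.span_le.2 ?_
  rintro z ⟨x, hx, c, rfl | rfl⟩ <;> refine Submodule.subset_span ⟨f.prodMap g x, ?_, HeisCliff.map B B' f g h c, ?_⟩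
  · exact ⟨hx.1, hx.2⟩
  · exact Or.inl (by simp [HeisCliff.map_boson])
  · exact ⟨hx.1, hx.2⟩
  · exact Or.inr (by simp [HeisCliff.map_fermion])

end Heisenberg

/-! ### The vacuum modules for `k((t)) ⊕ k((t))dt` and for `k[t, t⁻¹] ⊕ k[t, t⁻¹]dt` -/

section Vacuum

variable (k : Type u) [Field k]

/-- The residue pairing `⟨g dt, f⟩ = res (f g dt)` between `k((t))dt` and `k((t))`. A form `g dt`
is represented by the Laurent series `g`. -/
noncomputable def resPairing : LaurentSeries k →ₗ[k] LaurentSeries k →ₗ[k] k :=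
  LinearMap.mk₂ k (fun g f => (f * g).coeff (-1))
    (fun g g' f => by rw [mul_add, HahnSeries.coeff_add])
    (fun c g f => by
      rw [← HahnSeries.C_mul_eq_smul, mul_left_comm, HahnSeries.C_mul_eq_smul,
        HahnSeries.coeff_smul])
    (fun g f f' => by rw [add_mul, HahnSeries.coeff_add])
    (fun c g f => by
      rw [← HahnSeries.C_mul_eq_smul, mul_assoc, HahnSeries.C_mul_eq_smul,
        HahnSeries.coeff_smul])

/-- The subspace `k[[t]]` of `k((t))`. -/
def taylorPart : Submodule k (LaurentSeries k) where
  carrier := {f | ∀ n < 0, f.coeff n = 0}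
  add_mem' := by intro a b ha hb n hn; simp [ha n hn, hb n hn]
  zero_mem' := by intro n _; simp
  smul_mem' := by intro c a ha n hn; simp [ha n hn]

/-- The inclusion of `k[t, t⁻¹]` into `k((t))`. -/
noncomputable def laurentIncl : LaurentPolynomial k →ₗ[k] LaurentSeries k where
  toFun p := HahnSeries.ofFinsuppLinearMap k p.coeff
  map_add' := by intros; ext; simp
  map_smul' := by intros; ext; simp

/-- The restriction of the residue pairing to Laurent polynomials. -/
noncomputable def resPairingPoly : LaurentPolynomial k →ₗ[k] LaurentPolynomial k →ₗ[k] k :=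
  (resPairing k).compl₁₂ (laurentIncl k) (laurentIncl k)

/-- The vacuum module `Vac = CD / CD⁺`, where `CD` is the Heisenberg-Clifford algebra of
`k((t)) ⊕ k((t))dt` and `CD⁺` is the right ideal generated by the (infinite) linear combinations of
`a_n = tⁿ`, `a*_{n+1} = tⁿ dt` in `D` and of `b_n = tⁿ`, `b*_{n+1} = tⁿ dt` in `C`, `n ≥ 0`. -/
abbrev Vac : Type u := VacuumModule (resPairing k) (taylorPart k) (taylorPart k)

/-- The polynomial vacuum module: the same with `k[t, t⁻¹]` in place of `k((t))`, and with finite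
linear combinations of the generators. -/
abbrev VacPoly : Type u :=
  VacuumModule (resPairingPoly k)
    ((taylorPart k).comap (laurentIncl k)) ((taylorPart k).comap (laurentIncl k))

/-- The natural map from the polynomial to the completed vacuum module, induced by the algebra map
that the inclusion of `k[t, t⁻¹]` into `k((t))` gives. -/
noncomputable def vacMap : VacPoly k →ₗ[k] Vac k :=
  Submodule.mapQ _ _
    (HeisCliff.map (resPairingPoly k) (resPairing k) (laurentIncl k) (laurentIncl k)
      (fun _ _ => rfl)).toLinearMap
    (HeisCliff.plus_le_comap _ _ _ _ _ _ _)

/-- The right action on `Vac` of the element `tⁿ` of `V = k((t))`, placed in `D`. -/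
noncomputable def Vac.bosonV (n : ℤ) : Module.End k (Vac k) :=
  VacuumModule.mulRight (resPairing k) (taylorPart k) (taylorPart k)
    (HeisCliff.boson (resPairing k) (HahnSeries.single n 1, 0))

/-- The right action on `Vac` of the element `tⁿ dt` of `V^* = k((t))dt`, placed in `D`. -/
noncomputable def Vac.bosonL (n : ℤ) : Module.End k (Vac k) :=
  VacuumModule.mulRight (resPairing k) (taylorPart k) (taylorPart k)
    (HeisCliff.boson (resPairing k) (0, HahnSeries.single n 1))

/-- The right action on `Vac` of the element `tⁿ` of `V = k((t))`, placed in `C`. -/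
noncomputable def Vac.fermionV (n : ℤ) : Module.End k (Vac k) :=
  VacuumModule.mulRight (resPairing k) (taylorPart k) (taylorPart k)
    (HeisCliff.fermion (resPairing k) (HahnSeries.single n 1, 0))

/-- The right action on `Vac` of the element `tⁿ dt` of `V^* = k((t))dt`, placed in `C`. -/
noncomputable def Vac.fermionL (n : ℤ) : Module.End k (Vac k) :=
  VacuumModule.mulRight (resPairing k) (taylorPart k) (taylorPart k)
    (HeisCliff.fermion (resPairing k) (0, HahnSeries.single n 1))

end Vacuum

/-! ### Differential operators on affine spaces -/

section Weyl

/-- The relations of the Weyl algebra; `Sum.inl i` stands for the coordinate `x i` and `Sum.inr i`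
for the derivation `∂ i`. -/
inductive WeylRel (k σ : Type*) [Field k] :
    FreeAlgebra k (σ ⊕ σ) → FreeAlgebra k (σ ⊕ σ) → Prop
  | x_x (i j : σ) : WeylRel k σ
      (FreeAlgebra.ι k (.inl i) * FreeAlgebra.ι k (.inl j))
      (FreeAlgebra.ι k (.inl j) * FreeAlgebra.ι k (.inl i))
  | d_d (i j : σ) : WeylRel k σ
      (FreeAlgebra.ι k (.inr i) * FreeAlgebra.ι k (.inr j))
      (FreeAlgebra.ι k (.inr j) * FreeAlgebra.ι k (.inr i))
  | d_x_ne (i j : σ) (h : i ≠ j) : WeylRel k σ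
      (FreeAlgebra.ι k (.inr i) * FreeAlgebra.ι k (.inl j))
      (FreeAlgebra.ι k (.inl j) * FreeAlgebra.ι k (.inr i))
  | d_x_self (i : σ) : WeylRel k σ
      (FreeAlgebra.ι k (.inr i) * FreeAlgebra.ι k (.inl i))
      (FreeAlgebra.ι k (.inl i) * FreeAlgebra.ι k (.inr i) + 1)

/-- The Weyl algebra: global (polynomial) differential operators on the affine space with
coordinates `x i`, `i : σ`, over a field of characteristic zero. -/
abbrev Weyl (k σ : Type*) [Field k] : Type _ := RingQuot (WeylRel k σ)

variable {k σ σ' : Type*} [Field k]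

/-- The coordinate function `x i` as a differential operator. -/
noncomputable def Weyl.x (i : σ) : Weyl k σ :=
  RingQuot.mkAlgHom k (WeylRel k σ) (FreeAlgebra.ι k (.inl i))

/-- The derivation `∂ / ∂ x i`. -/
noncomputable def Weyl.d (i : σ) : Weyl k σ :=
  RingQuot.mkAlgHom k (WeylRel k σ) (FreeAlgebra.ι k (.inr i))

theorem Weyl.x_mul_x (i j : σ) : (Weyl.x i * Weyl.x j : Weyl k σ) = Weyl.x j * Weyl.x i := by
  simpa [Weyl.x] using RingQuot.mkAlgHom_rel k (WeylRel.x_x (k := k) i j)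

theorem Weyl.d_mul_d (i j : σ) : (Weyl.d i * Weyl.d j : Weyl k σ) = Weyl.d j * Weyl.d i := by
  simpa [Weyl.d] using RingQuot.mkAlgHom_rel k (WeylRel.d_d (k := k) i j)

theorem Weyl.d_mul_x_of_ne {i j : σ} (h : i ≠ j) :
    (Weyl.d i * Weyl.x j : Weyl k σ) = Weyl.x j * Weyl.d i := by
  simpa [Weyl.d, Weyl.x] using RingQuot.mkAlgHom_rel k (WeylRel.d_x_ne (k := k) i j h)

theorem Weyl.d_mul_x_self (i : σ) :
    (Weyl.d i * Weyl.x i : Weyl k σ) = Weyl.x i * Weyl.d i + 1 := by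
  simpa [Weyl.d, Weyl.x] using RingQuot.mkAlgHom_rel k (WeylRel.d_x_self (k := k) i)

/-- The inclusion of the Weyl algebra of a smaller set of coordinates. -/
noncomputable def Weyl.map (f : σ ↪ σ') : Weyl k σ →ₐ[k] Weyl k σ' :=
  RingQuot.liftAlgHom k
    ⟨FreeAlgebra.lift k (Sum.elim (fun i => Weyl.x (f i)) (fun i => Weyl.d (f i))), by
      rintro _ _ (⟨i, j⟩ | ⟨i, j⟩ | ⟨i, j, h⟩ | ⟨i⟩)
      · simpa using Weyl.x_mul_x _ _
      · simpa using Weyl.d_mul_d _ _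
      · simpa using Weyl.d_mul_x_of_ne (fun e => h (f.injective e))
      · simpa using Weyl.d_mul_x_self _⟩

@[simp] theorem Weyl.map_x (f : σ ↪ σ') (i : σ) :
    Weyl.map f (Weyl.x i : Weyl k σ) = Weyl.x (f i) := by
  simp [Weyl.map, Weyl.x]

@[simp] theorem Weyl.map_d (f : σ ↪ σ') (i : σ) :
    Weyl.map f (Weyl.d i : Weyl k σ) = Weyl.d (f i) := by
  simp [Weyl.map, Weyl.d]

theorem Weyl.algHom_ext {R : Type*} [Ring R] [Algebra k R] {f g : Weyl k σ →ₐ[k] R}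
    (hx : ∀ i, f (Weyl.x i) = g (Weyl.x i)) (hd : ∀ i, f (Weyl.d i) = g (Weyl.d i)) : f = g := by
  refine RingQuot.ringQuot_ext' k f g (FreeAlgebra.hom_ext ?_)
  ext (i | i)
  · exact hx i
  · exact hd i

theorem pderiv_comm (i j : σ) (p : MvPolynomial σ k) :
    MvPolynomial.pderiv i (MvPolynomial.pderiv j p) =
      MvPolynomial.pderiv j (MvPolynomial.pderiv i p) := by
  classical
  let D (l : σ) : Derivation k (MvPolynomial σ k) (MvPolynomial σ k) := MvPolynomial.pderiv l
  have h : ⁅D i, D j⁆ = 0 := by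
    refine MvPolynomial.derivation_ext fun l => ?_
    simp [D, Derivation.commutator_apply, MvPolynomial.pderiv_X, Pi.single_apply, apply_ite]
  have := congrArg (fun E : Derivation k (MvPolynomial σ k) (MvPolynomial σ k) => E p) h
  exact sub_eq_zero.1 (by simpa [D, Derivation.commutator_apply] using this)

open MvPolynomial in
/-- The right `D`-module `ω` of the affine space with coordinates `x i`, `i : σ`: a form `f dx` is
represented by `f`, and the right action is `f · x i = x i f`, `f · ∂ i = - ∂ f / ∂ x i`. -/
noncomputable def omegaAct (k σ : Type*) [Field k] :
    Weyl k σ →ₐ[k] (Module.End k (MvPolynomial σ k))ᵐᵒᵖ :=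
  RingQuot.liftAlgHom k
    ⟨FreeAlgebra.lift k (Sum.elim
      (fun i => MulOpposite.op (LinearMap.mulLeft k (X i)))
      (fun i => MulOpposite.op (-(pderiv i).toLinearMap))), by
      rintro _ _ (⟨i, j⟩ | ⟨i, j⟩ | ⟨i, j, h⟩ | ⟨i⟩)
      · simp only [map_mul, FreeAlgebra.lift_ι_apply, Sum.elim_inl, ← MulOpposite.op_mul]
        congr 1
        exact LinearMap.ext fun p => mul_left_comm _ _ _
      · simp only [map_mul, FreeAlgebra.lift_ι_apply, Sum.elim_inr, ← MulOpposite.op_mul]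
        congr 1
        refine LinearMap.ext fun p => ?_
        simpa [Module.End.mul_apply] using pderiv_comm j i p
      · simp only [map_mul, FreeAlgebra.lift_ι_apply, Sum.elim_inr, Sum.elim_inl,
          ← MulOpposite.op_mul]
        congr 1
        refine LinearMap.ext fun p => ?_
        simp [Module.End.mul_apply, Derivation.leibniz, pderiv_X_of_ne (Ne.symm h)]
      · simp only [map_mul, map_add, map_one, FreeAlgebra.lift_ι_apply, Sum.elim_inr, Sum.elim_inl,
          ← MulOpposite.op_mul]
        rw [← MulOpposite.op_one, ← MulOpposite.op_add]
        congr 1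
        refine LinearMap.ext fun p => ?_
        simp [Module.End.mul_apply, Derivation.leibniz]⟩

/-- The right action of a differential operator on `ω`. -/
noncomputable def omegaMul (P : Weyl k σ) : Module.End k (MvPolynomial σ k) :=
  (omegaAct k σ P).unop

theorem omegaMul_mul (P Q : Weyl k σ) (m : MvPolynomial σ k) :
    omegaMul (P * Q) m = omegaMul Q (omegaMul P m) := by
  simp [omegaMul, Module.End.mul_apply]

theorem omegaMul_x (i : σ) (m : MvPolynomial σ k) :
    omegaMul (Weyl.x i) m = MvPolynomial.X i * m := by
  simp [omegaMul, omegaAct, Weyl.x]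

theorem omegaMul_d (i : σ) (m : MvPolynomial σ k) :
    omegaMul (Weyl.d i) m = -MvPolynomial.pderiv i m := by
  simp [omegaMul, omegaAct, Weyl.d]

theorem rename_omegaMul (f : σ ↪ σ') (P : Weyl k σ) (m : MvPolynomial σ k) :
    MvPolynomial.rename f (omegaMul P m) = omegaMul (Weyl.map f P) (MvPolynomial.rename f m) := by
  let S : Subalgebra k (Weyl k σ) :=
    { carrier := {P | ∀ m : MvPolynomial σ k, MvPolynomial.rename f (omegaMul P m) =
        omegaMul (Weyl.map f P) (MvPolynomial.rename f m)}
      mul_mem' := fun {P Q} hP hQ m => by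
        simp only [Set.mem_ofPred_eq] at hP hQ
        rw [omegaMul_mul, map_mul, omegaMul_mul, hQ, hP]
      add_mem' := fun {P Q} hP hQ m => by
        simp only [Set.mem_ofPred_eq] at hP hQ
        simp only [omegaMul, map_add, MulOpposite.unop_add, LinearMap.add_apply] at hP hQ ⊢
        rw [hP, hQ]
      algebraMap_mem' := fun c m => by
        simp [omegaMul, Module.algebraMap_end_apply] }
  have hx : ∀ i, Weyl.x i ∈ S := fun i m => by
    rw [Weyl.map_x, omegaMul_x, omegaMul_x]
    simp
  have hd : ∀ i, Weyl.d i ∈ S := fun i m => by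
    rw [Weyl.map_d, omegaMul_d, omegaMul_d, map_neg, MvPolynomial.pderiv_rename f.injective]
  have hS : ∀ P, P ∈ S := by
    intro P
    obtain ⟨p, rfl⟩ := RingQuot.mkAlgHom_surjective k (WeylRel k σ) P
    induction p using FreeAlgebra.induction with
    | grade0 c => simp
    | grade1 i =>
      rcases i with i | i
      · exact hx i
      · exact hd i
    | mul p q hp hq => simpa using S.mul_mem hp hq
    | add p q hp hq => simpa using S.add_mem hp hq
  exact hS P m

end Weyl

/-! ### Direct image of `ω` under the embedding of a coordinate subspace -/

section Push

variable (k τ ν : Type*) [Field k]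

/-- Let `Y` be the affine space with coordinates `x i`, `i : τ ⊕ ν`, and `X ⊂ Y` the subspace where
`x (inr n) = 0` for all `n : ν`. The relations that define `ω_X ⊗_{D_X} D_{X → Y}`, where
`D_{X → Y} = D_Y / I_X D_Y`, as a quotient of `ω_X ⊗_k D_Y`. -/
noncomputable def pushRel : Submodule k (MvPolynomial τ k ⊗[k] Weyl k (τ ⊕ ν)) :=
  Submodule.span k
    ({z | ∃ (m : MvPolynomial τ k) (P : Weyl k τ) (Q : Weyl k (τ ⊕ ν)),
        z = omegaMul P m ⊗ₜ[k] Q - m ⊗ₜ[k] (Weyl.map Function.Embedding.inl P * Q)} ∪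
      {z | ∃ (m : MvPolynomial τ k) (n : ν) (Q : Weyl k (τ ⊕ ν)),
        z = m ⊗ₜ[k] (Weyl.x (Sum.inr n) * Q)})

/-- The direct image `i_• ω_X = ω_X ⊗_{D_X} D_{X → Y}`. -/
def Push : Type _ := (MvPolynomial τ k ⊗[k] Weyl k (τ ⊕ ν)) ⧸ pushRel k τ ν

noncomputable instance : AddCommGroup (Push k τ ν) :=
  inferInstanceAs (AddCommGroup ((MvPolynomial τ k ⊗[k] Weyl k (τ ⊕ ν)) ⧸ pushRel k τ ν))

noncomputable instance : Module k (Push k τ ν) :=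
  inferInstanceAs (Module k ((MvPolynomial τ k ⊗[k] Weyl k (τ ⊕ ν)) ⧸ pushRel k τ ν))

variable {k τ ν}

/-- The class of `m ⊗ Q` in `i_• ω_X`. -/
noncomputable def Push.mk : MvPolynomial τ k ⊗[k] Weyl k (τ ⊕ ν) →ₗ[k] Push k τ ν :=
  (pushRel k τ ν).mkQ

theorem Push.hom_ext {W : Type*} [AddCommGroup W] [Module k W] {f g : Push k τ ν →ₗ[k] W}
    (h : ∀ m Q, f (Push.mk (m ⊗ₜ[k] Q)) = g (Push.mk (m ⊗ₜ[k] Q))) : f = g := by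
  refine Submodule.linearMap_qext _ (TensorProduct.ext' h)

/-- The right action of `D_Y` on `i_• ω_X`: `(m ⊗ Q) · P = m ⊗ Q P`. -/
noncomputable def Push.mulRight (P : Weyl k (τ ⊕ ν)) : Module.End k (Push k τ ν) :=
  Submodule.mapQ _ _ (TensorProduct.map LinearMap.id (LinearMap.mulRight k P)) <| by
    refine Submodule.span_le.2 ?_
    rintro _ (⟨m, R, Q, rfl⟩ | ⟨m, n, Q, rfl⟩)
    · refine Submodule.subset_span (Or.inl ⟨m, R, Q * P, ?_⟩)
      simp [mul_assoc]
    · refine Submodule.subset_span (Or.inr ⟨m, n, Q * P, ?_⟩)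
      simp [mul_assoc]

theorem Push.mulRight_mk (P : Weyl k (τ ⊕ ν)) (m : MvPolynomial τ k) (Q : Weyl k (τ ⊕ ν)) :
    Push.mulRight P (Push.mk (m ⊗ₜ[k] Q)) = Push.mk (m ⊗ₜ[k] (Q * P)) := rfl

theorem Push.mulRight_x_comm (i j : τ ⊕ ν) :
    (Push.mulRight (Weyl.x i) * Push.mulRight (Weyl.x j) : Module.End k (Push k τ ν)) =
      Push.mulRight (Weyl.x j) * Push.mulRight (Weyl.x i) := by
  refine Push.hom_ext fun m Q => ?_
  simp only [Module.End.mul_apply, Push.mulRight_mk, mul_assoc, Weyl.x_mul_x i j]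

/-- The algebra map out of a polynomial ring given by pairwise commuting elements of an algebra. -/
noncomputable def commLift {σ R : Type*} [Ring R] [Algebra k R] (f : σ → R)
    (h : ∀ i j, f i * f j = f j * f i) : MvPolynomial σ k →ₐ[k] R :=
  letI : CommRing (Algebra.adjoin k (Set.range f)) :=
    { (Algebra.adjoin k (Set.range f)).toRing with
      mul_comm := (Algebra.isMulCommutative_adjoin k
        (by rintro _ ⟨i, rfl⟩ _ ⟨j, rfl⟩; exact h i j)).is_comm.comm }
  (Algebra.adjoin k (Set.range f)).val.comp
    (MvPolynomial.aeval fun i => ⟨f i, Algebra.subset_adjoin ⟨i, rfl⟩⟩)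

theorem commLift_X {σ R : Type*} [Ring R] [Algebra k R] (f : σ → R)
    (h : ∀ i j, f i * f j = f j * f i) (i : σ) : commLift (k := k) f h (MvPolynomial.X i) = f i := by
  let _ : CommRing (Algebra.adjoin k (Set.range f)) :=
    { (Algebra.adjoin k (Set.range f)).toRing with
      mul_comm := (Algebra.isMulCommutative_adjoin k
        (by rintro _ ⟨i, rfl⟩ _ ⟨j, rfl⟩; exact h i j)).is_comm.comm }
  simp [commLift]

/-- The `O_Y`-module structure of `i_• ω_X`: functions act through `O_Y ⊂ D_Y`. -/
noncomputable instance : Module (MvPolynomial (τ ⊕ ν) k) (Push k τ ν) :=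
  Module.compHom _
    (commLift (k := k) (fun i : τ ⊕ ν => (Push.mulRight (Weyl.x i) : Module.End k (Push k τ ν)))
      Push.mulRight_x_comm).toRingHom

theorem Push.X_smul (i : τ ⊕ ν) (m : Push k τ ν) :
    (MvPolynomial.X i : MvPolynomial (τ ⊕ ν) k) • m = Push.mulRight (Weyl.x i) m :=
  LinearMap.congr_fun (commLift_X (k := k)
    (fun i : τ ⊕ ν => (Push.mulRight (Weyl.x i) : Module.End k (Push k τ ν)))
    Push.mulRight_x_comm i) m

instance : IsScalarTower k (MvPolynomial (τ ⊕ ν) k) (Push k τ ν) :=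
  ⟨fun c p m => LinearMap.congr_fun (map_smul (commLift (k := k)
    (fun i : τ ⊕ ν => (Push.mulRight (Weyl.x i) : Module.End k (Push k τ ν)))
    Push.mulRight_x_comm) c p) m⟩

/-- Enlarging the set of coordinates: `m ⊗ Q ↦ m ⊗ Q`. For more normal coordinates (`g`) this is the
embedding of a `D`-module into its direct image under a closed embedding; for more tangential
coordinates (`f`) it is the embedding into the smooth inverse image, `m ↦ m · dx`, where `dx` is the
relative top form of the new coordinates. -/
noncomputable def Push.map {τ' ν' : Type*} (f : τ ↪ τ') (g : ν ↪ ν') :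
    Push k τ ν →ₗ[k] Push k τ' ν' :=
  Submodule.mapQ _ _ (TensorProduct.map (MvPolynomial.rename f).toLinearMap
    (Weyl.map (f.sumMap g)).toLinearMap) <| by
    refine Submodule.span_le.2 ?_
    rintro _ (⟨m, P, Q, rfl⟩ | ⟨m, n, Q, rfl⟩)
    · refine Submodule.subset_span (Or.inl
        ⟨MvPolynomial.rename f m, Weyl.map f P, Weyl.map (f.sumMap g) Q, ?_⟩)
      have : Weyl.map (f.sumMap g) (Weyl.map Function.Embedding.inl P : Weyl k (τ ⊕ ν)) =
          (Weyl.map Function.Embedding.inl (Weyl.map f P) : Weyl k (τ' ⊕ ν')) := by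
        refine AlgHom.congr_fun (φ₁ := (Weyl.map (f.sumMap g)).comp (Weyl.map Function.Embedding.inl))
          (φ₂ := (Weyl.map Function.Embedding.inl).comp (Weyl.map f)) (Weyl.algHom_ext ?_ ?_) P <;>
        intro i <;> simp
      simp [rename_omegaMul, this]
    · refine Submodule.subset_span (Or.inr
        ⟨MvPolynomial.rename f m, g n, Weyl.map (f.sumMap g) Q, ?_⟩)
      simp

end Push

/-! ### The de Rham complex -/

section DeRham

open MvPolynomial

variable (k : Type u) [Field k]

/-- Coordinates on the space of truncated Laurent series `∑ a_l t^l`, `-N ≤ l ≤ M`: `inl m` stands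
for `a_m`, `0 ≤ m ≤ M`, and `inr n` stands for `a_{-n-1}`, `0 ≤ n < N`. -/
abbrev Coord (M N : ℕ) : Type := Fin (M + 1) ⊕ Fin N

/-- The ideal generated by `a_l ^ (1 + ε_l)` for `-N ≤ l < 0`. -/
noncomputable def nilIdeal (M N : ℕ) (ε : Fin N → ℕ) : Ideal (MvPolynomial (Coord M N) k) :=
  Ideal.span (Set.range fun n => X (Sum.inr n) ^ (1 + ε n))

/-- The coordinate ring of the scheme `L^ε_M` of truncated Laurent series `∑ a_l t^l`,
`-N ≤ l ≤ M`, with `a_l ^ (1 + ε_l) = 0` for `l < 0`. -/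
abbrev NilRing (M N : ℕ) (ε : Fin N → ℕ) : Type u :=
  MvPolynomial (Coord M N) k ⧸ nilIdeal k M N ε

/-- The sections of `i_• ω` on `L^ε_M`, where `i` is the embedding of `L^0_M` (all `a_l = 0` for
`l < 0`) into `L^ε_M`: the elements of the direct image to the ambient affine space that are
annihilated by the ideal of `L^ε_M`. -/
noncomputable abbrev OmegaO (M N : ℕ) (ε : Fin N → ℕ) :
    Submodule (MvPolynomial (Coord M N) k) (Push k (Fin (M + 1)) (Fin N)) :=
  Submodule.torsionBySet _ _ (nilIdeal k M N ε : Set (MvPolynomial (Coord M N) k))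

/-- `Hom_O (Ω^j, i_• ω)` on `L^ε_M`, the polyvector fields of degree `j` with values in `i_• ω`:
alternating forms on the module of Kähler differentials. (Linearity over the coordinate ring is the
same as linearity over the polynomial ring, of which it is a quotient.) -/
abbrev PolyField (M N : ℕ) (ε : Fin N → ℕ) (j : ℕ) : Type u :=
  Ω[NilRing k M N ε⁄k] [⋀^Fin j]→ₗ[MvPolynomial (Coord M N) k] OmegaO k M N ε

variable {k}

/-- The map of Kähler differentials induced by a map of algebras. -/
noncomputable def kaehlerMap {A B : Type*} [CommRing A] [CommRing B] [Algebra k A] [Algebra k B]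
    (f : A →ₐ[k] B) : Ω[A⁄k] →ₗ[k] Ω[B⁄k] :=
  letI := f.toRingHom.toAlgebra
  haveI : IsScalarTower k A B := IsScalarTower.of_algebraMap_eq fun c => (f.commutes c).symm
  (KaehlerDifferential.map k k A B).restrictScalars k

/-- The restriction of functions along the closed embedding of `L^ε_M` into `L^ε'_M`, for `N ≤ N'`
and `ε ≤ ε'`; the coordinates `a_l` with `l < -N` go to `0`. -/
noncomputable def nilRestrict (M : ℕ) {N N' : ℕ} (ε : Fin N → ℕ) (ε' : Fin N' → ℕ) (hN : N ≤ N')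
    (h : ∀ n, ε n ≤ ε' (Fin.castLE hN n)) : NilRing k M N' ε' →ₐ[k] NilRing k M N ε :=
  Ideal.Quotient.liftₐ _
    (aeval (Sum.elim (fun m => Ideal.Quotient.mk _ (X (Sum.inl m)))
      (fun n => if hn : (n : ℕ) < N then Ideal.Quotient.mk _ (X (Sum.inr ⟨n, hn⟩)) else 0))) <| by
    intro p hp
    refine (Ideal.span_le (I := RingHom.ker (aeval _ : _ →ₐ[k] NilRing k M N ε))).2 ?_ hp
    rintro _ ⟨n, rfl⟩
    simp only [SetLike.mem_coe, RingHom.mem_ker, map_pow, aeval_X, Sum.elim_inr]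
    split_ifs with hn
    · rw [← map_pow, Ideal.Quotient.eq_zero_iff_mem]
      refine Ideal.mem_of_dvd _ (pow_dvd_pow _ ?_) (Ideal.subset_span ⟨⟨n, hn⟩, rfl⟩)
      exact Nat.add_le_add_left (h ⟨n, hn⟩) 1
    · simp

/-- The pull-back of functions along the projection of `L^ε_{M+1}` onto `L^ε_M` that forgets
`a_{M+1}`. -/
noncomputable def nilPull (M N : ℕ) (ε : Fin N → ℕ) :
    NilRing k M N ε →ₐ[k] NilRing k (M + 1) N ε :=
  Ideal.quotientMapₐ _ (rename (Sum.map Fin.castSucc id)) <| by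
    refine Ideal.span_le.2 ?_
    rintro _ ⟨n, rfl⟩
    refine Ideal.subset_span ⟨n, ?_⟩
    simp

/-- The form `d a` on `L^ε_M`, for a coordinate `a`. -/
noncomputable def coordForm (k : Type u) [Field k] {M N : ℕ} (ε : Fin N → ℕ) (c : Coord M N) :
    Ω[NilRing k M N ε⁄k] :=
  KaehlerDifferential.D k (NilRing k M N ε) (Ideal.Quotient.mk _ (X c))

/-- The transition map of polyvector fields for the closed embedding of `L^ε_M` into `L^ε'_M`:
`φ'` is the composition of the restriction of forms, of `φ`, and of the embedding of the sections of
`i_• ω` on `L^ε_M` into those on `L^ε'_M`. -/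
def IsPushforward {M N N' j : ℕ} {ε : Fin N → ℕ} {ε' : Fin N' → ℕ} (hN : N ≤ N')
    (h : ∀ n, ε n ≤ ε' (Fin.castLE hN n)) (φ : PolyField k M N ε j)
    (φ' : PolyField k M N' ε' j) : Prop :=
  ∀ η : Fin j → Ω[NilRing k M N' ε'⁄k],
    (φ' η : Push k (Fin (M + 1)) (Fin N')) =
      Push.map (Function.Embedding.refl _) (Fin.castLEEmb hN)
        (φ fun r => kaehlerMap (nilRestrict M ε ε' hN h) (η r) : Push k (Fin (M + 1)) (Fin N))

/-- The transition map of polyvector fields for the smooth projection `p` of `L^ε_{M+1}` onto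
`L^ε_M`, of relative dimension `1`. It is given by `p^* Λ^j Θ → ω_{rel} ⊗ Λ^{j+1} Θ`,
`ξ ↦ d a_{M+1} ⊗ (∂ / ∂ a_{M+1} ∧ ξ)`; so `φ'` is the unique polyvector field whose value on
`d a_{M+1} ∧ p^* η` is `φ η · d a_{M+1}` and whose values on forms pulled back from `L^ε_M`
are zero. -/
def IsPullback {M N j : ℕ} {ε : Fin N → ℕ} (φ : PolyField k M N ε j)
    (φ' : PolyField k (M + 1) N ε (j + 1)) : Prop :=
  (∀ η : Fin j → Ω[NilRing k M N ε⁄k],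
    (φ' (Fin.cons (coordForm k ε (Sum.inl (Fin.last (M + 1)))) fun r => kaehlerMap (nilPull M N ε) (η r)) :
        Push k (Fin (M + 1 + 1)) (Fin N)) =
      Push.map Fin.castSuccEmb (Function.Embedding.refl _)
        (φ η : Push k (Fin (M + 1)) (Fin N))) ∧
  (∀ η : Fin (j + 1) → Ω[NilRing k M N ε⁄k],
    φ' (fun r => kaehlerMap (nilPull M N ε) (η r)) = 0)

/-- The indices of the terms of the system that defines the de Rham complex: the scheme `L^ε_M` and
the degree `j` of polyvector fields. -/
structure Stage where
  (M j N : ℕ)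
  (ε : Fin N → ℕ)

/-- The polyvector fields of degree `j` on `L^ε_M` with values in `i_• ω`. They contribute to the
term of the de Rham complex of degree `M - j`: as the relative dimension of `L^ε_{M+1}` over `L^ε_M`
is `1`, the transition maps raise `M` and `j` at the same time. -/
def DRTerm (k : Type u) [Field k] (x : Stage) : Type u :=
  PolyField k x.M x.N x.ε x.j

noncomputable instance (k : Type u) [Field k] (x : Stage) : AddCommGroup (DRTerm k x) :=
  inferInstanceAs (AddCommGroup (PolyField k x.M x.N x.ε x.j))

noncomputable instance (k : Type u) [Field k] (x : Stage) : Module k (DRTerm k x) :=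
  inferInstanceAs (Module k (PolyField k x.M x.N x.ε x.j))

open Classical in
/-- The inclusion of a term into the direct sum of all terms. -/
noncomputable def drIncl (k : Type u) [Field k] (M j N : ℕ) (ε : Fin N → ℕ) :
    PolyField k M N ε j →ₗ[k] ⨁ x : Stage, DRTerm k x :=
  DirectSum.lof k Stage (DRTerm k) ⟨M, j, N, ε⟩

/-- The relations that identify an element of a term with its image under the transition maps for
`(N, ε) ≤ (N', ε')` and for `(M, j) → (M + 1, j + 1)`, which generate the directed system. -/
noncomputable def drRel (k : Type u) [Field k] : Submodule k (⨁ x : Stage, DRTerm k x) :=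
  Submodule.span k
    ({z | ∃ (M j N N' : ℕ) (ε : Fin N → ℕ) (ε' : Fin N' → ℕ) (hN : N ≤ N')
        (h : ∀ n, ε n ≤ ε' (Fin.castLE hN n))
        (φ : PolyField k M N ε j) (φ' : PolyField k M N' ε' j),
        IsPushforward hN h φ φ' ∧ z = drIncl k M j N ε φ - drIncl k M j N' ε' φ'} ∪
      {z | ∃ (M j N : ℕ) (ε : Fin N → ℕ)
        (φ : PolyField k M N ε j) (φ' : PolyField k (M + 1) N ε (j + 1)),
        IsPullback φ φ' ∧ z = drIncl k M j N ε φ - drIncl k (M + 1) (j + 1) N ε φ'})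

/-- The underlying vector space (the direct sum of the terms of all degrees) of the de Rham complex
`DR (i_• p^• ω)` on the formal loop space of the affine line: the direct limit, over `M` and
`(N, ε)`, of the polyvector fields on `L^ε_M` with values in `i_• ω`. -/
abbrev DR (k : Type u) [Field k] : Type u := (⨁ x : Stage, DRTerm k x) ⧸ drRel k

/-- The class in the de Rham complex of a polyvector field on `L^ε_M` with values in `i_• ω`. -/
noncomputable def DR.cls {M j N : ℕ} {ε : Fin N → ℕ} (φ : PolyField k M N ε j) : DR k :=
  (drRel k).mkQ (drIncl k M j N ε φ)

/-! ### The right action of the Heisenberg and Clifford generators on polyvector fields -/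

/-- The exponent `l` of the coordinate `a_l`. -/
def Coord.exponent {M N : ℕ} : Coord M N → ℤ
  | Sum.inl m => ((m : ℕ) : ℤ)
  | Sum.inr n => -((n : ℕ) : ℤ) - 1

/-- `φ' = φ · ∂ / ∂ a`: the constant vector field acts on the values of `φ` at the forms `d a_l`. -/
def IsDerivative {M j N : ℕ} {ε : Fin N → ℕ} (c : Coord M N) (φ φ' : PolyField k M N ε j) : Prop :=
  ∀ e : Fin j → Coord M N,
    (φ' fun r => coordForm k ε (e r) : Push k (Fin (M + 1)) (Fin N)) =
      Push.mulRight (Weyl.d c) (φ fun r => coordForm k ε (e r) : Push k (Fin (M + 1)) (Fin N))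

/-- `φ'` is the contraction of `φ` with `d a`, from the right. -/
def IsContraction {M j N : ℕ} {ε : Fin N → ℕ} (c : Coord M N) (φ : PolyField k M N ε (j + 1))
    (φ' : PolyField k M N ε j) : Prop :=
  ∀ η : Fin j → Ω[NilRing k M N ε⁄k],
    φ' η = φ (Fin.snoc (α := fun _ => Ω[NilRing k M N ε⁄k]) η (coordForm k ε c))

open Classical in
/-- `φ' = φ ∧ ∂ / ∂ a`. -/
def IsWedge {M j N : ℕ} {ε : Fin N → ℕ} (c : Coord M N) (φ : PolyField k M N ε j)
    (φ' : PolyField k M N ε (j + 1)) : Prop :=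
  ∀ e : Fin (j + 1) → Coord M N,
    φ' (fun r => coordForm k ε (e r)) =
      ∑ i : Fin (j + 1), if e i = c then
        (-1 : ℤ) ^ (j - (i : ℕ)) • φ (fun r => coordForm k ε (e (i.succAbove r))) else 0

end DeRham

end ChiralDeRham

/-! Both parts rest on a triangular decomposition. The residue pairing is symmetric, and `k((t))` is
the sum of the isotropic subspaces `k[[t]]` and `t⁻¹k[t⁻¹]`, the first of which generates `CD⁺`.
Hence `Vac` is a Fock space `Λ(W) ⊗ Sym(W)`, where `W` consists of two copies of `t⁻¹k[t⁻¹]`, one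
from `V` and one from `V*`. Indeed `Polarization.ofFock`, which applies creation operators to the
vacuum vector, is onto because annihilation operators can be moved to the vacuum, and
`Polarization.toFock`, the action on `1 ⊗ 1`, is a left inverse. The complement `t⁻¹k[t⁻¹]` is the
same for `k[t, t⁻¹]`, so `vacMap` matches the two Fock parametrizations (`vacMap_ofFock`); this is
(a).

For (b), `i_• ω` is itself a bosonic Fock space: the `a_l` with `l ≥ 0` and the `∂ / ∂ a_l` with `l
< 0` create, their partners annihilate. Sending `a_l` to `t^{-l-1} dt` and `∂ / ∂ a_l` to `-t^l`
gives `Push.toVac`, injective in characteristic zero because iterated partial derivatives of a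
nonzero polynomial reach a nonzero constant. On the fermionic side, fields of degree `0` on `L^ε_M`
must be killed by contraction with every `da_l`, `l ≤ M`, whereas the vacuum vector is only known to
be killed by `t^{-l-1} dt` for `l < 0`. So the vacuum is first multiplied by `t^{-1}dt ⋯ t^{-M-1}dt`
(`Vac.fill`), and `v ⊗ ∂_{e_0} ∧ ⋯ ∧ ∂_{e_{j-1}}` goes to `v · fill · t^{e_0} ⋯ t^{e_{j-1}}`;
`DR.stageMap` is the averaged formula for an arbitrary field. Passing from `M` to `M + 1` inserts
`t^{-M-2}dt` and then `t^{M+1}`, which cancel (`Vac.fermionV_fill_succ`), so the stage maps glue to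
`DR.toVac`.

The forms `da_l`, `l < 0`, are torsion, with coefficients defined only modulo `a_l^{ε_l}`. After
enlarging `ε` this is harmless, and every class becomes a sum of elementary fields at one stage
(`DR.exists_mem_elementarySpan`). Injectivity follows by contracting down to degree zero, where
`Push.toVac_injective` applies. The image is everything since it contains the vacuum vector and is
stable under the generators. -/

namespace ChiralDeRham

/-! ### Relations and generators of the vacuum module -/

section VacuumModule

variable {k V L : Type*} [Field k] [AddCommGroup V] [Module k V] [AddCommGroup L] [Module k L]

theorem Heis.gen_mul_gen (B : L →ₗ[k] V →ₗ[k] k) (x y : V × L) :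
    Heis.gen B x * Heis.gen B y =
      Heis.gen B y * Heis.gen B x + algebraMap k (Heis B) (B x.2 y.1 - B y.2 x.1) := by
  have := RingQuot.mkAlgHom_rel k (HeisRel.comm (B := B) x y)
  rw [map_mul, map_add, map_mul, AlgHom.commutes] at this
  exact this

/-- The algebra map out of the Heisenberg algebra given by elements with the right commutators. -/
noncomputable def Heis.lift (B : L →ₗ[k] V →ₗ[k] k) {A : Type*} [Ring A] [Algebra k A]
    (f : V × L →ₗ[k] A)
    (h : ∀ x y, f x * f y = f y * f x + algebraMap k A (B x.2 y.1 - B y.2 x.1)) :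
    Heis B →ₐ[k] A :=
  RingQuot.liftAlgHom k ⟨TensorAlgebra.lift k f, by
    rintro _ _ ⟨x, y⟩
    simpa using h x y⟩

theorem Heis.lift_gen (B : L →ₗ[k] V →ₗ[k] k) {A : Type*} [Ring A] [Algebra k A]
    (f : V × L →ₗ[k] A)
    (h : ∀ x y, f x * f y = f y * f x + algebraMap k A (B x.2 y.1 - B y.2 x.1)) (x : V × L) :
    Heis.lift B f h (Heis.gen B x) = f x := by
  simp [Heis.lift, Heis.gen]

theorem Heis.adjoin_gen (B : L →ₗ[k] V →ₗ[k] k) :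
    Algebra.adjoin k (Set.range (Heis.gen B)) = ⊤ := by
  refine eq_top_iff.2 fun c _ => ?_
  obtain ⟨p, rfl⟩ := RingQuot.mkAlgHom_surjective k (HeisRel B) c
  induction p using TensorAlgebra.induction with
  | algebraMap r => rw [AlgHom.commutes]; exact Subalgebra.algebraMap_mem _ r
  | ι x => exact Algebra.subset_adjoin ⟨x, rfl⟩
  | mul a b ha hb => rw [map_mul]; exact mul_mem (ha trivial) (hb trivial)
  | add a b ha hb => rw [map_add]; exact add_mem (ha trivial) (hb trivial)

theorem pairingForm_apply (B : L →ₗ[k] V →ₗ[k] k) (x : V × L) : pairingForm B x = B x.2 x.1 := rfl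

theorem Cliff.ι_mul_ι_add_swap (B : L →ₗ[k] V →ₗ[k] k) (x y : V × L) :
    CliffordAlgebra.ι (pairingForm B) x * CliffordAlgebra.ι (pairingForm B) y +
      CliffordAlgebra.ι (pairingForm B) y * CliffordAlgebra.ι (pairingForm B) x =
      algebraMap k _ (B x.2 y.1 + B y.2 x.1) := by
  rw [CliffordAlgebra.ι_mul_ι_add_swap]
  congr 1
  simp only [QuadraticMap.polar, pairingForm_apply, Prod.snd_add, Prod.fst_add, map_add,
    LinearMap.add_apply]
  ring

theorem HeisCliff.boson_mul_boson (B : L →ₗ[k] V →ₗ[k] k) (x y : V × L) :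
    HeisCliff.boson B x * HeisCliff.boson B y =
      HeisCliff.boson B y * HeisCliff.boson B x + algebraMap k _ (B x.2 y.1 - B y.2 x.1) := by
  simp only [HeisCliff.boson, Algebra.TensorProduct.tmul_mul_tmul, one_mul, Heis.gen_mul_gen B x y,
    TensorProduct.tmul_add]
  congr 1
  rw [Algebra.TensorProduct.algebraMap_apply, Algebra.algebraMap_eq_smul_one,
    Algebra.algebraMap_eq_smul_one, TensorProduct.tmul_smul, TensorProduct.smul_tmul']

theorem HeisCliff.fermion_mul_fermion (B : L →ₗ[k] V →ₗ[k] k) (x y : V × L) :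
    HeisCliff.fermion B x * HeisCliff.fermion B y =
      -(HeisCliff.fermion B y * HeisCliff.fermion B x) + algebraMap k _ (B x.2 y.1 + B y.2 x.1) := by
  rw [eq_neg_add_iff_add_eq]
  simp only [HeisCliff.fermion, Algebra.TensorProduct.tmul_mul_tmul, one_mul,
    ← TensorProduct.add_tmul]
  rw [add_comm, Cliff.ι_mul_ι_add_swap, Algebra.TensorProduct.algebraMap_apply]

theorem HeisCliff.boson_mul_fermion (B : L →ₗ[k] V →ₗ[k] k) (x y : V × L) :
    HeisCliff.boson B x * HeisCliff.fermion B y = HeisCliff.fermion B y * HeisCliff.boson B x := by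
  simp only [HeisCliff.fermion, HeisCliff.boson, Algebra.TensorProduct.tmul_mul_tmul, one_mul,
    mul_one]

theorem HeisCliff.boson_add (B : L →ₗ[k] V →ₗ[k] k) (x y : V × L) :
    HeisCliff.boson B (x + y) = HeisCliff.boson B x + HeisCliff.boson B y := by
  simp [HeisCliff.boson, TensorProduct.tmul_add]

theorem HeisCliff.fermion_add (B : L →ₗ[k] V →ₗ[k] k) (x y : V × L) :
    HeisCliff.fermion B (x + y) = HeisCliff.fermion B x + HeisCliff.fermion B y := by
  simp [HeisCliff.fermion, TensorProduct.add_tmul]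

/-- The subalgebra generated by bosons and fermions is everything. -/
theorem HeisCliff.eq_top_of_mem (B : L →ₗ[k] V →ₗ[k] k) (S : Subalgebra k (HeisCliff B))
    (hb : ∀ x, HeisCliff.boson B x ∈ S) (hf : ∀ x, HeisCliff.fermion B x ∈ S) : S = ⊤ := by
  refine eq_top_iff.2 fun c _ => ?_
  have h1 : ∀ a : Cliff B, a ⊗ₜ[k] (1 : Heis B) ∈ S := fun a => by
    have : (⊤ : Subalgebra k (Cliff B)) ≤ S.comap Algebra.TensorProduct.includeLeft := by
      rw [← CliffordAlgebra.adjoin_range_ι, Algebra.adjoin_le_iff]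
      rintro _ ⟨x, rfl⟩
      exact hf x
    exact this trivial
  have h2 : ∀ a : Heis B, (1 : Cliff B) ⊗ₜ[k] a ∈ S := fun a => by
    have : (⊤ : Subalgebra k (Heis B)) ≤ S.comap Algebra.TensorProduct.includeRight := by
      rw [← Heis.adjoin_gen, Algebra.adjoin_le_iff]
      rintro _ ⟨x, rfl⟩
      exact hb x
    exact this trivial
  induction c using TensorProduct.induction_on with
  | zero => exact zero_mem S
  | tmul a b => simpa using S.mul_mem (h1 a) (h2 b)
  | add a b ha hb => exact S.add_mem (ha trivial) (hb trivial)

variable (B : L →ₗ[k] V →ₗ[k] k) (Vp : Submodule k V) (Lp : Submodule k L)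

/-- The vacuum vector. -/
noncomputable def VacuumModule.vac : VacuumModule B Vp Lp :=
  (HeisCliff.plus B Vp Lp).mkQ 1

theorem VacuumModule.mulRight_mkQ (c c' : HeisCliff B) :
    VacuumModule.mulRight B Vp Lp c ((HeisCliff.plus B Vp Lp).mkQ c') =
      (HeisCliff.plus B Vp Lp).mkQ (c' * c) := rfl

theorem VacuumModule.mulRight_vac (c : HeisCliff B) :
    VacuumModule.mulRight B Vp Lp c (VacuumModule.vac B Vp Lp) =
      (HeisCliff.plus B Vp Lp).mkQ c := by
  rw [VacuumModule.vac, VacuumModule.mulRight_mkQ, one_mul]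

theorem VacuumModule.mulRight_mul (c c' : HeisCliff B) (w : VacuumModule B Vp Lp) :
    VacuumModule.mulRight B Vp Lp (c * c') w =
      VacuumModule.mulRight B Vp Lp c' (VacuumModule.mulRight B Vp Lp c w) := by
  obtain ⟨w, rfl⟩ := Submodule.mkQ_surjective _ w
  simp only [VacuumModule.mulRight_mkQ, mul_assoc]

theorem VacuumModule.mulRight_add (c c' : HeisCliff B) (w : VacuumModule B Vp Lp) :
    VacuumModule.mulRight B Vp Lp (c + c') w =
      VacuumModule.mulRight B Vp Lp c w + VacuumModule.mulRight B Vp Lp c' w := by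
  obtain ⟨w, rfl⟩ := Submodule.mkQ_surjective _ w
  simp only [VacuumModule.mulRight_mkQ, mul_add, map_add]

theorem VacuumModule.mulRight_smul (a : k) (c : HeisCliff B) (w : VacuumModule B Vp Lp) :
    VacuumModule.mulRight B Vp Lp (a • c) w = a • VacuumModule.mulRight B Vp Lp c w := by
  obtain ⟨w, rfl⟩ := Submodule.mkQ_surjective _ w
  simp only [VacuumModule.mulRight_mkQ, mul_smul_comm, map_smul]

theorem VacuumModule.mulRight_one (w : VacuumModule B Vp Lp) :
    VacuumModule.mulRight B Vp Lp 1 w = w := by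
  obtain ⟨w, rfl⟩ := Submodule.mkQ_surjective _ w
  simp only [VacuumModule.mulRight_mkQ, mul_one]

theorem VacuumModule.mulRight_algebraMap (a : k) (w : VacuumModule B Vp Lp) :
    VacuumModule.mulRight B Vp Lp (algebraMap k _ a) w = a • w := by
  rw [Algebra.algebraMap_eq_smul_one, VacuumModule.mulRight_smul, VacuumModule.mulRight_one]

theorem VacuumModule.mulRight_neg (c : HeisCliff B) (w : VacuumModule B Vp Lp) :
    VacuumModule.mulRight B Vp Lp (-c) w = -VacuumModule.mulRight B Vp Lp c w := by
  rw [← neg_one_smul k c, VacuumModule.mulRight_smul, neg_one_smul]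

variable {B Vp Lp}

/-- Right multiplications compose in the opposite order, so the scalar is the negative of the
commutator of `x` and `y` in `D`. The fermionic scalar is symmetric and keeps its sign. -/
theorem VacuumModule.boson_boson (x y : V × L) (w : VacuumModule B Vp Lp) :
    VacuumModule.mulRight B Vp Lp (HeisCliff.boson B x)
        (VacuumModule.mulRight B Vp Lp (HeisCliff.boson B y) w) =
      VacuumModule.mulRight B Vp Lp (HeisCliff.boson B y)
        (VacuumModule.mulRight B Vp Lp (HeisCliff.boson B x) w) + (B y.2 x.1 - B x.2 y.1) • w := by
  rw [← VacuumModule.mulRight_mul, HeisCliff.boson_mul_boson, VacuumModule.mulRight_add,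
    VacuumModule.mulRight_algebraMap, VacuumModule.mulRight_mul]

theorem VacuumModule.fermion_fermion (x y : V × L) (w : VacuumModule B Vp Lp) :
    VacuumModule.mulRight B Vp Lp (HeisCliff.fermion B x)
        (VacuumModule.mulRight B Vp Lp (HeisCliff.fermion B y) w) =
      -VacuumModule.mulRight B Vp Lp (HeisCliff.fermion B y)
        (VacuumModule.mulRight B Vp Lp (HeisCliff.fermion B x) w) + (B y.2 x.1 + B x.2 y.1) • w := by
  rw [← VacuumModule.mulRight_mul, HeisCliff.fermion_mul_fermion, VacuumModule.mulRight_add,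
    VacuumModule.mulRight_algebraMap, VacuumModule.mulRight_neg, VacuumModule.mulRight_mul]

theorem VacuumModule.boson_fermion (x y : V × L) (w : VacuumModule B Vp Lp) :
    VacuumModule.mulRight B Vp Lp (HeisCliff.boson B x)
        (VacuumModule.mulRight B Vp Lp (HeisCliff.fermion B y) w) =
      VacuumModule.mulRight B Vp Lp (HeisCliff.fermion B y)
        (VacuumModule.mulRight B Vp Lp (HeisCliff.boson B x) w) := by
  rw [← VacuumModule.mulRight_mul, ← VacuumModule.mulRight_mul, HeisCliff.boson_mul_fermion]

theorem VacuumModule.boson_vac {x : V × L} (hx : x ∈ Vp.prod Lp) :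
    VacuumModule.mulRight B Vp Lp (HeisCliff.boson B x) (VacuumModule.vac B Vp Lp) = 0 := by
  rw [VacuumModule.mulRight_vac, Submodule.mkQ_apply, Submodule.Quotient.mk_eq_zero]
  exact Submodule.subset_span ⟨x, hx, 1, Or.inl (mul_one _).symm⟩

theorem VacuumModule.fermion_vac {x : V × L} (hx : x ∈ Vp.prod Lp) :
    VacuumModule.mulRight B Vp Lp (HeisCliff.fermion B x) (VacuumModule.vac B Vp Lp) = 0 := by
  rw [VacuumModule.mulRight_vac, Submodule.mkQ_apply, Submodule.Quotient.mk_eq_zero]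
  exact Submodule.subset_span ⟨x, hx, 1, Or.inr (mul_one _).symm⟩

/-- A subspace that contains the vacuum vector and is stable under the generators is everything. -/
theorem VacuumModule.eq_top_of_stable (R : Submodule k (VacuumModule B Vp Lp))
    (h0 : VacuumModule.vac B Vp Lp ∈ R)
    (hb : ∀ x, ∀ w ∈ R, VacuumModule.mulRight B Vp Lp (HeisCliff.boson B x) w ∈ R)
    (hf : ∀ x, ∀ w ∈ R, VacuumModule.mulRight B Vp Lp (HeisCliff.fermion B x) w ∈ R) : R = ⊤ := by
  let S : Subalgebra k (HeisCliff B) :=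
    { carrier := {c | ∀ w ∈ R, VacuumModule.mulRight B Vp Lp c w ∈ R}
      mul_mem' := fun {a b} ha hb w hw => by
        rw [VacuumModule.mulRight_mul]; exact hb _ (ha _ hw)
      add_mem' := fun {a b} ha hb w hw => by
        rw [VacuumModule.mulRight_add]; exact R.add_mem (ha _ hw) (hb _ hw)
      algebraMap_mem' := fun a w hw => by
        rw [VacuumModule.mulRight_algebraMap]; exact R.smul_mem _ hw }
  have hS : S = ⊤ := HeisCliff.eq_top_of_mem B S hb hf
  refine eq_top_iff.2 fun w _ => ?_
  obtain ⟨c, rfl⟩ := Submodule.mkQ_surjective _ w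
  rw [← VacuumModule.mulRight_vac]
  exact (show c ∈ S by rw [hS]; trivial) _ h0

end VacuumModule

/-! ### Polarizations and the Fock space model of the vacuum module -/

section Fock

variable {k V : Type*} [Field k] [AddCommGroup V] [Module k V]

/-- A splitting of `V` into `Vp` and a complement with basis indexed by `ℕ`, for which both parts
are isotropic. Here `u` gives the components in the complement, `n` is the inclusion of the
complement, and `d` is the pairing with it. -/
structure Polarization (B : V →ₗ[k] V →ₗ[k] k) (Vp : Submodule k V) where
  u : V →ₗ[k] (ℕ →₀ k)
  d : V →ₗ[k] Module.Dual k (ℕ →₀ k)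
  n : (ℕ →₀ k) →ₗ[k] V
  u_n (a : ℕ →₀ k) : u (n a) = a
  d_n (a : ℕ →₀ k) : d (n a) = 0
  u_eq_zero (v : V) (hv : v ∈ Vp) : u v = 0
  sub_mem (v : V) : v - n (u v) ∈ Vp
  pairing (l v : V) : B l v = d l (u v) + d v (u l)

/-- The space of creation operators. -/
abbrev NegPart (k : Type*) [Field k] : Type _ := (ℕ →₀ k) × (ℕ →₀ k)

/-- Linear forms as polynomials. -/
noncomputable def linForm (k : Type*) [Field k] : NegPart k →ₗ[k] MvPolynomial (ℕ ⊕ ℕ) k :=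
  (Finsupp.linearCombination k fun m => MvPolynomial.X (Sum.inl m)).coprod
    (Finsupp.linearCombination k fun m => MvPolynomial.X (Sum.inr m))

/-- The Fock space. -/
abbrev Fock (k : Type*) [Field k] : Type _ :=
  ExteriorAlgebra k (NegPart k) ⊗[k] MvPolynomial (ℕ ⊕ ℕ) k

namespace Polarization

variable {B : V →ₗ[k] V →ₗ[k] k} {Vp : Submodule k V} (P : Polarization B Vp)

/-- The creation part of a generator. -/
noncomputable def neg : V × V →ₗ[k] NegPart k := P.u.prodMap P.u

/-- The generator with given creation part. -/
noncomputable def incl : NegPart k →ₗ[k] V × V := P.n.prodMap P.n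

/-- The linear form on the creation part given by the symmetric pairing with a generator. -/
noncomputable def dual : V × V →ₗ[k] Module.Dual k (NegPart k) where
  toFun x := (P.d x.2).coprod (P.d x.1)
  map_add' x y := by ext <;> simp
  map_smul' c x := by ext <;> simp

theorem dual_apply (x : V × V) (a : NegPart k) : P.dual x a = P.d x.2 a.1 + P.d x.1 a.2 := rfl

theorem neg_incl (a : NegPart k) : P.neg (P.incl a) = a :=
  Prod.ext (P.u_n _) (P.u_n _)

theorem dual_incl (a : NegPart k) : P.dual (P.incl a) = 0 := by
  ext <;> simp [dual, incl, P.d_n]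

theorem sub_incl_neg_mem (x : V × V) : x - P.incl (P.neg x) ∈ Vp.prod Vp :=
  ⟨P.sub_mem _, P.sub_mem _⟩

/-- The annihilation part of the bosonic action, as a derivation. -/
noncomputable def der (x : V × V) :
    Derivation k (MvPolynomial (ℕ ⊕ ℕ) k) (MvPolynomial (ℕ ⊕ ℕ) k) :=
  MvPolynomial.mkDerivation k (Sum.elim
    (fun m => MvPolynomial.C (-P.d x.2 (Finsupp.single m 1)))
    (fun m => MvPolynomial.C (P.d x.1 (Finsupp.single m 1))))

theorem der_linForm (x : V × V) (a : NegPart k) :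
    P.der x (linForm k a) = MvPolynomial.C (P.d x.1 a.2 - P.d x.2 a.1) := by
  have : (P.der x).toLinearMap ∘ₗ linForm k =
      (Algebra.linearMap k (MvPolynomial (ℕ ⊕ ℕ) k)) ∘ₗ ((-P.d x.2).coprod (P.d x.1)) := by
    refine LinearMap.prod_ext (Finsupp.lhom_ext' fun m => LinearMap.ext_ring ?_)
      (Finsupp.lhom_ext' fun m => LinearMap.ext_ring ?_) <;>
      simp [linForm, der, MvPolynomial.mkDerivation_X, MvPolynomial.algebraMap_eq]
  have h := LinearMap.congr_fun this a
  simp only [LinearMap.comp_apply, LinearMap.coprod_apply, LinearMap.neg_apply,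
    Algebra.linearMap_apply] at h
  rw [sub_eq_neg_add]
  exact h

theorem der_comm (x y : V × V) (p : MvPolynomial (ℕ ⊕ ℕ) k) :
    P.der x (P.der y p) = P.der y (P.der x p) := by
  have h : ⁅P.der x, P.der y⁆ = 0 := by
    refine MvPolynomial.derivation_ext fun i => ?_
    rcases i with i | i <;> simp [der, Derivation.commutator_apply, MvPolynomial.mkDerivation_X]
  have := congrArg (fun E : Derivation k (MvPolynomial (ℕ ⊕ ℕ) k) _ => E p) h
  exact sub_eq_zero.1 (by simpa [Derivation.commutator_apply] using this)

/-- The bosonic action on polynomials. -/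
noncomputable def bosonOp : V × V →ₗ[k] Module.End k (MvPolynomial (ℕ ⊕ ℕ) k) where
  toFun x := LinearMap.mulLeft k (linForm k (P.neg x)) + (P.der x).toLinearMap
  map_add' x y := by
    have h : P.der (x + y) = P.der x + P.der y := by
      refine MvPolynomial.derivation_ext fun i => ?_
      rcases i with i | i <;> simp [der, MvPolynomial.mkDerivation_X, add_comm]
    refine LinearMap.ext fun p => ?_
    simp only [h, map_add, LinearMap.add_apply, LinearMap.mulLeft_apply, add_mul,
      Derivation.coeFn_coe, Derivation.add_apply]
    abel
  map_smul' c x := by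
    have h : P.der (c • x) = c • P.der x := by
      refine MvPolynomial.derivation_ext fun i => ?_
      rcases i with i | i <;> simp [der, MvPolynomial.mkDerivation_X, MvPolynomial.smul_eq_C_mul]
    refine LinearMap.ext fun p => ?_
    simp [h]

theorem bosonOp_apply (x : V × V) (p : MvPolynomial (ℕ ⊕ ℕ) k) :
    P.bosonOp x p = linForm k (P.neg x) * p + P.der x p := rfl

/-- The multiplications commute with each other and so do the derivations, so only the two cross
terms survive; these are scalars by `der_linForm`. The operator of `y` is outermost on the left
because the algebra acts from the right. -/
theorem bosonOp_bosonOp (x y : V × V) (p : MvPolynomial (ℕ ⊕ ℕ) k) :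
    P.bosonOp y (P.bosonOp x p) =
      P.bosonOp x (P.bosonOp y p) + (B x.2 y.1 - B y.2 x.1) • p := by
  have hx := P.der_linForm x (P.neg y)
  have hy := P.der_linForm y (P.neg x)
  simp only [bosonOp_apply, map_add, Derivation.leibniz, hx, hy, P.der_comm x y, P.pairing,
    smul_eq_mul, MvPolynomial.smul_eq_C_mul]
  simp only [neg, LinearMap.prodMap_apply, map_add, map_sub]
  ring

/-- The fermionic action on the exterior algebra. -/
noncomputable def fermionOp :
    V × V →ₗ[k] Module.End k (ExteriorAlgebra k (NegPart k)) :=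
  LinearMap.mul k (ExteriorAlgebra k (NegPart k)) ∘ₗ ExteriorAlgebra.ι k ∘ₗ P.neg +
    CliffordAlgebra.contractLeft ∘ₗ P.dual

theorem fermionOp_apply (x : V × V) (f : ExteriorAlgebra k (NegPart k)) :
    P.fermionOp x f = ExteriorAlgebra.ι k (P.neg x) * f +
      CliffordAlgebra.contractLeft (P.dual x) f := rfl

/-- Exterior multiplication and contraction square to zero, and their anticommutator is the scalar
`P.dual x (P.neg x)`, which is `B x.2 x.1` by `P.pairing`. This is the Clifford relation; a square
is insensitive to passing to the opposite algebra. -/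
theorem fermionOp_fermionOp (x : V × V) (f : ExteriorAlgebra k (NegPart k)) :
    P.fermionOp x (P.fermionOp x f) = pairingForm B x • f := by
  have h : CliffordAlgebra.contractLeft (P.dual x) (ExteriorAlgebra.ι k (P.neg x) * f) =
      P.dual x (P.neg x) • f -
        ExteriorAlgebra.ι k (P.neg x) * CliffordAlgebra.contractLeft (P.dual x) f :=
    CliffordAlgebra.contractLeft_ι_mul _ _ _
  simp only [fermionOp_apply, map_add, h, CliffordAlgebra.contractLeft_contractLeft]
  rw [← mul_assoc, ExteriorAlgebra.ι_sq_zero, pairingForm_apply, P.pairing, dual_apply]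
  simp [neg]

/-- The bosonic right action on the Fock space. -/
noncomputable def heisAct : Heis B →ₐ[k] (Module.End k (Fock k))ᵐᵒᵖ :=
  Heis.lift B (A := (Module.End k (Fock k))ᵐᵒᵖ)
    ((MulOpposite.opLinearEquiv k).toLinearMap ∘ₗ
      LinearMap.lTensorHom (ExteriorAlgebra k (NegPart k)) ∘ₗ P.bosonOp) <| by
    intro x y
    refine MulOpposite.unop_injective ?_
    refine TensorProduct.ext' fun f p => ?_
    simp [P.bosonOp_bosonOp x y p, TensorProduct.tmul_add, Algebra.algebraMap_eq_smul_one]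

/-- The fermionic right action on the Fock space. -/
noncomputable def cliffAct : Cliff B →ₐ[k] (Module.End k (Fock k))ᵐᵒᵖ :=
  CliffordAlgebra.lift (pairingForm B)
    ⟨(MulOpposite.opLinearEquiv k).toLinearMap ∘ₗ
      LinearMap.rTensorHom (MvPolynomial (ℕ ⊕ ℕ) k) ∘ₗ P.fermionOp, by
    intro x
    refine MulOpposite.unop_injective ?_
    refine TensorProduct.ext' fun f p => ?_
    simp [fermionOp_fermionOp, TensorProduct.smul_tmul', Algebra.algebraMap_eq_smul_one]⟩

theorem heisAct_gen (x : V × V) (f : ExteriorAlgebra k (NegPart k))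
    (p : MvPolynomial (ℕ ⊕ ℕ) k) :
    (P.heisAct (Heis.gen B x)).unop (f ⊗ₜ p) = f ⊗ₜ P.bosonOp x p := by
  rw [heisAct, Heis.lift_gen]
  rfl

theorem cliffAct_ι (x : V × V) (f : ExteriorAlgebra k (NegPart k))
    (p : MvPolynomial (ℕ ⊕ ℕ) k) :
    (P.cliffAct (CliffordAlgebra.ι _ x)).unop (f ⊗ₜ p) = P.fermionOp x f ⊗ₜ p := by
  rw [cliffAct, CliffordAlgebra.lift_ι_apply]
  rfl

/-- One action touches only the exterior factor, the other only the polynomial factor. A centralizer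
is a subalgebra, so it suffices to test generators, in one algebra after the other. -/
theorem commute_cliffAct_heisAct (a : Cliff B) (b : Heis B) :
    Commute (P.cliffAct a) (P.heisAct b) := by
  have hb : b ∈ (Subalgebra.centralizer k (Set.range P.cliffAct)).comap P.heisAct := by
    have : (⊤ : Subalgebra k (Heis B)) ≤
        (Subalgebra.centralizer k (Set.range P.cliffAct)).comap P.heisAct := by
      rw [← Heis.adjoin_gen, Algebra.adjoin_le_iff]
      rintro _ ⟨x, rfl⟩
      rintro _ ⟨a, rfl⟩
      have ha : a ∈ (Subalgebra.centralizer k {P.heisAct (Heis.gen B x)}).comap P.cliffAct := by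
        have : (⊤ : Subalgebra k (Cliff B)) ≤
            (Subalgebra.centralizer k {P.heisAct (Heis.gen B x)}).comap P.cliffAct := by
          rw [← CliffordAlgebra.adjoin_range_ι, Algebra.adjoin_le_iff]
          rintro _ ⟨y, rfl⟩
          rintro _ rfl
          refine MulOpposite.unop_injective ?_
          refine TensorProduct.ext' fun f p => ?_
          simp only [MulOpposite.unop_mul, Module.End.mul_apply]
          change (P.cliffAct _).unop _ = (P.heisAct _).unop ((P.cliffAct _).unop _)
          rw [P.heisAct_gen, P.cliffAct_ι, P.cliffAct_ι]
          exact (P.heisAct_gen _ _ _).symm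
        exact this trivial
      exact (ha _ rfl).symm
    exact this trivial
  exact hb _ ⟨a, rfl⟩

/-- The right action of the Heisenberg-Clifford algebra on the Fock space. -/
noncomputable def act : HeisCliff B →ₐ[k] (Module.End k (Fock k))ᵐᵒᵖ :=
  Algebra.TensorProduct.lift P.cliffAct P.heisAct P.commute_cliffAct_heisAct

theorem act_boson (x : V × V) (f : ExteriorAlgebra k (NegPart k))
    (p : MvPolynomial (ℕ ⊕ ℕ) k) :
    (P.act (HeisCliff.boson B x)).unop (f ⊗ₜ p) = f ⊗ₜ P.bosonOp x p := by
  rw [← P.heisAct_gen]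
  simp [act, HeisCliff.boson]

theorem act_fermion (x : V × V) (f : ExteriorAlgebra k (NegPart k))
    (p : MvPolynomial (ℕ ⊕ ℕ) k) :
    (P.act (HeisCliff.fermion B x)).unop (f ⊗ₜ p) = P.fermionOp x f ⊗ₜ p := by
  rw [← P.cliffAct_ι]
  simp [act, HeisCliff.fermion]

theorem neg_eq_zero {x : V × V} (hx : x ∈ Vp.prod Vp) : P.neg x = 0 :=
  Prod.ext (P.u_eq_zero _ hx.1) (P.u_eq_zero _ hx.2)

/-- The map from the vacuum module to the Fock space. -/
noncomputable def toFock : VacuumModule B Vp Vp →ₗ[k] Fock k :=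
  Submodule.liftQ _
    ((LinearMap.applyₗ (1 ⊗ₜ 1 : Fock k)) ∘ₗ (MulOpposite.opLinearEquiv k).symm.toLinearMap ∘ₗ
      P.act.toLinearMap) <| by
    refine Submodule.span_le.2 ?_
    rintro _ ⟨x, hx, c, rfl | rfl⟩
    · have h : (P.act (HeisCliff.boson B x)).unop (1 ⊗ₜ 1) = 0 := by
        rw [P.act_boson, bosonOp_apply, P.neg_eq_zero hx]
        simp
      simp [h]
    · have h : (P.act (HeisCliff.fermion B x)).unop (1 ⊗ₜ 1) = 0 := by
        rw [P.act_fermion, fermionOp_apply, P.neg_eq_zero hx]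
        simp
      simp [h]

theorem toFock_mkQ (c : HeisCliff B) :
    P.toFock ((HeisCliff.plus B Vp Vp).mkQ c) = (P.act c).unop (1 ⊗ₜ 1) := rfl

theorem toFock_mulRight (c : HeisCliff B) (w : VacuumModule B Vp Vp) :
    P.toFock (VacuumModule.mulRight B Vp Vp c w) = (P.act c).unop (P.toFock w) := by
  obtain ⟨w, rfl⟩ := Submodule.mkQ_surjective _ w
  rw [VacuumModule.mulRight_mkQ, toFock_mkQ, toFock_mkQ, map_mul]
  rfl

/-- Isotropy of the complement: the fermionic creation operators generate an image of an exterior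
algebra. -/
theorem incl_anticomm (a : NegPart k) :
    pairingForm B (P.incl a) = 0 := by
  rw [pairingForm_apply, P.pairing]
  simp [incl, P.d_n]

/-- Exterior polynomials in the creation operators. -/
noncomputable def extIncl : ExteriorAlgebra k (NegPart k) →ₐ[k] (Cliff B)ᵐᵒᵖ :=
  ExteriorAlgebra.lift k ⟨(MulOpposite.opLinearEquiv k).toLinearMap ∘ₗ
    CliffordAlgebra.ι (pairingForm B) ∘ₗ P.incl, fun a => by
      simp [← MulOpposite.op_mul, incl_anticomm]⟩

theorem extIncl_ι (a : NegPart k) :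
    P.extIncl (ExteriorAlgebra.ι k a) = MulOpposite.op (CliffordAlgebra.ι _ (P.incl a)) := by
  simp [extIncl]

/-- Polynomials in the creation operators. -/
noncomputable def polyIncl : MvPolynomial (ℕ ⊕ ℕ) k →ₐ[k] Heis B :=
  commLift (Sum.elim (fun m => Heis.gen B (P.incl (Finsupp.single m 1, 0)))
    (fun m => Heis.gen B (P.incl (0, Finsupp.single m 1)))) <| by
    have key (a b : NegPart k) : Heis.gen B (P.incl a) * Heis.gen B (P.incl b) =
        Heis.gen B (P.incl b) * Heis.gen B (P.incl a) := by
      rw [Heis.gen_mul_gen, P.pairing, P.pairing]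
      simp [incl, P.d_n]
    rintro (i | i) (j | j) <;> exact key _ _

theorem polyIncl_linForm (a : NegPart k) : P.polyIncl (linForm k a) = Heis.gen B (P.incl a) := by
  have : P.polyIncl.toLinearMap ∘ₗ linForm k = Heis.gen B ∘ₗ P.incl := by
    refine LinearMap.prod_ext (Finsupp.lhom_ext' fun m => LinearMap.ext_ring ?_)
      (Finsupp.lhom_ext' fun m => LinearMap.ext_ring ?_) <;>
      simp [linForm, polyIncl, commLift_X]
  exact LinearMap.congr_fun this a

/-- The map from the Fock space to the vacuum module. -/
noncomputable def ofFock : Fock k →ₗ[k] VacuumModule B Vp Vp :=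
  (HeisCliff.plus B Vp Vp).mkQ ∘ₗ
    TensorProduct.map ((MulOpposite.opLinearEquiv k).symm.toLinearMap ∘ₗ P.extIncl.toLinearMap)
      P.polyIncl.toLinearMap

theorem ofFock_tmul (f : ExteriorAlgebra k (NegPart k)) (p : MvPolynomial (ℕ ⊕ ℕ) k) :
    P.ofFock (f ⊗ₜ p) =
      (HeisCliff.plus B Vp Vp).mkQ ((P.extIncl f).unop ⊗ₜ P.polyIncl p) := rfl

theorem ofFock_one : P.ofFock (1 ⊗ₜ 1) = VacuumModule.vac B Vp Vp := by
  rw [ofFock_tmul, map_one, map_one]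
  rfl

theorem ofFock_linForm_mul (a : NegPart k) (f : ExteriorAlgebra k (NegPart k))
    (p : MvPolynomial (ℕ ⊕ ℕ) k) :
    P.ofFock (f ⊗ₜ (linForm k a * p)) =
      VacuumModule.mulRight B Vp Vp (HeisCliff.boson B (P.incl a)) (P.ofFock (f ⊗ₜ p)) := by
  rw [mul_comm, ofFock_tmul, map_mul, polyIncl_linForm, ofFock_tmul, VacuumModule.mulRight_mkQ,
    HeisCliff.boson, Algebra.TensorProduct.tmul_mul_tmul, mul_one]

/-- Left multiplication on the Fock space becomes right multiplication in `C`, which is why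
`extIncl` takes values in the opposite algebra. Polynomials commute and need no such twist. -/
theorem ofFock_ι_mul (a : NegPart k) (f : ExteriorAlgebra k (NegPart k))
    (p : MvPolynomial (ℕ ⊕ ℕ) k) :
    P.ofFock ((ExteriorAlgebra.ι k a * f) ⊗ₜ p) =
      VacuumModule.mulRight B Vp Vp (HeisCliff.fermion B (P.incl a)) (P.ofFock (f ⊗ₜ p)) := by
  rw [ofFock_tmul, map_mul, extIncl_ι, ofFock_tmul, VacuumModule.mulRight_mkQ,
    HeisCliff.fermion, Algebra.TensorProduct.tmul_mul_tmul, mul_one]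
  rfl

theorem exteriorAlgebra_induction {M : Type*} [AddCommGroup M] [Module k M]
    {C : ExteriorAlgebra k M → Prop} (one : C 1) (smul : ∀ (r : k) f, C f → C (r • f))
    (add : ∀ f g, C f → C g → C (f + g))
    (ι_mul : ∀ f m, C f → C (ExteriorAlgebra.ι k m * f)) (f : ExteriorAlgebra k M) : C f := by
  induction f using CliffordAlgebra.left_induction with
  | algebraMap r =>
    rw [Algebra.algebraMap_eq_smul_one]
    exact smul r 1 one
  | add f g hf hg => exact add f g hf hg
  | ι_mul f m hf => exact ι_mul f m hf

/-- Induction on polynomials in the creation operators. -/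
theorem linForm_induction {C : MvPolynomial (ℕ ⊕ ℕ) k → Prop} (one : C 1)
    (smul : ∀ (r : k) p, C p → C (r • p)) (add : ∀ p q, C p → C q → C (p + q))
    (inl_mul : ∀ p m, C p → C (linForm k (Finsupp.single m 1, 0) * p))
    (inr_mul : ∀ p m, C p → C (linForm k (0, Finsupp.single m 1) * p))
    (p : MvPolynomial (ℕ ⊕ ℕ) k) : C p := by
  induction p using MvPolynomial.induction_on with
  | C r =>
    rw [← mul_one (MvPolynomial.C r), ← MvPolynomial.smul_eq_C_mul]
    exact smul r 1 one
  | add p q hp hq => exact add p q hp hq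
  | mul_X p i hp =>
    rw [mul_comm]
    rcases i with m | m
    · simpa [linForm] using inl_mul p m hp
    · simpa [linForm] using inr_mul p m hp

/-- An element of `Vp` kills the vacuum vector, so its action is determined by its commutators with
the creation operators: zero for the fermionic ones, the scalars of `der_linForm` for the bosonic
ones. Such an operator is a derivation. -/
theorem ofFock_boson_of_mem {x : V × V} (hx : x ∈ Vp.prod Vp)
    (f : ExteriorAlgebra k (NegPart k)) (p : MvPolynomial (ℕ ⊕ ℕ) k) :
    VacuumModule.mulRight B Vp Vp (HeisCliff.boson B x) (P.ofFock (f ⊗ₜ p)) =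
      P.ofFock (f ⊗ₜ P.der x p) := by
  have hmul (a : NegPart k) (p : MvPolynomial (ℕ ⊕ ℕ) k)
      (ih : VacuumModule.mulRight B Vp Vp (HeisCliff.boson B x) (P.ofFock (f ⊗ₜ p)) =
        P.ofFock (f ⊗ₜ P.der x p)) :
      VacuumModule.mulRight B Vp Vp (HeisCliff.boson B x) (P.ofFock (f ⊗ₜ (linForm k a * p))) =
        P.ofFock (f ⊗ₜ P.der x (linForm k a * p)) := by
    have h1 : P.u x.1 = 0 := P.u_eq_zero _ hx.1
    have h2 : P.u x.2 = 0 := P.u_eq_zero _ hx.2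
    rw [ofFock_linForm_mul, VacuumModule.boson_boson, ih, Derivation.leibniz, smul_eq_mul,
      TensorProduct.tmul_add, map_add, ofFock_linForm_mul, P.der_linForm, smul_eq_mul, mul_comm p,
      ← MvPolynomial.smul_eq_C_mul, TensorProduct.tmul_smul, map_smul, P.pairing, P.pairing]
    congr 2
    simp [incl, P.d_n, P.u_n, h1, h2]
  induction p using linForm_induction with
  | one =>
    -- For `p = 1` the derivative is zero, and `x` only has to be moved past the fermions to the
    -- vacuum vector.
    clear hmul
    rw [Derivation.map_one_eq_zero, TensorProduct.tmul_zero, map_zero]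
    induction f using exteriorAlgebra_induction with
    | one => rw [ofFock_one, VacuumModule.boson_vac hx]
    | smul r f ih => rw [← TensorProduct.smul_tmul', map_smul, map_smul, ih, smul_zero]
    | add f g hf hg => rw [TensorProduct.add_tmul, map_add, map_add, hf, hg, add_zero]
    | ι_mul f m ih => rw [ofFock_ι_mul, VacuumModule.boson_fermion, ih, map_zero]
  | smul r p ih => rw [Derivation.map_smul, TensorProduct.tmul_smul, TensorProduct.tmul_smul, map_smul,
      map_smul, map_smul, ih]
  | add p q hp hq => rw [map_add, TensorProduct.tmul_add, TensorProduct.tmul_add, map_add,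
      map_add, map_add, hp, hq]
  | inl_mul p m ih => exact hmul _ _ ih
  | inr_mul p m ih => exact hmul _ _ ih

/-- As in the bosonic case, with anticommutators: crossing a fermionic creation operator produces
the sign and the scalar of the contraction rule. -/
theorem ofFock_fermion_of_mem {x : V × V} (hx : x ∈ Vp.prod Vp)
    (f : ExteriorAlgebra k (NegPart k)) (p : MvPolynomial (ℕ ⊕ ℕ) k) :
    VacuumModule.mulRight B Vp Vp (HeisCliff.fermion B x) (P.ofFock (f ⊗ₜ p)) =
      P.ofFock (CliffordAlgebra.contractLeft (P.dual x) f ⊗ₜ p) := by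
  induction f using exteriorAlgebra_induction with
  | one =>
    rw [CliffordAlgebra.contractLeft_one, TensorProduct.zero_tmul, map_zero]
    induction p using linForm_induction with
    | one => rw [ofFock_one, VacuumModule.fermion_vac hx]
    | smul r p ih => rw [TensorProduct.tmul_smul, map_smul, map_smul, ih, smul_zero]
    | add p q hp hq => rw [TensorProduct.tmul_add, map_add, map_add, hp, hq, add_zero]
    | inl_mul p m ih => rw [ofFock_linForm_mul, ← VacuumModule.boson_fermion, ih, map_zero]
    | inr_mul p m ih => rw [ofFock_linForm_mul, ← VacuumModule.boson_fermion, ih, map_zero]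
  | smul r f ih => rw [map_smul, ← TensorProduct.smul_tmul', ← TensorProduct.smul_tmul', map_smul,
      map_smul, map_smul, ih]
  | add f g hf hg => rw [map_add, TensorProduct.add_tmul, TensorProduct.add_tmul, map_add,
      map_add, map_add, hf, hg]
  | ι_mul f m ih =>
    have h : CliffordAlgebra.contractLeft (P.dual x) (ExteriorAlgebra.ι k m * f) =
        P.dual x m • f -
          ExteriorAlgebra.ι k m * CliffordAlgebra.contractLeft (P.dual x) f :=
      CliffordAlgebra.contractLeft_ι_mul _ _ _
    have h1 : P.u x.1 = 0 := P.u_eq_zero _ hx.1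
    have h2 : P.u x.2 = 0 := P.u_eq_zero _ hx.2
    rw [ofFock_ι_mul, VacuumModule.fermion_fermion, ih, h, TensorProduct.sub_tmul, map_sub,
      ofFock_ι_mul, ← TensorProduct.smul_tmul', map_smul, P.pairing, P.pairing, dual_apply,
      sub_eq_neg_add]
    congr 2
    simp [incl, P.d_n, P.u_n, h1, h2, add_comm]

/-- The Fock space maps onto the vacuum module. -/
theorem ofFock_surjective : Function.Surjective P.ofFock := by
  rw [← LinearMap.range_eq_top]
  refine VacuumModule.eq_top_of_stable _ ⟨_, P.ofFock_one⟩ ?_ ?_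
  · rintro x _ ⟨z, rfl⟩
    -- A creation part and a remainder in `Vp`: the first multiplies, the second differentiates (or,
    -- for fermions, contracts), and both preserve the range.
    have hx : x = P.incl (P.neg x) + (x - P.incl (P.neg x)) := by abel
    induction z using TensorProduct.induction_on with
    | zero => simp
    | add a b ha hb => rw [map_add, map_add]; exact Submodule.add_mem _ ha hb
    | tmul f p =>
      rw [hx, HeisCliff.boson_add, VacuumModule.mulRight_add, ← ofFock_linForm_mul,
        P.ofFock_boson_of_mem (P.sub_incl_neg_mem x)]
      exact Submodule.add_mem _ ⟨_, rfl⟩ ⟨_, rfl⟩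
  · rintro x _ ⟨z, rfl⟩
    have hx : x = P.incl (P.neg x) + (x - P.incl (P.neg x)) := by abel
    induction z using TensorProduct.induction_on with
    | zero => simp
    | add a b ha hb => rw [map_add, map_add]; exact Submodule.add_mem _ ha hb
    | tmul f p =>
      rw [hx, HeisCliff.fermion_add, VacuumModule.mulRight_add, ← ofFock_ι_mul,
        P.ofFock_fermion_of_mem (P.sub_incl_neg_mem x)]
      exact Submodule.add_mem _ ⟨_, rfl⟩ ⟨_, rfl⟩

/-- Creation operators have no annihilation part (`d_n`, `dual_incl`), so on the Fock space they are
pure multiplications and rebuild `f ⊗ p` from `1 ⊗ 1`. -/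
theorem toFock_ofFock (z : Fock k) : P.toFock (P.ofFock z) = z := by
  have hlin (a : NegPart k) (f : ExteriorAlgebra k (NegPart k)) (p : MvPolynomial (ℕ ⊕ ℕ) k)
      (ih : P.toFock (P.ofFock (f ⊗ₜ p)) = f ⊗ₜ p) :
      P.toFock (P.ofFock (f ⊗ₜ (linForm k a * p))) = f ⊗ₜ (linForm k a * p) := by
    have h : P.der (P.incl a) = 0 := by
      refine MvPolynomial.derivation_ext fun i => ?_
      rcases i with i | i <;> simp [der, MvPolynomial.mkDerivation_X, incl, P.d_n]
    rw [ofFock_linForm_mul, toFock_mulRight, ih, act_boson, bosonOp_apply, P.neg_incl, h,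
      Derivation.zero_apply, add_zero]
  induction z using TensorProduct.induction_on with
  | zero => simp
  | add a b ha hb => rw [map_add, map_add, ha, hb]
  | tmul f p =>
    induction p using linForm_induction with
    | one =>
      induction f using exteriorAlgebra_induction with
      | one => rw [ofFock_one, VacuumModule.vac, toFock_mkQ, map_one]; rfl
      | smul r f ih => rw [← TensorProduct.smul_tmul', map_smul, map_smul, ih]
      | add f g hf hg => rw [TensorProduct.add_tmul, map_add, map_add, hf, hg]
      | ι_mul f m ih =>
        rw [ofFock_ι_mul, toFock_mulRight, ih, act_fermion, fermionOp_apply, P.neg_incl,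
          P.dual_incl, map_zero, LinearMap.zero_apply, add_zero]
    | smul r p ih => rw [TensorProduct.tmul_smul, map_smul, map_smul, ih]
    | add p q hp hq => rw [TensorProduct.tmul_add, map_add, map_add, hp, hq]
    | inl_mul p m ih => exact hlin _ _ _ ih
    | inr_mul p m ih => exact hlin _ _ _ ih

theorem vac_ne_zero (P : Polarization B Vp) : VacuumModule.vac B Vp Vp ≠ 0 := by
  intro h
  have h1 := P.toFock_ofFock (1 ⊗ₜ 1)
  rw [ofFock_one, h, map_zero] at h1
  -- The product of the augmentations of the two factors sends `1 ⊗ 1` to `1`.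
  have h2 := congrArg (Algebra.TensorProduct.lift
    (ExteriorAlgebra.algebraMapInv (R := k) (M := NegPart k))
    (MvPolynomial.aeval (fun _ : ℕ ⊕ ℕ => (0 : k))) fun _ _ => Commute.all _ _) h1
  simp at h2

/-- A subspace that contains the vacuum vector and is stable under the creation operators is
everything. -/
theorem eq_top_of_stable (R : Submodule k (VacuumModule B Vp Vp))
    (h0 : VacuumModule.vac B Vp Vp ∈ R)
    (hbV : ∀ m, ∀ w ∈ R, VacuumModule.mulRight B Vp Vp
      (HeisCliff.boson B (P.n (Finsupp.single m 1), 0)) w ∈ R)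
    (hbL : ∀ m, ∀ w ∈ R, VacuumModule.mulRight B Vp Vp
      (HeisCliff.boson B (0, P.n (Finsupp.single m 1))) w ∈ R)
    (hfV : ∀ m, ∀ w ∈ R, VacuumModule.mulRight B Vp Vp
      (HeisCliff.fermion B (P.n (Finsupp.single m 1), 0)) w ∈ R)
    (hfL : ∀ m, ∀ w ∈ R, VacuumModule.mulRight B Vp Vp
      (HeisCliff.fermion B (0, P.n (Finsupp.single m 1))) w ∈ R) : R = ⊤ := by
  have hf (w) (hw : w ∈ R) (a : NegPart k) :
      VacuumModule.mulRight B Vp Vp (HeisCliff.fermion B (P.incl a)) w ∈ R := by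
    -- Stability is assumed for basis vectors only, while induction on the exterior algebra uses
    -- arbitrary vectors; linearity in the generator bridges the gap. Polynomials are built from
    -- variables, so bosons need no such step.
    let g : NegPart k →ₗ[k] VacuumModule B Vp Vp :=
      { toFun a := VacuumModule.mulRight B Vp Vp (HeisCliff.fermion B (P.incl a)) w
        map_add' a b := by
          rw [map_add, HeisCliff.fermion_add, VacuumModule.mulRight_add]
        map_smul' c a := by
          rw [RingHom.id_apply, ← VacuumModule.mulRight_smul]
          congr 1
          simp [HeisCliff.fermion, TensorProduct.smul_tmul'] }
    have h1 (a : ℕ →₀ k) : g (a, 0) ∈ R := by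
      induction a using Finsupp.induction_linear with
      | zero => rw [show ((0 : ℕ →₀ k), (0 : ℕ →₀ k)) = 0 from rfl, map_zero]; exact R.zero_mem
      | add a b ha hb =>
        rw [show (a + b, (0 : ℕ →₀ k)) = (a, 0) + (b, 0) by simp, map_add]
        exact R.add_mem ha hb
      | single m c =>
        rw [show (Finsupp.single m c, (0 : ℕ →₀ k)) = c • (Finsupp.single m 1, 0) by simp, map_smul]
        refine R.smul_mem _ ?_
        simpa [g, incl] using hfV m w hw
    have h2 (a : ℕ →₀ k) : g (0, a) ∈ R := by
      induction a using Finsupp.induction_linear with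
      | zero => rw [show ((0 : ℕ →₀ k), (0 : ℕ →₀ k)) = 0 from rfl, map_zero]; exact R.zero_mem
      | add a b ha hb =>
        rw [show ((0 : ℕ →₀ k), a + b) = (0, a) + (0, b) by simp, map_add]
        exact R.add_mem ha hb
      | single m c =>
        rw [show ((0 : ℕ →₀ k), Finsupp.single m c) = c • (0, Finsupp.single m 1) by simp, map_smul]
        refine R.smul_mem _ ?_
        simpa [g, incl] using hfL m w hw
    have : g a = g (a.1, 0) + g (0, a.2) := by rw [← map_add]; simp
    exact this ▸ R.add_mem (h1 _) (h2 _)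
  refine eq_top_iff.2 fun w _ => ?_
  obtain ⟨z, rfl⟩ := P.ofFock_surjective w
  induction z using TensorProduct.induction_on with
  | zero => simp
  | add a b ha hb => rw [map_add]; exact R.add_mem (ha trivial) (hb trivial)
  | tmul f p =>
    induction p using linForm_induction with
    | one =>
      induction f using exteriorAlgebra_induction with
      | one => rwa [ofFock_one]
      | smul r f ih => rw [← TensorProduct.smul_tmul', map_smul]; exact R.smul_mem _ (ih trivial)
      | add f g hf hg =>
        rw [TensorProduct.add_tmul, map_add]; exact R.add_mem (hf trivial) (hg trivial)
      | ι_mul f m ih => rw [ofFock_ι_mul]; exact hf _ (ih trivial) _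
    | smul r p ih => rw [TensorProduct.tmul_smul, map_smul]; exact R.smul_mem _ (ih trivial)
    | add p q hp hq =>
      rw [TensorProduct.tmul_add, map_add]; exact R.add_mem (hp trivial) (hq trivial)
    | inl_mul p m ih =>
      rw [ofFock_linForm_mul]
      simpa [incl] using hbV m _ (ih trivial)
    | inr_mul p m ih =>
      rw [ofFock_linForm_mul]
      simpa [incl] using hbL m _ (ih trivial)

end Polarization

end Fock

/-! ### Polarizations of `k((t))` and `k[t, t⁻¹]`; proof of (a) -/

section LaurentPolarization

variable (k : Type u) [Field k]

theorem resPairing_apply (l v : LaurentSeries k) : resPairing k l v = (v * l).coeff (-1) := rfl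

/-- With `g dt` written as `g`, the pairing is symmetric; hence one splitting serves both `V` and
`V*`. -/
theorem resPairing_comm (l v : LaurentSeries k) : resPairing k l v = resPairing k v l := by
  rw [resPairing_apply, resPairing_apply, mul_comm]

theorem resPairing_single (l : LaurentSeries k) (n : ℤ) :
    resPairing k l (HahnSeries.single n 1) = l.coeff (-n - 1) := by
  have := HahnSeries.coeff_single_mul_add (r := (1 : k)) (x := l) (a := -n - 1) (b := n)
  rw [show -n - 1 + n = -1 by ring, one_mul] at this
  rwa [resPairing_apply]

/-- The polar part of a Laurent series. -/
noncomputable def polarCoeff : LaurentSeries k →ₗ[k] (ℕ →₀ k) where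
  toFun f := Finsupp.ofSupportFinite (fun m : ℕ => f.coeff (-(m : ℤ) - 1)) <| by
    refine (Set.finite_Iic (-f.order).toNat).subset fun m hm => ?_
    by_contra h
    refine hm (HahnSeries.coeff_eq_zero_of_lt_order ?_)
    simp only [Set.mem_Iic] at h
    omega
  map_add' f g := Finsupp.ext fun m => HahnSeries.coeff_add
  map_smul' c f := Finsupp.ext fun m => HahnSeries.coeff_smul

theorem polarCoeff_apply (f : LaurentSeries k) (m : ℕ) :
    polarCoeff k f m = f.coeff (-(m : ℤ) - 1) := rfl

/-- The pairing of a Laurent series with polar parts. -/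
noncomputable def regularPairing : LaurentSeries k →ₗ[k] Module.Dual k (ℕ →₀ k) where
  toFun f := Finsupp.linearCombination k fun m : ℕ => f.coeff (m : ℤ)
  map_add' f g := by ext; simp
  map_smul' c f := by ext; simp

theorem regularPairing_single (f : LaurentSeries k) (m : ℕ) :
    regularPairing k f (Finsupp.single m 1) = f.coeff m := by
  simp [regularPairing]

/-- The inclusion of polar parts. -/
noncomputable def polarIncl : (ℕ →₀ k) →ₗ[k] LaurentSeries k :=
  Finsupp.linearCombination k fun m : ℕ => HahnSeries.single (-(m : ℤ) - 1) (1 : k)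

theorem polarIncl_single (m : ℕ) :
    polarIncl k (Finsupp.single m 1) = HahnSeries.single (-(m : ℤ) - 1) (1 : k) := by
  simp [polarIncl]

theorem polarCoeff_polarIncl (a : ℕ →₀ k) : polarCoeff k (polarIncl k a) = a := by
  have : polarCoeff k ∘ₗ polarIncl k = LinearMap.id := by
    refine Finsupp.lhom_ext' fun m => LinearMap.ext_ring (Finsupp.ext fun m' => ?_)
    simp only [LinearMap.comp_apply, Finsupp.lsingle_apply, polarIncl_single, polarCoeff_apply,
      HahnSeries.coeff_single, LinearMap.id_apply, Finsupp.single_apply]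
    congr 1
    rw [eq_iff_iff]
    omega
  exact LinearMap.congr_fun this a

theorem regularPairing_polarIncl (a : ℕ →₀ k) : regularPairing k (polarIncl k a) = 0 := by
  have : regularPairing k ∘ₗ polarIncl k = 0 := by
    refine Finsupp.lhom_ext' fun m => LinearMap.ext_ring
      (Finsupp.lhom_ext' fun m' => LinearMap.ext_ring ?_)
    simp only [LinearMap.comp_apply, Finsupp.lsingle_apply, polarIncl_single,
      regularPairing_single, LinearMap.zero_apply]
    exact HahnSeries.coeff_single_of_ne (by omega)
  exact LinearMap.congr_fun this a

theorem sub_polarIncl_mem (f : LaurentSeries k) :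
    f - polarIncl k (polarCoeff k f) ∈ taylorPart k := by
  intro n hn
  have h := DFunLike.congr_fun (polarCoeff_polarIncl k (polarCoeff k f)) (-n - 1).toNat
  rw [polarCoeff_apply, polarCoeff_apply, show -((-n - 1).toNat : ℤ) - 1 = n by omega] at h
  simp [h]

theorem resPairing_polarIncl (l : LaurentSeries k) (a : ℕ →₀ k) :
    resPairing k l (polarIncl k a) = regularPairing k l a := by
  have : resPairing k l ∘ₗ polarIncl k = regularPairing k l := by
    refine Finsupp.lhom_ext' fun m => LinearMap.ext_ring ?_
    simp only [LinearMap.comp_apply, Finsupp.lsingle_apply, polarIncl_single,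
      regularPairing_single, resPairing_single]
    congr 1
    omega
  exact LinearMap.congr_fun this a

theorem resPairing_of_mem {l v : LaurentSeries k} (hl : l ∈ taylorPart k) (hv : v ∈ taylorPart k) :
    resPairing k l v = 0 := by
  rw [resPairing_apply, HahnSeries.coeff_mul]
  refine Finset.sum_eq_zero fun ij hij => ?_
  rw [Finset.mem_antidiagonal] at hij
  rcases lt_or_ge ij.1 0 with h | h
  · rw [hv _ h, zero_mul]
  · rw [hl _ (by omega), mul_zero]

/-- The splitting of `k((t))` into `k[[t]]` and `t⁻¹ k[t⁻¹]`. -/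
noncomputable def laurentPolarization : Polarization (resPairing k) (taylorPart k) where
  u := polarCoeff k
  d := regularPairing k
  n := polarIncl k
  u_n := polarCoeff_polarIncl k
  d_n := regularPairing_polarIncl k
  u_eq_zero f hf := Finsupp.ext fun m => hf (-(m : ℤ) - 1) (by omega)
  sub_mem := sub_polarIncl_mem k
  pairing l v := by
    -- The polar part of each argument is split off in turn. Two Taylor parts have no residue, nor
    -- do two polar parts (`regularPairing_polarIncl`), so only the mixed terms remain.
    have h1 : resPairing k l v =
        resPairing k l (v - polarIncl k (polarCoeff k v)) + regularPairing k l (polarCoeff k v) := by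
      rw [map_sub, resPairing_polarIncl, sub_add_cancel]
    have h2 : resPairing k (v - polarIncl k (polarCoeff k v)) l =
        resPairing k (v - polarIncl k (polarCoeff k v)) (l - polarIncl k (polarCoeff k l)) +
          regularPairing k (v - polarIncl k (polarCoeff k v)) (polarCoeff k l) := by
      rw [map_sub (resPairing k _), resPairing_polarIncl, sub_add_cancel]
    rw [h1, resPairing_comm, h2,
      resPairing_of_mem k (sub_polarIncl_mem k _) (sub_polarIncl_mem k _), zero_add,
      map_sub (regularPairing k), regularPairing_polarIncl, sub_zero, add_comm]

theorem laurentIncl_T (n : ℤ) :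
    laurentIncl k (LaurentPolynomial.T n) = HahnSeries.single n 1 := by
  ext m
  change Finsupp.single n (1 : k) m = _
  rw [HahnSeries.coeff_single, Finsupp.single_apply]
  simp only [eq_comm]

/-- The splitting of `k[t, t⁻¹]` into `k[t]` and `t⁻¹ k[t⁻¹]`. -/
noncomputable def laurentPolyPolarization :
    Polarization (resPairingPoly k) ((taylorPart k).comap (laurentIncl k)) :=
  let n : (ℕ →₀ k) →ₗ[k] LaurentPolynomial k :=
    Finsupp.linearCombination k fun m : ℕ => LaurentPolynomial.T (-(m : ℤ) - 1)
  have hn (a : ℕ →₀ k) : laurentIncl k (n a) = polarIncl k a := by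
    have : laurentIncl k ∘ₗ n = polarIncl k := by
      refine Finsupp.lhom_ext' fun m => LinearMap.ext_ring ?_
      simp [n, laurentIncl_T, polarIncl_single]
    exact LinearMap.congr_fun this a
  { u := polarCoeff k ∘ₗ laurentIncl k
    d := regularPairing k ∘ₗ laurentIncl k
    n := n
    u_n a := by rw [LinearMap.comp_apply, hn, polarCoeff_polarIncl]
    d_n a := by rw [LinearMap.comp_apply, hn, regularPairing_polarIncl]
    u_eq_zero v hv := (laurentPolarization k).u_eq_zero _ hv
    sub_mem v := by
      rw [Submodule.mem_comap, map_sub, hn]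
      exact sub_polarIncl_mem k _
    pairing l v := (laurentPolarization k).pairing _ _ }

theorem laurentIncl_polyPolarization_n (a : ℕ →₀ k) :
    laurentIncl k ((laurentPolyPolarization k).n a) = (laurentPolarization k).n a := by
  have : laurentIncl k ∘ₗ (laurentPolyPolarization k).n = (laurentPolarization k).n := by
    refine Finsupp.lhom_ext' fun m => LinearMap.ext_ring ?_
    simp [laurentPolyPolarization, laurentIncl_T, laurentPolarization, polarIncl_single]
  exact LinearMap.congr_fun this a

theorem vacMap_mulRight_boson (x : LaurentPolynomial k × LaurentPolynomial k) (w : VacPoly k) :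
    vacMap k (VacuumModule.mulRight _ _ _ (HeisCliff.boson _ x) w) =
      VacuumModule.mulRight _ _ _
        (HeisCliff.boson _ ((laurentIncl k).prodMap (laurentIncl k) x)) (vacMap k w) := by
  obtain ⟨w, rfl⟩ := Submodule.mkQ_surjective _ w
  rw [← HeisCliff.map_boson (resPairingPoly k) (resPairing k) (laurentIncl k) (laurentIncl k)
    (fun _ _ => rfl), VacuumModule.mulRight_mkQ]
  change Submodule.mkQ _ _ = Submodule.mkQ _ _
  rw [AlgHom.toLinearMap_apply, map_mul]
  rfl

theorem vacMap_mulRight_fermion (x : LaurentPolynomial k × LaurentPolynomial k) (w : VacPoly k) :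
    vacMap k (VacuumModule.mulRight _ _ _ (HeisCliff.fermion _ x) w) =
      VacuumModule.mulRight _ _ _
        (HeisCliff.fermion _ ((laurentIncl k).prodMap (laurentIncl k) x)) (vacMap k w) := by
  obtain ⟨w, rfl⟩ := Submodule.mkQ_surjective _ w
  rw [← HeisCliff.map_fermion (resPairingPoly k) (resPairing k) (laurentIncl k) (laurentIncl k)
    (fun _ _ => rfl), VacuumModule.mulRight_mkQ]
  change Submodule.mkQ _ _ = Submodule.mkQ _ _
  rw [AlgHom.toLinearMap_apply, map_mul]
  rfl

theorem vacMap_vac : vacMap k (VacuumModule.vac _ _ _) = VacuumModule.vac _ _ _ := by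
  change Submodule.mkQ _ _ = Submodule.mkQ _ _
  rw [AlgHom.toLinearMap_apply, map_one]

theorem prodMap_laurentIncl_incl (a : NegPart k) :
    (laurentIncl k).prodMap (laurentIncl k) ((laurentPolyPolarization k).incl a) =
      (laurentPolarization k).incl a :=
  Prod.ext (laurentIncl_polyPolarization_n k _) (laurentIncl_polyPolarization_n k _)

/-- The creation operators lie in `k[t, t⁻¹]` already and are the same for both polarizations. So
one Fock space parametrizes both vacuum modules, and compatibility with the generators and with the
vacuum vector suffices. -/
theorem vacMap_ofFock (z : Fock k) :
    vacMap k ((laurentPolyPolarization k).ofFock z) = (laurentPolarization k).ofFock z := by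
  induction z using TensorProduct.induction_on with
  | zero => simp
  | add a b ha hb => rw [map_add, map_add, map_add, ha, hb]
  | tmul f p =>
    induction p using Polarization.linForm_induction with
    | one =>
      induction f using Polarization.exteriorAlgebra_induction with
      | one => rw [Polarization.ofFock_one, Polarization.ofFock_one, vacMap_vac]
      | smul r f ih => rw [← TensorProduct.smul_tmul', map_smul, map_smul, map_smul, ih]
      | add f g hf hg => rw [TensorProduct.add_tmul, map_add, map_add, map_add, hf, hg]
      | ι_mul f m ih =>
        rw [Polarization.ofFock_ι_mul, Polarization.ofFock_ι_mul, vacMap_mulRight_fermion, ih,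
          prodMap_laurentIncl_incl]
    | smul r p ih => rw [TensorProduct.tmul_smul, map_smul, map_smul, map_smul, ih]
    | add p q hp hq => rw [TensorProduct.tmul_add, map_add, map_add, map_add, hp, hq]
    | inl_mul p m ih =>
      rw [Polarization.ofFock_linForm_mul, Polarization.ofFock_linForm_mul,
        vacMap_mulRight_boson, ih, prodMap_laurentIncl_incl]
    | inr_mul p m ih =>
      rw [Polarization.ofFock_linForm_mul, Polarization.ofFock_linForm_mul,
        vacMap_mulRight_boson, ih, prodMap_laurentIncl_incl]

theorem vacMap_bijective : Function.Bijective (vacMap k) := by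
  constructor
  · intro a b hab
    obtain ⟨a, rfl⟩ := (laurentPolyPolarization k).ofFock_surjective a
    obtain ⟨b, rfl⟩ := (laurentPolyPolarization k).ofFock_surjective b
    rw [vacMap_ofFock, vacMap_ofFock] at hab
    rw [← (laurentPolarization k).toFock_ofFock a, hab, (laurentPolarization k).toFock_ofFock]
  · intro w
    obtain ⟨z, rfl⟩ := (laurentPolarization k).ofFock_surjective w
    exact ⟨_, vacMap_ofFock k z⟩

end LaurentPolarization

/-! ### The operators `tⁿ` and `tⁿ dt` on `Vac` -/

section VacOperators

variable (k : Type u) [Field k]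

/-- The vacuum vector. -/
noncomputable def Vac.vac : Vac k := VacuumModule.vac _ _ _

theorem Vac.vac_ne_zero : Vac.vac k ≠ 0 := (laurentPolarization k).vac_ne_zero

variable {k}

theorem resPairing_single_single (m n : ℤ) :
    resPairing k (HahnSeries.single m 1) (HahnSeries.single n 1) =
      if m + n = -1 then 1 else 0 := by
  rw [resPairing_single, HahnSeries.coeff_single]
  congr 1
  rw [eq_iff_iff]
  omega

theorem single_mem_taylorPart {n : ℤ} (hn : 0 ≤ n) : HahnSeries.single n (1 : k) ∈ taylorPart k :=
  fun _ hm => HahnSeries.coeff_single_of_ne (by omega)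

theorem Vac.bosonV_bosonV (m n : ℤ) (w : Vac k) :
    Vac.bosonV k m (Vac.bosonV k n w) = Vac.bosonV k n (Vac.bosonV k m w) := by
  simpa [Vac.bosonV] using VacuumModule.boson_boson (B := resPairing k) (Vp := taylorPart k)
    (Lp := taylorPart k) (HahnSeries.single m 1, 0) (HahnSeries.single n 1, 0) w

theorem Vac.bosonL_bosonL (m n : ℤ) (w : Vac k) :
    Vac.bosonL k m (Vac.bosonL k n w) = Vac.bosonL k n (Vac.bosonL k m w) := by
  simpa [Vac.bosonL] using VacuumModule.boson_boson (B := resPairing k) (Vp := taylorPart k)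
    (Lp := taylorPart k) (0, HahnSeries.single m 1) (0, HahnSeries.single n 1) w

/-- This is `l v = v l + ⟨l, v⟩` acting from the right: the factor written first in a product is the
innermost operator. -/
theorem Vac.bosonV_bosonL (m n : ℤ) (w : Vac k) :
    Vac.bosonV k m (Vac.bosonL k n w) =
      Vac.bosonL k n (Vac.bosonV k m w) + (if n + m = -1 then 1 else 0 : k) • w := by
  simpa [Vac.bosonV, Vac.bosonL, resPairing_single_single] using VacuumModule.boson_boson (B := resPairing k)
    (Vp := taylorPart k) (Lp := taylorPart k)
    (HahnSeries.single m 1, 0) (0, HahnSeries.single n 1) w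

theorem Vac.fermionL_fermionL (m n : ℤ) (w : Vac k) :
    Vac.fermionL k m (Vac.fermionL k n w) = -Vac.fermionL k n (Vac.fermionL k m w) := by
  simpa [Vac.fermionL] using VacuumModule.fermion_fermion (B := resPairing k) (Vp := taylorPart k)
    (Lp := taylorPart k) (0, HahnSeries.single m 1) (0, HahnSeries.single n 1) w

theorem Vac.fermionV_fermionL (m n : ℤ) (w : Vac k) :
    Vac.fermionV k m (Vac.fermionL k n w) =
      -Vac.fermionL k n (Vac.fermionV k m w) + (if n + m = -1 then 1 else 0 : k) • w := by
  simpa [Vac.fermionV, Vac.fermionL, resPairing_single_single] using VacuumModule.fermion_fermion (B := resPairing k)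
    (Vp := taylorPart k) (Lp := taylorPart k)
    (HahnSeries.single m 1, 0) (0, HahnSeries.single n 1) w

/-- Anticommutation would only show that twice the square vanishes; the quadratic form works in
every characteristic. -/
theorem Vac.fermionL_fermionL_self (m : ℤ) (w : Vac k) :
    Vac.fermionL k m (Vac.fermionL k m w) = 0 := by
  rw [Vac.fermionL, ← VacuumModule.mulRight_mul, HeisCliff.fermion,
    Algebra.TensorProduct.tmul_mul_tmul, CliffordAlgebra.ι_sq_scalar, pairingForm_apply]
  obtain ⟨w, rfl⟩ := Submodule.mkQ_surjective _ w
  rw [VacuumModule.mulRight_mkQ]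
  simp

theorem Vac.bosonV_fermionV (m n : ℤ) (w : Vac k) :
    Vac.bosonV k m (Vac.fermionV k n w) = Vac.fermionV k n (Vac.bosonV k m w) :=
  VacuumModule.boson_fermion _ _ _

theorem Vac.bosonV_fermionL (m n : ℤ) (w : Vac k) :
    Vac.bosonV k m (Vac.fermionL k n w) = Vac.fermionL k n (Vac.bosonV k m w) :=
  VacuumModule.boson_fermion _ _ _

theorem Vac.bosonL_fermionV (m n : ℤ) (w : Vac k) :
    Vac.bosonL k m (Vac.fermionV k n w) = Vac.fermionV k n (Vac.bosonL k m w) :=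
  VacuumModule.boson_fermion _ _ _

theorem Vac.bosonL_fermionL (m n : ℤ) (w : Vac k) :
    Vac.bosonL k m (Vac.fermionL k n w) = Vac.fermionL k n (Vac.bosonL k m w) :=
  VacuumModule.boson_fermion _ _ _

theorem Vac.bosonV_vac {n : ℤ} (hn : 0 ≤ n) : Vac.bosonV k n (Vac.vac k) = 0 :=
  VacuumModule.boson_vac ⟨single_mem_taylorPart hn, Submodule.zero_mem _⟩

theorem Vac.bosonL_vac {n : ℤ} (hn : 0 ≤ n) : Vac.bosonL k n (Vac.vac k) = 0 :=
  VacuumModule.boson_vac ⟨Submodule.zero_mem _, single_mem_taylorPart hn⟩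

theorem Vac.fermionV_vac {n : ℤ} (hn : 0 ≤ n) : Vac.fermionV k n (Vac.vac k) = 0 :=
  VacuumModule.fermion_vac ⟨single_mem_taylorPart hn, Submodule.zero_mem _⟩

theorem Vac.fermionL_vac {n : ℤ} (hn : 0 ≤ n) : Vac.fermionL k n (Vac.vac k) = 0 :=
  VacuumModule.fermion_vac ⟨Submodule.zero_mem _, single_mem_taylorPart hn⟩

theorem Vac.eq_top_of_stable (R : Submodule k (Vac k)) (h0 : Vac.vac k ∈ R)
    (hbV : ∀ n, ∀ w ∈ R, Vac.bosonV k n w ∈ R) (hbL : ∀ n, ∀ w ∈ R, Vac.bosonL k n w ∈ R)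
    (hfV : ∀ n, ∀ w ∈ R, Vac.fermionV k n w ∈ R) (hfL : ∀ n, ∀ w ∈ R, Vac.fermionL k n w ∈ R) :
    R = ⊤ := by
  have h (m : ℕ) : (laurentPolarization k).n (Finsupp.single m 1) =
    HahnSeries.single (-(m : ℤ) - 1) 1 := polarIncl_single k m
  refine (laurentPolarization k).eq_top_of_stable R h0 ?_ ?_ ?_ ?_ <;> intro m w hw <;> rw [h]
  · exact hbV _ _ hw
  · exact hbL _ _ hw
  · exact hfV _ _ hw
  · exact hfL _ _ hw

end VacOperators

/-! ### Creation and annihilation operators, and modules over the Weyl algebra -/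

section PolynomialLemmas

open MvPolynomial

variable {k σ : Type*} [Field k]

/-- In characteristic zero, a nonzero space of polynomials that is stable under all partial
derivatives contains a nonzero constant. -/
theorem eq_zero_of_pderiv_stable [CharZero k] (K : Submodule k (MvPolynomial σ k))
    (hK : ∀ i, ∀ p ∈ K, pderiv i p ∈ K) (h1 : (1 : MvPolynomial σ k) ∉ K)
    {p : MvPolynomial σ k} (hp : p ∈ K) : p = 0 := by
  classical
  have hC (c : k) (hc : C c ∈ K) : (C c : MvPolynomial σ k) = 0 := by
    by_contra h
    have hc0 : c ≠ 0 := fun h0 => h (by rw [h0, C_0])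
    refine h1 ?_
    have := K.smul_mem c⁻¹ hc
    rwa [smul_eq_C_mul, ← C_mul, inv_mul_cancel₀ hc0, C_1] at this
  -- Induction on a strict bound for the degree: the partial derivatives have smaller degree and lie
  -- in `K`, so they vanish. Then `p` is a constant, and `K` contains no nonzero constant.
  have key (n : ℕ) : ∀ p ∈ K, (∀ s : σ →₀ ℕ, n ≤ s.degree → p.coeff s = 0) → p = 0 := by
    induction n with
    | zero =>
      intro p _ h
      ext s
      simpa using h s (Nat.zero_le _)
    | succ n ih =>
      intro p hp h
      have hd (i : σ) : pderiv i p = 0 := by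
        refine ih _ (hK i p hp) fun s hs => ?_
        rw [coeff_pderiv, h _ (by simpa using hs), zero_mul]
      have hpC : p = C (p.coeff 0) := by
        ext s
        rw [coeff_C]
        split_ifs with hs
        · rw [← hs]
        · obtain ⟨i, hi⟩ := Finsupp.ne_iff.1 (Ne.symm hs)
          have hs' : s - Finsupp.single i 1 + Finsupp.single i 1 = s := by
            refine tsub_add_cancel_of_le (Finsupp.single_le_iff.2 ?_)
            exact Nat.one_le_iff_ne_zero.2 hi
          have := congrArg (coeff (s - Finsupp.single i 1)) (hd i)
          rw [coeff_pderiv, hs', coeff_zero, mul_eq_zero] at this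
          rcases this with h' | h'
          · exact h'
          -- The exponent brought down by differentiation is nonzero in characteristic zero.
          · exact absurd h' (Nat.cast_add_one_ne_zero _)
      rw [hpC]
      exact hC _ (hpC ▸ hp)
  refine key (p.totalDegree + 1) p hp fun s hs => ?_
  by_contra h
  have := le_totalDegree (mem_support_iff.2 h)
  rw [Finsupp.degree_apply] at hs
  exact absurd (hs.trans this) (by omega)

open Classical in
/-- Annihilation operators act on polynomials in creation operators as partial derivatives. -/
theorem commLift_pderiv {W : Type*} [AddCommGroup W] [Module k W] (A : σ → Module.End k W)
    (hA : ∀ i j, A i * A j = A j * A i) (j : σ) (D : Module.End k W)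
    (hD : ∀ i w, D (A i w) = A i (D w) + if i = j then w else 0) {w : W} (hw : D w = 0)
    (p : MvPolynomial σ k) :
    D (commLift A hA p w) = commLift A hA (pderiv j p) w := by
  induction p using MvPolynomial.induction_on with
  | C c =>
    rw [pderiv_C, map_zero, ← algebraMap_eq, AlgHom.commutes, Module.algebraMap_end_apply,
      map_smul, hw, smul_zero, LinearMap.zero_apply]
  | add p q hp hq => rw [map_add, LinearMap.add_apply, map_add, hp, hq, map_add, map_add,
      LinearMap.add_apply]
  | mul_X p i hp =>
    rw [mul_comm, map_mul, commLift_X, Module.End.mul_apply, hD, hp, Derivation.leibniz, map_add,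
      smul_eq_mul, map_mul, commLift_X, LinearMap.add_apply, Module.End.mul_apply, pderiv_X,
      Pi.single_apply]
    congr 1
    split_ifs with h <;> simp

/-- Polynomials in creation operators act freely on a vacuum vector. -/
theorem commLift_vac_injective [CharZero k] {W : Type*} [AddCommGroup W] [Module k W]
    (A : σ → Module.End k W) (hA : ∀ i j, A i * A j = A j * A i) (D : σ → Module.End k W)
    (hD : ∀ i j w, i ≠ j → D j (A i w) = A i (D j w)) (hDs : ∀ i w, D i (A i w) = A i (D i w) + w)
    {w : W} (hw : ∀ j, D j w = 0) (hw0 : w ≠ 0) {p : MvPolynomial σ k}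
    (hp : commLift A hA p w = 0) : p = 0 := by
  classical
  -- The polynomials whose operators kill `w` are stable under partial derivatives by
  -- `commLift_pderiv`, and `1` is not among them because `w ≠ 0`.
  refine eq_zero_of_pderiv_stable (LinearMap.ker
    ((LinearMap.applyₗ w : Module.End k W →ₗ[k] W) ∘ₗ (commLift A hA).toLinearMap))
    (fun i p hp => ?_) ?_ hp
  · change commLift A hA _ w = 0
    rw [← commLift_pderiv A hA i (D i) _ (hw i), show commLift A hA p w = 0 from hp, map_zero]
    intro j w
    split_ifs with h
    · rw [h, hDs]
    · rw [hD _ _ _ h, add_zero]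
  · change commLift A hA 1 w ≠ 0
    rwa [map_one]

/-- The subalgebra generated by coordinates and derivations is everything. -/
theorem Weyl.eq_top_of_mem (S : Subalgebra k (Weyl k σ)) (hx : ∀ i, Weyl.x i ∈ S)
    (hd : ∀ i, Weyl.d i ∈ S) : S = ⊤ := by
  refine eq_top_iff.2 fun P _ => ?_
  obtain ⟨p, rfl⟩ := RingQuot.mkAlgHom_surjective k (WeylRel k σ) P
  induction p using FreeAlgebra.induction with
  | grade0 c => rw [AlgHom.commutes]; exact S.algebraMap_mem c
  | grade1 i =>
    rcases i with i | i
    · exact hx i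
    · exact hd i
  | mul p q hp hq => rw [map_mul]; exact S.mul_mem (hp trivial) (hq trivial)
  | add p q hp hq => rw [map_add]; exact S.add_mem (hp trivial) (hq trivial)

/-- Right modules over the Weyl algebra. -/
noncomputable def Weyl.lift {W : Type*} [AddCommGroup W] [Module k W] (X D : σ → Module.End k W)
    (hX : ∀ i j, X i * X j = X j * X i) (hD : ∀ i j, D i * D j = D j * D i)
    (hne : ∀ i j, i ≠ j → X j * D i = D i * X j) (hs : ∀ i, X i * D i = D i * X i + 1) :
    Weyl k σ →ₐ[k] (Module.End k W)ᵐᵒᵖ :=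
  RingQuot.liftAlgHom k
    ⟨FreeAlgebra.lift k (Sum.elim (fun i => MulOpposite.op (X i)) (fun i => MulOpposite.op (D i))),
      by
      rintro _ _ (⟨i, j⟩ | ⟨i, j⟩ | ⟨i, j, h⟩ | ⟨i⟩)
      · simp [← MulOpposite.op_mul, hX i j]
      · simp [← MulOpposite.op_mul, hD i j]
      · simp [← MulOpposite.op_mul, hne i j h]
      · simp [← MulOpposite.op_mul, hs i]⟩

theorem Weyl.lift_x {W : Type*} [AddCommGroup W] [Module k W] (X D : σ → Module.End k W)
    (hX : ∀ i j, X i * X j = X j * X i) (hD : ∀ i j, D i * D j = D j * D i)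
    (hne : ∀ i j, i ≠ j → X j * D i = D i * X j) (hs : ∀ i, X i * D i = D i * X i + 1) (i : σ) :
    Weyl.lift X D hX hD hne hs (Weyl.x i) = MulOpposite.op (X i) := by
  simp [Weyl.lift, Weyl.x]

theorem Weyl.lift_d {W : Type*} [AddCommGroup W] [Module k W] (X D : σ → Module.End k W)
    (hX : ∀ i j, X i * X j = X j * X i) (hD : ∀ i j, D i * D j = D j * D i)
    (hne : ∀ i j, i ≠ j → X j * D i = D i * X j) (hs : ∀ i, X i * D i = D i * X i + 1) (i : σ) :
    Weyl.lift X D hX hD hne hs (Weyl.d i) = MulOpposite.op (D i) := by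
  simp [Weyl.lift, Weyl.d]

end PolynomialLemmas

/-! ### The direct image `i_• ω` as a bosonic Fock space -/

section PushLemmas

open MvPolynomial

variable {k τ ν : Type*} [Field k]

theorem Push.mulRight_mul (P Q : Weyl k (τ ⊕ ν)) (v : Push k τ ν) :
    Push.mulRight (P * Q) v = Push.mulRight Q (Push.mulRight P v) := by
  refine LinearMap.congr_fun (f := Push.mulRight (P * Q))
    (g := Push.mulRight Q ∘ₗ Push.mulRight P) (Push.hom_ext fun m R => ?_) v
  simp only [LinearMap.comp_apply, Push.mulRight_mk, mul_assoc]

theorem Push.mulRight_add (P Q : Weyl k (τ ⊕ ν)) (v : Push k τ ν) :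
    Push.mulRight (P + Q) v = Push.mulRight P v + Push.mulRight Q v := by
  refine LinearMap.congr_fun (f := Push.mulRight (P + Q))
    (g := Push.mulRight P + Push.mulRight Q) (Push.hom_ext fun m R => ?_) v
  simp only [LinearMap.add_apply, Push.mulRight_mk, mul_add, TensorProduct.tmul_add, map_add]

theorem Push.mulRight_one (v : Push k τ ν) : Push.mulRight 1 v = v := by
  refine LinearMap.congr_fun (f := Push.mulRight 1) (g := LinearMap.id)
    (Push.hom_ext fun m R => ?_) v
  rw [Push.mulRight_mk, mul_one, LinearMap.id_apply]

theorem Push.mulRight_smul (c : k) (P : Weyl k (τ ⊕ ν)) (v : Push k τ ν) :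
    Push.mulRight (c • P) v = c • Push.mulRight P v := by
  refine LinearMap.congr_fun (f := Push.mulRight (c • P)) (g := c • Push.mulRight P)
    (Push.hom_ext fun m R => ?_) v
  simp only [LinearMap.smul_apply, Push.mulRight_mk, mul_smul_comm, TensorProduct.tmul_smul,
    map_smul]

theorem Push.mk_omegaMul (m : MvPolynomial τ k) (P : Weyl k τ) (Q : Weyl k (τ ⊕ ν)) :
    (Push.mk (omegaMul P m ⊗ₜ[k] Q) : Push k τ ν) =
      Push.mk (m ⊗ₜ[k] (Weyl.map Function.Embedding.inl P * Q)) := by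
  rw [← sub_eq_zero, ← map_sub]
  exact (Submodule.Quotient.mk_eq_zero _).2 (Submodule.subset_span (Or.inl ⟨m, P, Q, rfl⟩))

theorem Push.mk_x_inr_mul (m : MvPolynomial τ k) (n : ν) (Q : Weyl k (τ ⊕ ν)) :
    (Push.mk (m ⊗ₜ[k] (Weyl.x (Sum.inr n) * Q)) : Push k τ ν) = 0 :=
  (Submodule.Quotient.mk_eq_zero _).2 (Submodule.subset_span (Or.inr ⟨m, n, Q, rfl⟩))

/-- The generator of the direct image. -/
noncomputable def Push.gen (k τ ν : Type*) [Field k] : Push k τ ν := Push.mk (1 ⊗ₜ[k] 1)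

theorem Push.mulRight_x_gen (n : ν) : Push.mulRight (Weyl.x (Sum.inr n)) (Push.gen k τ ν) = 0 := by
  rw [Push.gen, Push.mulRight_mk, one_mul, ← mul_one (Weyl.x _), Push.mk_x_inr_mul]

/-- The generator is the class of a form with constant coefficient, whose derivatives vanish.
Together with the normal coordinates these derivations are the annihilation operators of `i_• ω`. -/
theorem Push.mulRight_d_gen (i : τ) : Push.mulRight (Weyl.d (Sum.inl i)) (Push.gen k τ ν) = 0 := by
  have := Push.mk_omegaMul (ν := ν) (1 : MvPolynomial τ k) (Weyl.d i) 1
  rw [omegaMul_d, pderiv_one, neg_zero, TensorProduct.zero_tmul, map_zero, Weyl.map_d, mul_one]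
    at this
  rw [Push.gen, Push.mulRight_mk, one_mul]
  exact this.symm

theorem Push.eq_top_of_stable (R : Submodule k (Push k τ ν)) (h0 : Push.gen k τ ν ∈ R)
    (hx : ∀ i, ∀ v ∈ R, Push.mulRight (Weyl.x i) v ∈ R)
    (hd : ∀ i, ∀ v ∈ R, Push.mulRight (Weyl.d i) v ∈ R) : R = ⊤ := by
  let S : Subalgebra k (Weyl k (τ ⊕ ν)) :=
    { carrier := {P | ∀ v ∈ R, Push.mulRight P v ∈ R}
      mul_mem' := fun {P Q} hP hQ v hv => by
        rw [Push.mulRight_mul]; exact hQ _ (hP _ hv)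
      add_mem' := fun {P Q} hP hQ v hv => by
        rw [Push.mulRight_add]; exact R.add_mem (hP _ hv) (hQ _ hv)
      algebraMap_mem' := fun c v hv => by
        rw [Algebra.algebraMap_eq_smul_one, Push.mulRight_smul, Push.mulRight_one]
        exact R.smul_mem _ hv }
  have hS : S = ⊤ := Weyl.eq_top_of_mem S hx hd
  have hmul (P : Weyl k (τ ⊕ ν)) : ∀ v ∈ R, Push.mulRight P v ∈ R :=
    (show P ∈ S by rw [hS]; trivial)
  have hmk (m : MvPolynomial τ k) : (Push.mk (m ⊗ₜ[k] 1) : Push k τ ν) ∈ R := by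
    induction m using MvPolynomial.induction_on with
    | C c =>
      rw [← mul_one (C c), ← smul_eq_C_mul, ← TensorProduct.smul_tmul', map_smul]
      exact R.smul_mem _ h0
    | add p q hp hq => rw [TensorProduct.add_tmul, map_add]; exact R.add_mem hp hq
    | mul_X p i hp =>
      rw [mul_comm, ← omegaMul_x, Push.mk_omegaMul, mul_one, Weyl.map_x]
      have := hx (Sum.inl i) _ hp
      rwa [Push.mulRight_mk, one_mul] at this
  refine eq_top_iff.2 fun v _ => ?_
  obtain ⟨z, rfl⟩ := Submodule.mkQ_surjective (pushRel k τ ν) v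
  induction z using TensorProduct.induction_on with
  | zero => exact R.zero_mem
  | tmul m Q =>
    have := hmul Q _ (hmk m)
    rw [Push.mulRight_mk, one_mul] at this
    exact this
  | add a b ha hb => rw [map_add]; exact R.add_mem (ha trivial) (hb trivial)

theorem Push.mulRight_d_comm (i j : τ ⊕ ν) (v : Push k τ ν) :
    Push.mulRight (Weyl.d i) (Push.mulRight (Weyl.d j) v) =
      Push.mulRight (Weyl.d j) (Push.mulRight (Weyl.d i) v) := by
  rw [← Push.mulRight_mul, ← Push.mulRight_mul, Weyl.d_mul_d]

theorem Push.mulRight_x_d_of_ne {i j : τ ⊕ ν} (h : i ≠ j) (v : Push k τ ν) :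
    Push.mulRight (Weyl.x i) (Push.mulRight (Weyl.d j) v) =
      Push.mulRight (Weyl.d j) (Push.mulRight (Weyl.x i) v) := by
  rw [← Push.mulRight_mul, ← Push.mulRight_mul, Weyl.d_mul_x_of_ne h.symm]

theorem Push.mulRight_x_d_self (i : τ ⊕ ν) (v : Push k τ ν) :
    Push.mulRight (Weyl.x i) (Push.mulRight (Weyl.d i) v) =
      Push.mulRight (Weyl.d i) (Push.mulRight (Weyl.x i) v) + v := by
  rw [← Push.mulRight_mul, ← Push.mulRight_mul, Weyl.d_mul_x_self, Push.mulRight_add,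
    Push.mulRight_one]

/-- The operators on the direct image that do not kill the generator. -/
noncomputable def Push.creation : τ ⊕ ν → Module.End k (Push k τ ν) :=
  Sum.elim (fun i => Push.mulRight (Weyl.x (Sum.inl i))) (fun n => Push.mulRight (Weyl.d (Sum.inr n)))

theorem Push.creation_comm (i j : τ ⊕ ν) :
    (Push.creation i * Push.creation j : Module.End k (Push k τ ν)) =
      Push.creation j * Push.creation i := by
  refine LinearMap.ext fun v => ?_
  rcases i with i | i <;> rcases j with j | j
  · exact LinearMap.congr_fun (Push.mulRight_x_comm _ _) v
  · exact Push.mulRight_x_d_of_ne (by simp) v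
  · exact (Push.mulRight_x_d_of_ne (by simp) v).symm
  · exact Push.mulRight_d_comm _ _ v

/-- Every element of the direct image is a polynomial in the creation operators, applied to the
generator. -/
theorem Push.exists_eq_commLift (v : Push k τ ν) :
    ∃ p : MvPolynomial (τ ⊕ ν) k, commLift Push.creation Push.creation_comm p (Push.gen k τ ν) = v := by
  classical
  let R : Submodule k (Push k τ ν) := LinearMap.range
    ((LinearMap.applyₗ (Push.gen k τ ν) : Module.End k _ →ₗ[k] Push k τ ν) ∘ₗ
      (commLift (k := k) Push.creation Push.creation_comm).toLinearMap)
  have hR : R = ⊤ := by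
    refine Push.eq_top_of_stable R ⟨1, ?_⟩ ?_ ?_
    · simp
    · rintro (i | n) _ ⟨p, rfl⟩
      · refine ⟨X (Sum.inl i) * p, ?_⟩
        simp [commLift_X, Push.creation, Module.End.mul_apply]
      -- A normal coordinate kills the generator and has commutator `1` with its own derivation, so
      -- it acts as a partial derivative.
      · refine ⟨pderiv (Sum.inr n) p, ?_⟩
        refine (commLift_pderiv Push.creation Push.creation_comm (Sum.inr n)
          (Push.mulRight (Weyl.x (Sum.inr n))) ?_ (Push.mulRight_x_gen n) p).symm
        rintro (i | m) w
        · simpa [Push.creation] using LinearMap.congr_fun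
            (Push.mulRight_x_comm (Sum.inr n) (Sum.inl i)) w
        · by_cases h : m = n
          · subst h
            simpa [Push.creation] using Push.mulRight_x_d_self (Sum.inr m) w
          · simpa [Push.creation, h] using
              Push.mulRight_x_d_of_ne (i := Sum.inr n) (j := Sum.inr m)
                (fun e => h (Sum.inr_injective e).symm) w
    · rintro (i | n) _ ⟨p, rfl⟩
      -- For a right action the commutator of a tangential derivation with its coordinate is `-1`,
      -- as in `f · ∂ = -∂f`.
      · refine ⟨-pderiv (Sum.inl i) p, ?_⟩
        have := commLift_pderiv Push.creation Push.creation_comm (Sum.inl i)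
          (-Push.mulRight (Weyl.d (Sum.inl i)) : Module.End k (Push k τ ν)) ?_
          (by rw [LinearMap.neg_apply, Push.mulRight_d_gen, neg_zero]) p
        · rw [map_neg, LinearMap.comp_apply, AlgHom.toLinearMap_apply, LinearMap.applyₗ_apply_apply,
            ← this, LinearMap.neg_apply, neg_neg]
          rfl
        rintro (j | m) w
        · by_cases h : j = i
          · subst h
            simp [Push.creation, Push.mulRight_x_d_self]
          · simpa [Push.creation, h] using
              (Push.mulRight_x_d_of_ne (i := Sum.inl j) (j := Sum.inl i)
                (fun e => h (Sum.inl_injective e)) w).symm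
        · simpa [Push.creation] using Push.mulRight_d_comm _ _ w
      · refine ⟨X (Sum.inr n) * p, ?_⟩
        simp [commLift_X, Push.creation, Module.End.mul_apply]
  obtain ⟨p, hp⟩ := (show v ∈ R by rw [hR]; trivial)
  exact ⟨p, hp⟩

end PushLemmas

/-! ### The bosonic embedding of `i_• ω` into `Vac` -/

section BosonMap

open MvPolynomial

variable (k : Type u) [Field k] (M N : ℕ)

theorem Coord.exponent_injective {M N : ℕ} :
    Function.Injective (Coord.exponent : Coord M N → ℤ) := by
  rintro (i | i) (j | j) h <;> simp only [Coord.exponent] at h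
  · exact congrArg _ (Fin.ext (by omega))
  · omega
  · omega
  · exact congrArg _ (Fin.ext (by omega))

theorem Coord.exponent_le {M N : ℕ} (c : Coord M N) : c.exponent < (M + 1 : ℕ) := by
  rcases c with i | i <;> simp only [Coord.exponent] <;> omega

theorem Coord.exists_exponent {M N : ℕ} (l : ℤ) (h1 : l ≤ M) (h2 : -l ≤ N) :
    ∃ c : Coord M N, c.exponent = l := by
  rcases le_or_gt 0 l with h | h
  · exact ⟨Sum.inl ⟨l.toNat, by omega⟩, by simp only [Coord.exponent]; omega⟩
  · exact ⟨Sum.inr ⟨(-l - 1).toNat, by omega⟩, by simp only [Coord.exponent]; omega⟩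

/-- The right action of differential operators on the vacuum module. -/
noncomputable def Vac.weylAct : Weyl k (Coord M N) →ₐ[k] (Module.End k (Vac k))ᵐᵒᵖ :=
  Weyl.lift (fun c => Vac.bosonL k (-c.exponent - 1)) (fun c => -Vac.bosonV k c.exponent)
    (fun i j => LinearMap.ext fun w => Vac.bosonL_bosonL _ _ w)
    (fun i j => LinearMap.ext fun w => by
      simpa [Module.End.mul_apply] using Vac.bosonV_bosonV _ _ w)
    (fun i j h => LinearMap.ext fun w => by
      have h' : -j.exponent - 1 + i.exponent ≠ -1 := fun e =>
        h (Coord.exponent_injective (by omega))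
      simp [Module.End.mul_apply, Vac.bosonV_bosonL, h'])
    -- Here the sign in `∂ ↦ -t^l` is forced: `[∂, a] = 1` in the Weyl algebra, while `[t^{-l-1}dt,
    -- t^l] = 1` in `D`.
    (fun i => LinearMap.ext fun w => by
      have h' : -i.exponent - 1 + i.exponent = -1 := by omega
      simp [Module.End.mul_apply, Vac.bosonV_bosonL, h'])

variable {k M N}

theorem Vac.weylAct_x (c : Coord M N) (w : Vac k) :
    (Vac.weylAct k M N (Weyl.x c)).unop w = Vac.bosonL k (-c.exponent - 1) w := by
  rw [Vac.weylAct, Weyl.lift_x]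
  rfl

theorem Vac.weylAct_d (c : Coord M N) (w : Vac k) :
    (Vac.weylAct k M N (Weyl.d c)).unop w = -Vac.bosonV k c.exponent w := by
  rw [Vac.weylAct, Weyl.lift_d]
  rfl

/-- The functions of the coordinates `a_l`, `l ≥ 0`, acting on the vacuum vector. -/
noncomputable def omegaToVac (k : Type u) [Field k] (M : ℕ) :
    MvPolynomial (Fin (M + 1)) k →ₗ[k] Vac k :=
  (LinearMap.applyₗ (Vac.vac k) : Module.End k (Vac k) →ₗ[k] Vac k) ∘ₗ
    (commLift (fun i : Fin (M + 1) => Vac.bosonL k (-((i : ℕ) : ℤ) - 1))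
      (fun _ _ => LinearMap.ext fun w => Vac.bosonL_bosonL _ _ w)).toLinearMap

theorem omegaToVac_one : omegaToVac k M 1 = Vac.vac k := by
  simp [omegaToVac]

theorem omegaToVac_X_mul (i : Fin (M + 1)) (p : MvPolynomial (Fin (M + 1)) k) :
    omegaToVac k M (X i * p) = Vac.bosonL k (-((i : ℕ) : ℤ) - 1) (omegaToVac k M p) := by
  simp [omegaToVac, commLift_X, Module.End.mul_apply]

/-- Since `t^i` kills the vacuum vector and has commutator `1` with `t^{-i-1}dt`, it differentiates
polynomials in these creation operators. Hence `-t^i` is the right action of `∂` on `ω`. -/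
theorem omegaToVac_pderiv (i : Fin (M + 1)) (p : MvPolynomial (Fin (M + 1)) k) :
    omegaToVac k M (pderiv i p) = Vac.bosonV k ((i : ℕ) : ℤ) (omegaToVac k M p) := by
  refine (commLift_pderiv (fun i : Fin (M + 1) => Vac.bosonL k (-((i : ℕ) : ℤ) - 1))
    (fun _ _ => LinearMap.ext fun w => Vac.bosonL_bosonL _ _ w) i
    (Vac.bosonV k ((i : ℕ) : ℤ)) (fun j w => ?_) (Vac.bosonV_vac (by omega)) p).symm
  rw [Vac.bosonV_bosonL]
  by_cases h : j = i
  · subst h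
    have h' : -((j : ℕ) : ℤ) - 1 + ((j : ℕ) : ℤ) = -1 := by omega
    simp [h']
  · have h' : -((j : ℕ) : ℤ) - 1 + ((i : ℕ) : ℤ) ≠ -1 := fun e => h (Fin.ext (by omega))
    simp [h, h']

theorem omegaToVac_omegaMul (P : Weyl k (Fin (M + 1))) (p : MvPolynomial (Fin (M + 1)) k) :
    omegaToVac k M (omegaMul P p) =
      (Vac.weylAct k M N (Weyl.map Function.Embedding.inl P)).unop (omegaToVac k M p) := by
  let S : Subalgebra k (Weyl k (Fin (M + 1))) :=
    { carrier := {P | ∀ p, omegaToVac k M (omegaMul P p) =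
        (Vac.weylAct k M N (Weyl.map Function.Embedding.inl P)).unop (omegaToVac k M p)}
      mul_mem' := fun {P Q} hP hQ p => by
        simp only [Set.mem_ofPred_eq] at hP hQ
        rw [omegaMul_mul, hQ, hP, map_mul, map_mul]
        rfl
      add_mem' := fun {P Q} hP hQ p => by
        simp only [Set.mem_ofPred_eq] at hP hQ
        rw [map_add, map_add, MulOpposite.unop_add, LinearMap.add_apply, ← hP, ← hQ, ← map_add]
        congr 1
        simp [omegaMul]
      algebraMap_mem' := fun c p => by
        rw [AlgHom.commutes, AlgHom.commutes]
        simp [omegaMul, Module.algebraMap_end_apply] }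
  have hS : S = ⊤ := by
    refine Weyl.eq_top_of_mem S (fun i p => ?_) (fun i p => ?_)
    · rw [omegaMul_x, omegaToVac_X_mul, Weyl.map_x, Vac.weylAct_x]
      rfl
    · rw [omegaMul_d, map_neg, omegaToVac_pderiv, Weyl.map_d, Vac.weylAct_d]
      rfl
  exact (show P ∈ S by rw [hS]; trivial) p

/-- For `l < 0` the operator `t^{-l-1}dt` kills the vacuum vector and commutes with the others in
`V*`. This is the relation in `i_• ω` that makes normal coordinates vanish on `X`. -/
theorem bosonL_inr_omegaToVac (n : Fin N) (p : MvPolynomial (Fin (M + 1)) k) :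
    Vac.bosonL k (-(Coord.exponent (Sum.inr n : Coord M N)) - 1) (omegaToVac k M p) = 0 := by
  induction p using MvPolynomial.induction_on with
  | C c =>
    rw [← mul_one (C c), ← smul_eq_C_mul, map_smul, omegaToVac_one, map_smul,
      Vac.bosonL_vac (by simp only [Coord.exponent]; omega), smul_zero]
  | add p q hp hq => rw [map_add, map_add, hp, hq, add_zero]
  | mul_X p i hp => rw [mul_comm, omegaToVac_X_mul, Vac.bosonL_bosonL, hp, map_zero]

/-- The map from the direct image to the vacuum module. -/
noncomputable def Push.toVac (k : Type u) [Field k] (M N : ℕ) :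
    Push k (Fin (M + 1)) (Fin N) →ₗ[k] Vac k :=
  Submodule.liftQ _
    (TensorProduct.lift (LinearMap.mk₂ k
      (fun m (Q : Weyl k (Coord M N)) => (Vac.weylAct k M N Q).unop (omegaToVac k M m))
      (fun m m' Q => by rw [map_add, map_add])
      (fun c m Q => by rw [map_smul, map_smul])
      (fun m Q Q' => by rw [map_add, MulOpposite.unop_add, LinearMap.add_apply])
      (fun c m Q => by rw [map_smul, MulOpposite.unop_smul, LinearMap.smul_apply]))) <| by
    refine Submodule.span_le.2 ?_
    rintro _ (⟨m, P, Q, rfl⟩ | ⟨m, n, Q, rfl⟩)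
    · simp only [SetLike.mem_coe, LinearMap.mem_ker, map_sub, TensorProduct.lift.tmul,
        LinearMap.mk₂_apply, omegaToVac_omegaMul (N := N), map_mul, MulOpposite.unop_mul,
        Module.End.mul_apply, sub_self]
    · simp only [SetLike.mem_coe, LinearMap.mem_ker, TensorProduct.lift.tmul,
        LinearMap.mk₂_apply, map_mul, MulOpposite.unop_mul, Module.End.mul_apply, Vac.weylAct_x,
        bosonL_inr_omegaToVac, map_zero]

theorem Push.toVac_mk (m : MvPolynomial (Fin (M + 1)) k) (Q : Weyl k (Coord M N)) :
    Push.toVac k M N (Push.mk (m ⊗ₜ[k] Q)) = (Vac.weylAct k M N Q).unop (omegaToVac k M m) := rfl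

theorem Push.toVac_gen : Push.toVac k M N (Push.gen k _ _) = Vac.vac k := by
  rw [Push.gen, Push.toVac_mk, map_one, omegaToVac_one]
  rfl

theorem Push.toVac_mulRight (P : Weyl k (Coord M N)) (v : Push k (Fin (M + 1)) (Fin N)) :
    Push.toVac k M N (Push.mulRight P v) = (Vac.weylAct k M N P).unop (Push.toVac k M N v) := by
  refine LinearMap.congr_fun (f := Push.toVac k M N ∘ₗ Push.mulRight P)
    (g := (Vac.weylAct k M N P).unop ∘ₗ Push.toVac k M N) (Push.hom_ext fun m Q => ?_) v
  simp only [LinearMap.comp_apply, Push.mulRight_mk, Push.toVac_mk, map_mul, MulOpposite.unop_mul,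
    Module.End.mul_apply]

theorem Push.toVac_X_smul (c : Coord M N) (v : Push k (Fin (M + 1)) (Fin N)) :
    Push.toVac k M N ((X c : MvPolynomial (Coord M N) k) • v) =
      Vac.bosonL k (-c.exponent - 1) (Push.toVac k M N v) := by
  rw [Push.X_smul, Push.toVac_mulRight, Vac.weylAct_x]

theorem Push.toVac_mulRight_d (c : Coord M N) (v : Push k (Fin (M + 1)) (Fin N)) :
    Push.toVac k M N (Push.mulRight (Weyl.d c) v) =
      -Vac.bosonV k c.exponent (Push.toVac k M N v) := by
  rw [Push.toVac_mulRight, Vac.weylAct_d]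

/-- The construction depends on a coordinate only through its exponent, which `hf` and `hg` say is
preserved. -/
theorem Push.toVac_map {M' N' : ℕ} (f : Fin (M + 1) ↪ Fin (M' + 1)) (g : Fin N ↪ Fin N')
    (hf : ∀ i, (f i : ℕ) = i) (hg : ∀ i, (g i : ℕ) = i) (v : Push k (Fin (M + 1)) (Fin N)) :
    Push.toVac k M' N' (Push.map f g v) = Push.toVac k M N v := by
  have hexp (c : Coord M N) : Coord.exponent (f.sumMap g c : Coord M' N') = c.exponent := by
    rcases c with i | i
    · change ((f i : ℕ) : ℤ) = _
      rw [hf]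
      rfl
    · change -((g i : ℕ) : ℤ) - 1 = _
      rw [hg]
      rfl
  have hW : (Vac.weylAct k M' N').comp (Weyl.map (f.sumMap g)) = Vac.weylAct k M N := by
    refine Weyl.algHom_ext (fun c => ?_) (fun c => ?_) <;>
      refine MulOpposite.unop_injective (LinearMap.ext fun w => ?_)
    · rw [AlgHom.comp_apply, Weyl.map_x, Vac.weylAct_x, Vac.weylAct_x, hexp]
    · rw [AlgHom.comp_apply, Weyl.map_d, Vac.weylAct_d, Vac.weylAct_d, hexp]
  have hα (m : MvPolynomial (Fin (M + 1)) k) :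
      omegaToVac k M' (rename f m) = omegaToVac k M m := by
    induction m using MvPolynomial.induction_on with
    | C c =>
      rw [rename_C, C_eq_smul_one, C_eq_smul_one, map_smul, map_smul, omegaToVac_one,
        omegaToVac_one]
    | add p q hp hq => rw [map_add, map_add, map_add, hp, hq]
    | mul_X p i hp => rw [map_mul, rename_X, mul_comm, omegaToVac_X_mul, mul_comm p,
        omegaToVac_X_mul, hp, hf]
  refine LinearMap.congr_fun (f := Push.toVac k M' N' ∘ₗ Push.map f g)
    (g := Push.toVac k M N) (Push.hom_ext fun m Q => ?_) v
  rw [LinearMap.comp_apply, Push.toVac_mk, ← hα, ← hW]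
  rfl

/-- Polynomials in the creation operators exhaust the source (`Push.exists_eq_commLift`), and their
images act freely on the nonzero vacuum vector of `Vac` (`commLift_vac_injective`). -/
theorem Push.toVac_injective [CharZero k] : Function.Injective (Push.toVac k M N) := by
  rw [injective_iff_map_eq_zero]
  intro v hv
  obtain ⟨p, rfl⟩ := Push.exists_eq_commLift v
  let A : Coord M N → Module.End k (Vac k) :=
    Sum.elim (fun i => Vac.bosonL k (-((i : ℕ) : ℤ) - 1))
      (fun n => -Vac.bosonV k (-((n : ℕ) : ℤ) - 1))
  have hA (i j : Coord M N) : A i * A j = A j * A i := by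
    refine LinearMap.ext fun w => ?_
    rcases i with i | i <;> rcases j with j | j
    · exact Vac.bosonL_bosonL _ _ w
    · have h : -((i : ℕ) : ℤ) - 1 + (-((j : ℕ) : ℤ) - 1) ≠ -1 := by omega
      simp [A, Module.End.mul_apply, Vac.bosonV_bosonL, h]
    · have h : -((j : ℕ) : ℤ) - 1 + (-((i : ℕ) : ℤ) - 1) ≠ -1 := by omega
      simp [A, Module.End.mul_apply, Vac.bosonV_bosonL, h]
    · simpa [A, Module.End.mul_apply] using Vac.bosonV_bosonV _ _ w
  have hA' (c : Coord M N) (v : Push k (Fin (M + 1)) (Fin N)) :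
      Push.toVac k M N (Push.creation c v) = A c (Push.toVac k M N v) := by
    rcases c with i | i
    · exact (Push.toVac_mulRight _ _).trans (Vac.weylAct_x _ _)
    · exact (Push.toVac_mulRight _ _).trans (Vac.weylAct_d _ _)
  have hlift (p : MvPolynomial (Coord M N) k) :
      Push.toVac k M N (commLift Push.creation Push.creation_comm p (Push.gen k _ _)) =
        commLift A hA p (Vac.vac k) := by
    induction p using MvPolynomial.induction_on with
    | C c =>
      rw [← algebraMap_eq, AlgHom.commutes, AlgHom.commutes, Module.algebraMap_end_apply,
        Module.algebraMap_end_apply, map_smul, Push.toVac_gen]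
    | add p q hp hq =>
      rw [map_add, map_add, LinearMap.add_apply, map_add, hp, hq, LinearMap.add_apply]
    | mul_X p c hp =>
      rw [mul_comm, map_mul, map_mul, commLift_X, commLift_X, Module.End.mul_apply, hA', hp,
        Module.End.mul_apply]
  rw [hlift] at hv
  have hp : p = 0 := by
    refine commLift_vac_injective A hA
      -- The annihilation partners: `t^i` for `t^{-i-1}dt`, and `t^n dt` for `-t^{-n-1}`.
      (Sum.elim (fun i => Vac.bosonV k ((i : ℕ) : ℤ)) (fun n => Vac.bosonL k ((n : ℕ) : ℤ)))
      ?_ ?_ ?_ (Vac.vac_ne_zero k) hv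
    · rintro (i | i) (j | j) w hij
      · have h : -((i : ℕ) : ℤ) - 1 + ((j : ℕ) : ℤ) ≠ -1 := fun e =>
          hij (congrArg _ (Fin.ext (by omega)))
        simp [A, Vac.bosonV_bosonL, h]
      · exact Vac.bosonL_bosonL _ _ w
      · simpa [A] using Vac.bosonV_bosonV _ _ w
      · have h : ((j : ℕ) : ℤ) + (-((i : ℕ) : ℤ) - 1) ≠ -1 := fun e =>
          hij (congrArg _ (Fin.ext (by omega)))
        simp [A, Vac.bosonV_bosonL, h]
    · rintro (i | i) w
      · have h : -((i : ℕ) : ℤ) - 1 + ((i : ℕ) : ℤ) = -1 := by omega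
        simp [A, Vac.bosonV_bosonL, h]
      · have h : ((i : ℕ) : ℤ) + (-((i : ℕ) : ℤ) - 1) = -1 := by omega
        simp [A, Vac.bosonV_bosonL, h]
    · rintro (i | i)
      · exact Vac.bosonV_vac (by omega)
      · exact Vac.bosonL_vac (by omega)
  rw [hp, map_zero, LinearMap.zero_apply]

end BosonMap

/-! ### Fermionic products and the shifted vacuum -/

section FermionMap

variable {k : Type u} [Field k]

/-- Products of elements of `V` in the Clifford algebra. -/
noncomputable def wedgeAlt (k : Type u) [Field k] (j : ℕ) :
    LaurentSeries k [⋀^Fin j]→ₗ[k] HeisCliff (resPairing k) :=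
  (ExteriorAlgebra.lift k ⟨(TensorProduct.mk k _ _).flip 1 ∘ₗ
      CliffordAlgebra.ι (pairingForm (resPairing k)) ∘ₗ LinearMap.inl k _ _, fun f => by
    simp [pairingForm_apply]⟩ :
    ExteriorAlgebra k (LaurentSeries k) →ₐ[k] HeisCliff (resPairing k)).toLinearMap.compAlternatingMap
    (ExteriorAlgebra.ιMulti k j)

theorem wedgeAlt_zero (f : Fin 0 → LaurentSeries k) : wedgeAlt k 0 f = 1 := by
  simp [wedgeAlt]

theorem wedgeAlt_succ {j : ℕ} (f : Fin (j + 1) → LaurentSeries k) :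
    wedgeAlt k (j + 1) f = HeisCliff.fermion _ (f 0, 0) * wedgeAlt k j (Fin.tail f) := by
  simp only [wedgeAlt, LinearMap.compAlternatingMap_apply, ExteriorAlgebra.ιMulti_succ_apply,
    AlgHom.toLinearMap_apply, map_mul, ExteriorAlgebra.lift_ι_apply]
  rfl

/-- Right multiplication by the product of the `t ^ e i` in the Clifford algebra. -/
noncomputable def Vac.wedge (k : Type u) [Field k] {j : ℕ} (e : Fin j → ℤ) :
    Module.End k (Vac k) :=
  VacuumModule.mulRight _ _ _ (wedgeAlt k j fun i => HahnSeries.single (e i) 1)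

theorem Vac.wedge_zero (e : Fin 0 → ℤ) (w : Vac k) : Vac.wedge k e w = w := by
  rw [Vac.wedge, wedgeAlt_zero, VacuumModule.mulRight_one]

theorem Vac.wedge_succ {j : ℕ} (e : Fin (j + 1) → ℤ) (w : Vac k) :
    Vac.wedge k e w = Vac.wedge k (Fin.tail e) (Vac.fermionV k (e 0) w) := by
  rw [Vac.wedge, wedgeAlt_succ, VacuumModule.mulRight_mul]
  rfl

/-- A right action reads a product from left to right, so the appended factor acts last. -/
theorem Vac.wedge_snoc {j : ℕ} (e : Fin j → ℤ) (c : ℤ) (w : Vac k) :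
    Vac.wedge k (Fin.snoc e c : Fin (j + 1) → ℤ) w = Vac.fermionV k c (Vac.wedge k e w) := by
  induction j generalizing w with
  | zero =>
    rw [Vac.wedge_succ, Vac.wedge_zero, Vac.wedge_zero]
    rfl
  | succ j ih =>
    rw [Vac.wedge_succ, Vac.wedge_succ e, ← ih]
    congr 2
    rw [← Fin.cons_self_tail e, ← Fin.cons_snoc_eq_snoc_cons]
    simp

theorem Vac.wedge_insertNth {j : ℕ} (i : Fin (j + 1)) (c : ℤ) (e : Fin j → ℤ) (w : Vac k) :
    Vac.wedge k (i.insertNth c e : Fin (j + 1) → ℤ) w =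
      (-1 : ℤ) ^ (i : ℕ) • Vac.wedge k (Fin.cons c e : Fin (j + 1) → ℤ) w := by
  have h1 : (fun r => HahnSeries.single ((i.insertNth c e : Fin (j + 1) → ℤ) r) (1 : k)) =
      i.insertNth (HahnSeries.single c 1) fun r => HahnSeries.single (e r) 1 := by
    funext r
    refine Fin.succAboveCases i ?_ (fun r => ?_) r <;> simp
  have h2 : (fun r => HahnSeries.single ((Fin.cons c e : Fin (j + 1) → ℤ) r) (1 : k)) =
      Matrix.vecCons (HahnSeries.single c 1) fun r => HahnSeries.single (e r) 1 := by
    funext r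
    refine Fin.cases ?_ (fun r => ?_) r <;> simp
  rw [Vac.wedge, Vac.wedge, h1, h2, AlternatingMap.map_insertNth]
  rcases neg_one_pow_eq_or ℤ (i : ℕ) with h | h
  · rw [h, one_smul, one_smul]
  · rw [h, neg_one_smul, neg_one_smul, VacuumModule.mulRight_neg]

theorem Vac.wedge_of_not_injective {j : ℕ} {e : Fin j → ℤ} (he : ¬Function.Injective e)
    (w : Vac k) : Vac.wedge k e w = 0 := by
  rw [Vac.wedge, AlternatingMap.map_eq_zero_of_not_injective]
  · rw [← zero_smul k (0 : HeisCliff (resPairing k)), VacuumModule.mulRight_smul, zero_smul]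
  · intro h
    refine he fun a b hab => h ?_
    simp only [hab]

theorem Vac.bosonV_wedge {j : ℕ} (n : ℤ) (e : Fin j → ℤ) (w : Vac k) :
    Vac.bosonV k n (Vac.wedge k e w) = Vac.wedge k e (Vac.bosonV k n w) := by
  induction j generalizing w with
  | zero => rw [Vac.wedge_zero, Vac.wedge_zero]
  | succ j ih => rw [Vac.wedge_succ, ih, Vac.wedge_succ e, Vac.bosonV_fermionV]

theorem Vac.bosonL_wedge {j : ℕ} (n : ℤ) (e : Fin j → ℤ) (w : Vac k) :
    Vac.bosonL k n (Vac.wedge k e w) = Vac.wedge k e (Vac.bosonL k n w) := by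
  induction j generalizing w with
  | zero => rw [Vac.wedge_zero, Vac.wedge_zero]
  | succ j ih => rw [Vac.wedge_succ, ih, Vac.wedge_succ e, Vac.bosonL_fermionV]

/-- The element `t^{-c-1}dt` enters from the right, crosses the `j - i` factors after position `i`,
and cancels there against `t^c`. What crosses the whole product reaches `w` and dies. -/
theorem Vac.fermionL_wedge {j : ℕ} (c : ℤ) (e : Fin (j + 1) → ℤ) {w : Vac k}
    (hw : Vac.fermionL k (-c - 1) w = 0) :
    Vac.fermionL k (-c - 1) (Vac.wedge k e w) =
      ∑ i : Fin (j + 1), if e i = c then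
        (-1 : ℤ) ^ (j - (i : ℕ)) • Vac.wedge k (fun r => e (i.succAbove r)) w else 0 := by
  have comm (n : ℤ) (w : Vac k) : Vac.fermionL k (-c - 1) (Vac.fermionV k n w) =
      -Vac.fermionV k n (Vac.fermionL k (-c - 1) w) + if n = c then w else 0 := by
    rw [Vac.fermionV_fermionL]
    have : -c - 1 + n = -1 ↔ n = c := by omega
    simp only [this]
    split_ifs <;> simp
  induction j with
  | zero =>
    rw [Vac.wedge_succ, Vac.wedge_zero, comm, hw]
    simp [Vac.wedge_zero]
  | succ j ih =>
    obtain ⟨e', n, rfl⟩ : ∃ (e' : Fin (j + 1) → ℤ) (n : ℤ), e = Fin.snoc e' n :=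
      ⟨Fin.init e, e (Fin.last _), (Fin.snoc_init_self e).symm⟩
    rw [Vac.wedge_snoc, comm, ih, Fin.sum_univ_castSucc (n := j + 1)]
    congr 1
    · rw [map_sum, ← Finset.sum_neg_distrib]
      refine Finset.sum_congr rfl fun i _ => ?_
      rw [Fin.snoc_castSucc]
      split_ifs
      · have h : (fun r => (Fin.snoc e' n : Fin (j + 1 + 1) → ℤ) (i.castSucc.succAbove r)) =
            Fin.snoc (fun r => e' (i.succAbove r)) n := by
          funext r
          refine Fin.lastCases ?_ (fun r => ?_) r
          · have : i.castSucc.succAbove (Fin.last j) = Fin.last (j + 1) :=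
              Fin.succAbove_ne_last_last (Fin.castSucc_lt_last i).ne
            rw [Fin.snoc_last, this, Fin.snoc_last]
          · have : i.castSucc.succAbove r.castSucc = (i.succAbove r).castSucc :=
              Fin.castSucc_succAbove_castSucc
            rw [Fin.snoc_castSucc, this, Fin.snoc_castSucc]
        rw [h, Vac.wedge_snoc, Fin.val_castSucc, Nat.succ_sub (by omega), pow_succ, map_zsmul]
        simp
      · simp
    · simp only [Fin.snoc_last, Fin.val_last, Nat.sub_self, pow_zero, one_smul]
      congr 3
      funext r
      rw [Fin.succAbove_last, Fin.snoc_castSucc]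

/-- Vectors that are killed by the fermionic annihilation operators. -/
def Vac.IsFermionVac (w : Vac k) : Prop :=
  ∀ n : ℤ, 0 ≤ n → Vac.fermionV k n w = 0 ∧ Vac.fermionL k n w = 0

/-- Right multiplication by the product of the `t ^ (-i - 1) dt`, `i < K`, in the Clifford algebra. -/
noncomputable def Vac.fill (k : Type u) [Field k] : ℕ → Module.End k (Vac k)
  | 0 => 1
  | K + 1 => Vac.fermionL k (-(K : ℤ) - 1) * Vac.fill k K

theorem Vac.fill_succ (K : ℕ) (w : Vac k) :
    Vac.fill k (K + 1) w = Vac.fermionL k (-(K : ℤ) - 1) (Vac.fill k K w) := rfl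

theorem Vac.bosonV_fill (n : ℤ) (K : ℕ) (w : Vac k) :
    Vac.bosonV k n (Vac.fill k K w) = Vac.fill k K (Vac.bosonV k n w) := by
  induction K with
  | zero => rfl
  | succ K ih => rw [Vac.fill_succ, Vac.bosonV_fermionL, ih, Vac.fill_succ]

theorem Vac.bosonL_fill (n : ℤ) (K : ℕ) (w : Vac k) :
    Vac.bosonL k n (Vac.fill k K w) = Vac.fill k K (Vac.bosonL k n w) := by
  induction K with
  | zero => rfl
  | succ K ih => rw [Vac.fill_succ, Vac.bosonL_fermionL, ih, Vac.fill_succ]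

/-- For `0 ≤ c < K` the factor `t^{-c-1}dt` already occurs in the product; for `c < 0` it
anticommutes with every factor and kills `w`. With `K = M + 1`, filled vectors thus behave like
fields of degree zero on `L^ε_M`. -/
theorem Vac.fermionL_fill {w : Vac k} (hw : Vac.IsFermionVac w) (K : ℕ) (c : ℤ) (hc : c < K) :
    Vac.fermionL k (-c - 1) (Vac.fill k K w) = 0 := by
  induction K with
  | zero => exact (hw _ (by push_cast at hc; omega)).2
  | succ K ih =>
    rw [Vac.fill_succ]
    rcases eq_or_ne c K with rfl | h
    · exact Vac.fermionL_fermionL_self _ _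
    · rw [Vac.fermionL_fermionL, ih (by push_cast at hc; omega), map_zero, neg_zero]

theorem Vac.fermionV_fill {w : Vac k} (hw : Vac.IsFermionVac w) (K : ℕ) (m : ℤ) (hm : K ≤ m) :
    Vac.fermionV k m (Vac.fill k K w) = 0 := by
  induction K with
  | zero => exact (hw _ (by simpa using hm)).1
  | succ K ih =>
    have h : -(K : ℤ) - 1 + m ≠ -1 := by push_cast at hm; omega
    rw [Vac.fill_succ, Vac.fermionV_fermionL, ih (by push_cast at hm; omega), map_zero, neg_zero,
      if_neg h, zero_smul, add_zero]

/-- The last factor `t^{-K-1}dt` is cancelled by `t^K`, which has no partner among the earlier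
factors. With `K = M + 1` this gives compatibility with the transition from `M` to `M + 1`. -/
theorem Vac.fermionV_fill_succ {w : Vac k} (hw : Vac.IsFermionVac w) (K : ℕ) :
    Vac.fermionV k K (Vac.fill k (K + 1) w) = Vac.fill k K w := by
  have h : -(K : ℤ) - 1 + K = -1 := by omega
  rw [Vac.fill_succ, Vac.fermionV_fermionL, Vac.fermionV_fill hw K K le_rfl, map_zero, neg_zero,
    if_pos h, one_smul, zero_add]

theorem Vac.eq_zero_of_fill_eq_zero {w : Vac k} (hw : Vac.IsFermionVac w) {K : ℕ}
    (h : Vac.fill k K w = 0) : w = 0 := by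
  induction K with
  | zero => exact h
  | succ K ih => exact ih (by rw [← Vac.fermionV_fill_succ hw, h, map_zero])

/-- The image arises from the vacuum vector by bosonic operators alone, and these commute with the
fermions. -/
theorem Push.isFermionVac_toVac {M N : ℕ} (v : Push k (Fin (M + 1)) (Fin N)) :
    Vac.IsFermionVac (Push.toVac k M N v) := by
  intro n hn
  have h : (LinearMap.ker (Vac.fermionV k n) ⊓ LinearMap.ker (Vac.fermionL k n)).comap
      (Push.toVac k M N) = ⊤ := by
    refine Push.eq_top_of_stable _ ?_ ?_ ?_
    · rw [Submodule.mem_comap, Push.toVac_gen]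
      exact ⟨Vac.fermionV_vac hn, Vac.fermionL_vac hn⟩
    · rintro c v ⟨h1, h2⟩
      rw [SetLike.mem_coe, LinearMap.mem_ker] at h1 h2
      rw [Submodule.mem_comap, Push.toVac_mulRight, Vac.weylAct_x]
      exact ⟨by rw [SetLike.mem_coe, LinearMap.mem_ker, ← Vac.bosonL_fermionV, h1, map_zero],
        by rw [SetLike.mem_coe, LinearMap.mem_ker, ← Vac.bosonL_fermionL, h2, map_zero]⟩
    · rintro c v ⟨h1, h2⟩
      rw [SetLike.mem_coe, LinearMap.mem_ker] at h1 h2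
      rw [Submodule.mem_comap, Push.toVac_mulRight_d]
      exact Submodule.neg_mem _
        ⟨by rw [SetLike.mem_coe, LinearMap.mem_ker, ← Vac.bosonV_fermionV, h1, map_zero],
          by rw [SetLike.mem_coe, LinearMap.mem_ker, ← Vac.bosonV_fermionL, h2, map_zero]⟩
  have hv : v ∈ (LinearMap.ker (Vac.fermionV k n) ⊓ LinearMap.ker (Vac.fermionL k n)).comap
      (Push.toVac k M N) := by rw [h]; trivial
  exact hv

end FermionMap

/-! ### Kähler differentials of the truncated schemes -/

section Kaehler

open MvPolynomial

variable {k : Type u} [Field k]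

theorem kaehlerMap_D {A B : Type*} [CommRing A] [CommRing B] [Algebra k A] [Algebra k B]
    (f : A →ₐ[k] B) (a : A) :
    kaehlerMap f (KaehlerDifferential.D k A a) = KaehlerDifferential.D k B (f a) := by
  let _ := f.toRingHom.toAlgebra
  have : IsScalarTower k A B := IsScalarTower.of_algebraMap_eq fun c => (f.commutes c).symm
  exact KaehlerDifferential.map_D k k A B a

theorem kaehlerMap_smul {A B : Type*} [CommRing A] [CommRing B] [Algebra k A] [Algebra k B]
    (f : A →ₐ[k] B) (a : A) (η : Ω[A⁄k]) : kaehlerMap f (a • η) = f a • kaehlerMap f η := by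
  let _ := f.toRingHom.toAlgebra
  have : IsScalarTower k A B := IsScalarTower.of_algebraMap_eq fun c => (f.commutes c).symm
  refine ((KaehlerDifferential.map k k A B).map_smul a η).trans ?_
  exact (algebraMap_smul B a (KaehlerDifferential.map k k A B η)).symm

variable {M N : ℕ} {ε : Fin N → ℕ}

theorem mk_smul_kaehler (p : MvPolynomial (Coord M N) k) (η : Ω[NilRing k M N ε⁄k]) :
    (Ideal.Quotient.mk (nilIdeal k M N ε) p) • η = p • η :=
  algebraMap_smul (NilRing k M N ε) p η

/-- The differentials of the coordinates generate the module of differentials. -/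
theorem span_coordForm :
    Submodule.span (MvPolynomial (Coord M N) k) (Set.range (coordForm k (M := M) ε)) = ⊤ := by
  set U := Submodule.span (MvPolynomial (Coord M N) k) (Set.range (coordForm k (M := M) ε)) with hU
  have hD (p : MvPolynomial (Coord M N) k) : KaehlerDifferential.D k (NilRing k M N ε)
      (Ideal.Quotient.mk _ p) ∈ U := by
    induction p using MvPolynomial.induction_on with
    | C c =>
      rw [show Ideal.Quotient.mk (nilIdeal k M N ε) (C c) = algebraMap k _ c from rfl,
        Derivation.map_algebraMap]
      exact U.zero_mem
    | add p q hp hq => rw [map_add, map_add]; exact U.add_mem hp hq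
    | mul_X p c hp =>
      rw [map_mul, Derivation.leibniz, mk_smul_kaehler, mk_smul_kaehler]
      exact U.add_mem (U.smul_mem _ (Submodule.subset_span ⟨c, rfl⟩)) (U.smul_mem _ hp)
  refine eq_top_iff.2 fun η _ => ?_
  have hη : η ∈ Submodule.span (NilRing k M N ε)
      (Set.range (KaehlerDifferential.D k (NilRing k M N ε))) := by
    rw [KaehlerDifferential.span_range_derivation]
    trivial
  induction hη using Submodule.span_induction with
  | mem x hx =>
    obtain ⟨a, rfl⟩ := hx
    obtain ⟨p, rfl⟩ := Ideal.Quotient.mk_surjective a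
    exact hD p
  | zero => exact U.zero_mem
  | add x y _ _ hx hy => exact U.add_mem (hx trivial) (hy trivial)
  | smul a x _ hx =>
    obtain ⟨p, rfl⟩ := Ideal.Quotient.mk_surjective a
    rw [mk_smul_kaehler]
    exact U.smul_mem _ (hx trivial)

/-- The forms `da` generate but are not free, since `(1 + ε_l) a_l^{ε_l} da_l = 0` for `l < 0`. They
therefore give uniqueness of polyvector fields, but not existence. -/
theorem PolyField.ext {j : ℕ} {φ φ' : PolyField k M N ε j}
    (h : ∀ e : Fin j → Coord M N, φ (fun r => coordForm k ε (e r)) =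
      φ' fun r => coordForm k ε (e r)) : φ = φ' := by
  refine AlternatingMap.coe_multilinearMap_injective
    (MultilinearMap.ext_of_span_eq_top (g := fun _ => coordForm k ε)
      (fun _ => span_coordForm) fun e => ?_)
  exact h e

end Kaehler

/-! ### Transition along closed embeddings -/

section PushMap

open MvPolynomial

variable {k : Type u} [Field k]

theorem Push.map_mulRight {τ ν τ' ν' : Type*} (f : τ ↪ τ') (g : ν ↪ ν') (P : Weyl k (τ ⊕ ν))
    (v : Push k τ ν) :
    Push.map f g (Push.mulRight P v) =
      Push.mulRight (Weyl.map (f.sumMap g) P) (Push.map f g v) := by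
  refine LinearMap.congr_fun (f := Push.map f g ∘ₗ Push.mulRight P)
    (g := Push.mulRight (Weyl.map (f.sumMap g) P) ∘ₗ Push.map f g)
    (Push.hom_ext fun m Q => ?_) v
  change Push.mk (rename f m ⊗ₜ[k] Weyl.map (f.sumMap g) (Q * P)) =
    Push.mk (rename f m ⊗ₜ[k] (Weyl.map (f.sumMap g) Q * Weyl.map (f.sumMap g) P))
  rw [map_mul]

theorem Push.map_smul_rename {τ ν τ' ν' : Type*} (f : τ ↪ τ') (g : ν ↪ ν')
    (p : MvPolynomial (τ ⊕ ν) k) (v : Push k τ ν) :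
    Push.map f g (p • v) = (rename (f.sumMap g) p : MvPolynomial (τ' ⊕ ν') k) • Push.map f g v := by
  induction p using MvPolynomial.induction_on generalizing v with
  | C c =>
    rw [rename_C, C_eq_smul_one, C_eq_smul_one, smul_assoc, smul_assoc, one_smul, one_smul,
      map_smul]
  | add p q hp hq => rw [map_add, add_smul, add_smul, map_add, hp, hq]
  | mul_X p c hp =>
    rw [map_mul, mul_smul, mul_smul, hp, rename_X, Push.X_smul, Push.X_smul, Push.map_mulRight,
      Weyl.map_x]

/-- The new normal coordinates act by zero on the image of a direct image. -/
theorem Push.mulRight_x_map {τ ν τ' ν' : Type*} (f : τ ↪ τ') (g : ν ↪ ν') (n : ν')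
    (hn : n ∉ Set.range g) (v : Push k τ ν) :
    Push.mulRight (Weyl.x (Sum.inr n)) (Push.map f g v) = 0 := by
  have h : (LinearMap.ker (Push.mulRight (Weyl.x (Sum.inr n)) : Module.End k (Push k τ' ν'))).comap
      (Push.map f g) = ⊤ := by
    refine Push.eq_top_of_stable _ ?_ ?_ ?_
    · have : Push.map f g (Push.gen k τ ν) = Push.gen k τ' ν' := by
        change Push.mk (rename f 1 ⊗ₜ[k] Weyl.map (f.sumMap g) 1) = _
        rw [map_one, map_one]
        rfl
      rw [Submodule.mem_comap, this, LinearMap.mem_ker, Push.mulRight_x_gen]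
    · intro c v hv
      rw [Submodule.mem_comap, LinearMap.mem_ker] at hv ⊢
      rw [Push.map_mulRight, Weyl.map_x]
      have := LinearMap.congr_fun (Push.mulRight_x_comm (k := k) (Sum.inr n) (f.sumMap g c))
        (Push.map f g v)
      rw [Module.End.mul_apply, Module.End.mul_apply, hv, map_zero] at this
      exact this
    · intro c v hv
      rw [Submodule.mem_comap, LinearMap.mem_ker] at hv ⊢
      have hne : (Sum.inr n : τ' ⊕ ν') ≠ f.sumMap g c := by
        rcases c with c | c
        · exact Sum.inr_ne_inl
        · exact fun e => hn ⟨c, (Sum.inr_injective e).symm⟩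
      rw [Push.map_mulRight, Weyl.map_d, Push.mulRight_x_d_of_ne hne, hv, map_zero]
  have hv : v ∈ (LinearMap.ker (Push.mulRight (Weyl.x (Sum.inr n)) :
      Module.End k (Push k τ' ν'))).comap (Push.map f g) := by rw [h]; trivial
  exact hv

variable {M N N' : ℕ}

/-- The restriction of polynomials to a coordinate subspace. -/
noncomputable def polyRestrict (k : Type u) [Field k] (M N N' : ℕ) :
    MvPolynomial (Coord M N') k →ₐ[k] MvPolynomial (Coord M N) k :=
  aeval (Sum.elim (fun m => X (Sum.inl m))
    (fun n => if hn : (n : ℕ) < N then X (Sum.inr ⟨n, hn⟩) else 0))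

theorem nilRestrict_mk (ε : Fin N → ℕ) (ε' : Fin N' → ℕ) (hN : N ≤ N')
    (h : ∀ n, ε n ≤ ε' (Fin.castLE hN n)) (p : MvPolynomial (Coord M N') k) :
    nilRestrict M ε ε' hN h (Ideal.Quotient.mk _ p) =
      Ideal.Quotient.mk _ (polyRestrict k M N N' p) := by
  have : (nilRestrict (k := k) M ε ε' hN h).comp (Ideal.Quotient.mkₐ k _) =
      (Ideal.Quotient.mkₐ k _).comp (polyRestrict k M N N') := by
    refine MvPolynomial.algHom_ext fun c => ?_
    change aeval (Sum.elim (fun m => Ideal.Quotient.mk (nilIdeal k M N ε) (X (Sum.inl m)))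
      (fun n : Fin N' => if hn : (n : ℕ) < N then
        Ideal.Quotient.mk (nilIdeal k M N ε) (X (Sum.inr ⟨n, hn⟩)) else 0)) (X c) =
      Ideal.Quotient.mk (nilIdeal k M N ε) (polyRestrict k M N N' (X c))
    rw [aeval_X, polyRestrict, aeval_X]
    rcases c with c | c
    · rfl
    · simp only [Sum.elim_inr]
      split_ifs
      · rfl
      · rw [map_zero]
  exact AlgHom.congr_fun this p

/-- A function acts through its restriction, because the new normal coordinates act by zero on the
image (`Push.mulRight_x_map`). -/
theorem Push.smul_map_castLE (hN : N ≤ N') (p : MvPolynomial (Coord M N') k)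
    (v : Push k (Fin (M + 1)) (Fin N)) :
    p • Push.map (Function.Embedding.refl _) (Fin.castLEEmb hN) v =
      Push.map (Function.Embedding.refl _) (Fin.castLEEmb hN) (polyRestrict k M N N' p • v) := by
  induction p using MvPolynomial.induction_on generalizing v with
  | C c =>
    rw [← algebraMap_eq, AlgHom.commutes, algebraMap_smul, algebraMap_smul, map_smul]
  | add p q hp hq => rw [map_add, add_smul, add_smul, map_add, hp, hq]
  | mul_X p c hp =>
    rw [map_mul, mul_comm, mul_smul, hp, mul_comm (polyRestrict k M N N' p), mul_smul, Push.X_smul]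
    rcases c with c | c
    · rw [polyRestrict, aeval_X, Sum.elim_inl, Push.X_smul, Push.map_mulRight, Weyl.map_x]
      rfl
    · rw [polyRestrict, aeval_X, Sum.elim_inr]
      split_ifs with hn
      · rw [Push.X_smul, Push.map_mulRight, Weyl.map_x]
        rfl
      · rw [zero_smul, map_zero, Push.mulRight_x_map]
        rintro ⟨a, rfl⟩
        exact hn a.2

variable {ε : Fin N → ℕ} {ε' : Fin N' → ℕ}

theorem polyRestrict_nilIdeal (hN : N ≤ N') (h : ∀ n, ε n ≤ ε' (Fin.castLE hN n))
    {p : MvPolynomial (Coord M N') k} (hp : p ∈ nilIdeal k M N' ε') :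
    polyRestrict k M N N' p ∈ nilIdeal k M N ε := by
  rw [← Ideal.Quotient.eq_zero_iff_mem, ← nilRestrict_mk ε ε' hN h,
    Ideal.Quotient.eq_zero_iff_mem.2 hp, map_zero]

/-- The transition map of polyvector fields for a closed embedding. -/
noncomputable def PolyField.pushforward {j : ℕ} (hN : N ≤ N')
    (h : ∀ n, ε n ≤ ε' (Fin.castLE hN n)) (φ : PolyField k M N ε j) : PolyField k M N' ε' j where
  toFun η := ⟨Push.map (Function.Embedding.refl _) (Fin.castLEEmb hN)
    (φ fun r => kaehlerMap (nilRestrict M ε ε' hN h) (η r) : Push k (Fin (M + 1)) (Fin N)), by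
      rw [Submodule.mem_torsionBySet_iff]
      rintro ⟨p, hp⟩
      rw [Subtype.coe_mk, Push.smul_map_castLE]
      have := (φ fun r => kaehlerMap (nilRestrict M ε ε' hN h) (η r)).2
      rw [Submodule.mem_torsionBySet_iff] at this
      rw [this ⟨_, polyRestrict_nilIdeal hN h hp⟩, map_zero]⟩
  map_update_add' η i x y := by
    refine Subtype.ext ?_
    simp only [Function.apply_update (fun _ => kaehlerMap (nilRestrict (k := k) M ε ε' hN h)),
      map_add, AlternatingMap.map_update_add, Submodule.coe_add]
  map_update_smul' η i p x := by
    refine Subtype.ext ?_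
    simp only [Function.apply_update (fun _ => kaehlerMap (nilRestrict (k := k) M ε ε' hN h)),
      Submodule.coe_smul]
    rw [← mk_smul_kaehler, kaehlerMap_smul, nilRestrict_mk, mk_smul_kaehler,
      AlternatingMap.map_update_smul, Submodule.coe_smul, Push.smul_map_castLE]
  map_eq_zero_of_eq' η i i' hη hi := by
    refine Subtype.ext ?_
    simp only [φ.map_eq_zero_of_eq (fun r => kaehlerMap (nilRestrict M ε ε' hN h) (η r))
      (congrArg _ hη) hi, Submodule.coe_zero, map_zero]

theorem PolyField.isPushforward_pushforward {j : ℕ} (hN : N ≤ N')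
    (h : ∀ n, ε n ≤ ε' (Fin.castLE hN n)) (φ : PolyField k M N ε j) :
    IsPushforward hN h φ (φ.pushforward hN h) := fun _ => rfl

end PushMap

/-! ### Coefficients of forms and elementary polyvector fields -/

section Elementary

open MvPolynomial

variable (k : Type u) [Field k] {M N : ℕ} (ε : Fin N → ℕ)

/-- The ideal generated by `a_l ^ ε_l` for `-N ≤ l < 0`. -/
noncomputable def lowIdeal (M : ℕ) {N : ℕ} (ε : Fin N → ℕ) : Ideal (MvPolynomial (Coord M N) k) :=
  Ideal.span (Set.range fun n => X (Sum.inr n) ^ ε n)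

/-- The quotient by `lowIdeal`; the coefficients of differential forms are well defined there. -/
abbrev LowRing (M : ℕ) {N : ℕ} (ε : Fin N → ℕ) : Type u :=
  MvPolynomial (Coord M N) k ⧸ lowIdeal k M ε

variable {k}

theorem nilIdeal_le_lowIdeal : nilIdeal k M N ε ≤ lowIdeal k M ε := by
  refine Ideal.span_le.2 ?_
  rintro _ ⟨n, rfl⟩
  exact Ideal.mem_of_dvd _ (pow_dvd_pow _ (Nat.le_add_left _ 1)) (Ideal.subset_span ⟨n, rfl⟩)

/-- Differentiating `a_l^{1+ε_l}` loses one power. So the coefficients of a form on `L^ε_M` make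
sense only modulo the powers `a_l^{ε_l}`, which is the reason for `lowIdeal`. -/
theorem pderiv_mem_lowIdeal (c : Coord M N) {p : MvPolynomial (Coord M N) k}
    (hp : p ∈ nilIdeal k M N ε) : pderiv c p ∈ lowIdeal k M ε := by
  induction hp using Submodule.span_induction with
  | mem x hx =>
    obtain ⟨n, rfl⟩ := hx
    simp only [pderiv_pow, Nat.add_sub_cancel_left]
    exact Ideal.mul_mem_right _ _ (Ideal.mul_mem_left _ _ (Ideal.subset_span ⟨n, rfl⟩))
  | zero => rw [map_zero]; exact Ideal.zero_mem _
  | add x y _ _ hx hy => rw [map_add]; exact Ideal.add_mem _ hx hy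
  | smul a x hx hx' =>
    rw [smul_eq_mul, Derivation.leibniz, smul_eq_mul, smul_eq_mul]
    exact Ideal.add_mem _ (Ideal.mul_mem_left _ _ hx')
      (Ideal.mul_mem_right _ _ (nilIdeal_le_lowIdeal ε hx))

/-- The functions on `L^ε_M` act on `LowRing`. -/
noncomputable abbrev lowModule : Module (NilRing k M N ε) (LowRing k M ε) :=
  Module.compHom _ (Ideal.Quotient.factor (nilIdeal_le_lowIdeal (k := k) (M := M) ε))

/-- The partial derivative as a linear map of quotients. -/
noncomputable def lowPDeriv (c : Coord M N) : NilRing k M N ε →ₗ[k] LowRing k M ε :=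
  (Submodule.liftQ ((nilIdeal k M N ε).restrictScalars k)
    ((Ideal.Quotient.mkₐ k (lowIdeal k M ε)).toLinearMap ∘ₗ (pderiv c).toLinearMap) <| by
      intro p hp
      exact Ideal.Quotient.eq_zero_iff_mem.2 (pderiv_mem_lowIdeal ε c hp)) ∘ₗ
    (Submodule.Quotient.restrictScalarsEquiv k (nilIdeal k M N ε)).symm.toLinearMap

theorem lowPDeriv_mk (c : Coord M N) (p : MvPolynomial (Coord M N) k) :
    lowPDeriv ε c (Ideal.Quotient.mk _ p) = Ideal.Quotient.mk _ (pderiv c p) := rfl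

attribute [local instance] lowModule

theorem lowModule_mk_smul (p q : MvPolynomial (Coord M N) k) :
    Ideal.Quotient.mk (nilIdeal k M N ε) p • Ideal.Quotient.mk (lowIdeal k M ε) q =
      Ideal.Quotient.mk (lowIdeal k M ε) (p * q) := rfl

theorem lowModule_isScalarTower : IsScalarTower k (NilRing k M N ε) (LowRing k M ε) :=
  ⟨fun a b x => by
    obtain ⟨b, rfl⟩ := Ideal.Quotient.mk_surjective b
    obtain ⟨x, rfl⟩ := Ideal.Quotient.mk_surjective x
    change Ideal.Quotient.mk _ ((a • b) * x) = a • Ideal.Quotient.mk _ (b * x)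
    rw [smul_mul_assoc]
    rfl⟩

attribute [local instance] lowModule_isScalarTower

/-- The partial derivative as a derivation. -/
noncomputable def lowDeriv (c : Coord M N) : Derivation k (NilRing k M N ε) (LowRing k M ε) :=
  Derivation.mk' (lowPDeriv ε c) fun a b => by
    obtain ⟨a, rfl⟩ := Ideal.Quotient.mk_surjective a
    obtain ⟨b, rfl⟩ := Ideal.Quotient.mk_surjective b
    rw [← map_mul, lowPDeriv_mk, lowPDeriv_mk, lowPDeriv_mk, lowModule_mk_smul, lowModule_mk_smul,
      ← map_add, Derivation.leibniz, smul_eq_mul, smul_eq_mul]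

/-- The coefficient of `d a` in a differential form. -/
noncomputable def formCoeff (c : Coord M N) :
    Ω[NilRing k M N ε⁄k] →ₗ[MvPolynomial (Coord M N) k] LowRing k M ε where
  toFun := (lowDeriv ε c).liftKaehlerDifferential
  map_add' := map_add _
  map_smul' p η := by
    rw [← mk_smul_kaehler, map_smul]
    obtain ⟨x, hx⟩ := Ideal.Quotient.mk_surjective ((lowDeriv ε c).liftKaehlerDifferential η)
    rw [← hx]
    rfl

theorem formCoeff_D (c : Coord M N) (p : MvPolynomial (Coord M N) k) :
    formCoeff ε c (KaehlerDifferential.D k (NilRing k M N ε) (Ideal.Quotient.mk _ p)) =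
      Ideal.Quotient.mk _ (pderiv c p) :=
  (Derivation.liftKaehlerDifferential_comp_D (lowDeriv ε c) _).trans (lowPDeriv_mk ε c p)

theorem formCoeff_coordForm (c d : Coord M N) [Decidable (d = c)] :
    formCoeff ε c (coordForm k ε d) = Ideal.Quotient.mk _ (if d = c then 1 else 0) := by
  classical
  rw [coordForm, formCoeff_D, pderiv_X, Pi.single_apply]
  congr 1
  split_ifs <;> simp_all

/-- The minor of an array of differential forms. -/
noncomputable def formMinor {j : ℕ} (e : Fin j → Coord M N) :
    Ω[NilRing k M N ε⁄k] [⋀^Fin j]→ₗ[MvPolynomial (Coord M N) k] LowRing k M ε where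
  toMultilinearMap := ((Matrix.detRowAlternating (n := Fin j)
    (R := LowRing k M ε)).toMultilinearMap.restrictScalars
      (MvPolynomial (Coord M N) k)).compLinearMap fun _ => LinearMap.pi fun r => formCoeff ε (e r)
  map_eq_zero_of_eq' η i i' h hi :=
    Matrix.det_zero_of_row_eq hi (by funext r; simp [h])

theorem formMinor_apply {j : ℕ} (e : Fin j → Coord M N) (η : Fin j → Ω[NilRing k M N ε⁄k]) :
    formMinor ε e η = Matrix.det (Matrix.of fun s r => formCoeff ε (e r) (η s)) := rfl

theorem torsion_lowIdeal_le :
    Submodule.torsionBySet (MvPolynomial (Coord M N) k) (Push k (Fin (M + 1)) (Fin N))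
      (lowIdeal k M ε : Set (MvPolynomial (Coord M N) k)) ≤ OmegaO k M N ε :=
  fun _ hv => (Submodule.mem_torsionBySet_iff _ _).2 fun ⟨p, hp⟩ =>
    (Submodule.mem_torsionBySet_iff _ _).1 hv ⟨p, nilIdeal_le_lowIdeal ε hp⟩

variable {ε}

/-- The polyvector field `v ⊗ ∂ e_0 ∧ ⋯ ∧ ∂ e_{j-1}`. -/
noncomputable def elementary {j : ℕ} (e : Fin j → Coord M N)
    (v : Push k (Fin (M + 1)) (Fin N))
    (hv : v ∈ Submodule.torsionBySet (MvPolynomial (Coord M N) k) (Push k (Fin (M + 1)) (Fin N))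
      (lowIdeal k M ε : Set (MvPolynomial (Coord M N) k))) : PolyField k M N ε j :=
  (Submodule.liftQ (lowIdeal k M ε)
    (LinearMap.toSpanSingleton (MvPolynomial (Coord M N) k) (OmegaO k M N ε)
      ⟨v, torsion_lowIdeal_le ε hv⟩) fun p hp => Subtype.ext
        ((Submodule.mem_torsionBySet_iff _ _).1 hv ⟨p, hp⟩)).compAlternatingMap (formMinor ε e)

theorem elementary_apply {j : ℕ} (e : Fin j → Coord M N) {v : Push k (Fin (M + 1)) (Fin N)}
    (hv : v ∈ Submodule.torsionBySet (MvPolynomial (Coord M N) k) (Push k (Fin (M + 1)) (Fin N))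
      (lowIdeal k M ε : Set (MvPolynomial (Coord M N) k)))
    {η : Fin j → Ω[NilRing k M N ε⁄k]} {q : MvPolynomial (Coord M N) k}
    (hq : formMinor ε e η = Ideal.Quotient.mk _ q) :
    (elementary e v hv η : Push k (Fin (M + 1)) (Fin N)) = q • v := by
  rw [elementary, LinearMap.compAlternatingMap_apply, hq]
  rfl

-- Expansion of the minor: an array of coordinate forms gives a permutation matrix when `e'` is a
-- rearrangement of an injective `e`. If `e` has repetitions, several `σ` can occur and their signs
-- cancel.
open Classical in
theorem elementary_coordForm {j : ℕ} (e e' : Fin j → Coord M N)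
    {v : Push k (Fin (M + 1)) (Fin N)}
    (hv : v ∈ Submodule.torsionBySet (MvPolynomial (Coord M N) k) (Push k (Fin (M + 1)) (Fin N))
      (lowIdeal k M ε : Set (MvPolynomial (Coord M N) k))) :
    (elementary e v hv (fun r => coordForm k ε (e' r)) : Push k (Fin (M + 1)) (Fin N)) =
      ∑ σ : Equiv.Perm (Fin j), if e = e' ∘ σ then (Equiv.Perm.sign σ : ℤ) • v else 0 := by
  have hq : formMinor ε e (fun r => coordForm k ε (e' r)) = Ideal.Quotient.mk (lowIdeal k M ε)
      (Matrix.det (Matrix.of fun s r => if e' s = e r then 1 else 0)) := by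
    rw [formMinor_apply, RingHom.map_det]
    congr 1
    ext s r
    simp only [Matrix.of_apply, formCoeff_coordForm, RingHom.mapMatrix_apply, Matrix.map_apply]
  rw [elementary_apply e hv hq, Matrix.det_apply, Finset.sum_smul]
  refine Finset.sum_congr rfl fun σ _ => ?_
  simp only [Matrix.of_apply]
  rw [Finset.prod_ite_zero]
  simp only [Finset.mem_univ, true_imp_iff, Finset.prod_const_one]
  have : (∀ i, e' (σ i) = e i) ↔ e = e' ∘ σ := by
    rw [funext_iff]
    exact forall_congr' fun i => eq_comm
  simp only [this]
  split_ifs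
  · rw [Units.smul_def, smul_assoc, one_smul]
  · simp

/-- A polyvector field with values in the `lowIdeal`-torsion is a sum of elementary ones. -/
theorem PolyField.eq_sum_elementary [CharZero k] {j : ℕ} (φ : PolyField k M N ε j)
    (hφ : ∀ e : Fin j → Coord M N, (φ fun r => coordForm k ε (e r) : Push k _ _) ∈
      Submodule.torsionBySet (MvPolynomial (Coord M N) k) (Push k (Fin (M + 1)) (Fin N))
        (lowIdeal k M ε : Set (MvPolynomial (Coord M N) k))) :
    φ = (j.factorial : k)⁻¹ • ∑ e : Fin j → Coord M N, elementary e _ (hφ e) := by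
  classical
  have hj : (j.factorial : k) ≠ 0 := Nat.cast_ne_zero.2 j.factorial_ne_zero
  rw [eq_inv_smul_iff₀ hj]
  refine PolyField.ext fun e' => Subtype.ext ?_
  have hs : ((∑ e : Fin j → Coord M N, elementary e _ (hφ e)) fun r => coordForm k ε (e' r)) =
      ∑ e : Fin j → Coord M N, elementary e _ (hφ e) fun r => coordForm k ε (e' r) :=
    map_sum (AddMonoidHom.mk' (fun ψ : PolyField k M N ε j => ψ fun r => coordForm k ε (e' r))
      fun _ _ => rfl) _ _
  rw [hs, AlternatingMap.smul_apply, Submodule.coe_sum]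
  simp only [elementary_coordForm]
  -- For fixed `σ` only `e = e' ∘ σ` contributes, and alternation turns its term into the value at
  -- `e'`; the `j!` equal terms cancel the normalization.
  rw [Finset.sum_comm]
  simp only [Finset.sum_ite_eq', Finset.mem_univ, if_true]
  have h (σ : Equiv.Perm (Fin j)) : (Equiv.Perm.sign σ : ℤ) •
      ((φ fun r => coordForm k ε ((e' ∘ σ) r)) : Push k (Fin (M + 1)) (Fin N)) =
        (φ fun r => coordForm k ε (e' r) : Push k (Fin (M + 1)) (Fin N)) := by
    have := φ.map_perm (fun r => coordForm k ε (e' r)) σ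
    rw [Function.comp_def] at this
    simp only [Function.comp_apply, this]
    rcases Int.units_eq_one_or (Equiv.Perm.sign σ) with h | h <;> simp [h]
  simp only [h, Finset.sum_const, Finset.card_univ, Fintype.card_perm, Fintype.card_fin]
  rw [← Nat.cast_smul_eq_nsmul k]
  rfl

/-- The contraction of a polyvector field with `d a`, from the right. -/
noncomputable def PolyField.contract {j : ℕ} (c : Coord M N) (φ : PolyField k M N ε (j + 1)) :
    PolyField k M N ε j :=
  (-1 : ℤ) ^ j • φ.curryLeft (coordForm k ε c)

/-- The sign `(-1) ^ j` in `contract` moves the form from the first argument past the `j` others. -/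
theorem PolyField.isContraction_contract {j : ℕ} (c : Coord M N)
    (φ : PolyField k M N ε (j + 1)) : IsContraction c φ (φ.contract c) := by
  intro η
  have := φ.map_insertNth (Fin.last j) (coordForm k ε c) η
  rw [Fin.insertNth_last', Fin.val_last] at this
  rw [this]
  rfl

end Elementary

/-! ### Transition in `M`, and reduction of classes to elementary fields -/

section Transition

open MvPolynomial

variable {k : Type u} [Field k] {M N : ℕ} {ε : Fin N → ℕ}

theorem mem_torsion_lowIdeal_iff {v : Push k (Fin (M + 1)) (Fin N)} :
    v ∈ Submodule.torsionBySet (MvPolynomial (Coord M N) k) (Push k (Fin (M + 1)) (Fin N))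
      (lowIdeal k M ε : Set (MvPolynomial (Coord M N) k)) ↔
      ∀ n, (X (Sum.inr n) : MvPolynomial (Coord M N) k) ^ ε n • v = 0 := by
  rw [lowIdeal, ← Submodule.torsionBySet_eq_torsionBySet_span, Submodule.mem_torsionBySet_iff]
  exact ⟨fun h n => h ⟨_, n, rfl⟩, by rintro h ⟨_, n, rfl⟩; exact h n⟩

theorem mem_OmegaO_iff {v : Push k (Fin (M + 1)) (Fin N)} :
    v ∈ OmegaO k M N ε ↔
      ∀ n, (X (Sum.inr n) : MvPolynomial (Coord M N) k) ^ (1 + ε n) • v = 0 := by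
  rw [OmegaO, nilIdeal, ← Submodule.torsionBySet_eq_torsionBySet_span,
    Submodule.mem_torsionBySet_iff]
  exact ⟨fun h n => h ⟨_, n, rfl⟩, by rintro h ⟨_, n, rfl⟩; exact h n⟩

/-- The coordinates of `L_M` as coordinates of `L_{M+1}`. -/
def Coord.castSucc {M N : ℕ} : Coord M N → Coord (M + 1) N := Sum.map Fin.castSucc id

theorem Coord.castSucc_injective : Function.Injective (Coord.castSucc (M := M) (N := N)) :=
  Function.Injective.sumMap (Fin.castSucc_injective _) Function.injective_id

theorem Coord.castSucc_ne_last (c : Coord M N) : c.castSucc ≠ Sum.inl (Fin.last (M + 1)) := by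
  rcases c with c | c
  · exact fun h => (Fin.castSucc_lt_last c).ne (Sum.inl_injective h)
  · exact Sum.inr_ne_inl

theorem Coord.exponent_castSucc (c : Coord M N) : c.castSucc.exponent = c.exponent := by
  rcases c with c | c <;> rfl

theorem nilPull_mk (p : MvPolynomial (Coord M N) k) :
    nilPull M N ε (Ideal.Quotient.mk _ p) = Ideal.Quotient.mk _ (rename Coord.castSucc p) := rfl

theorem kaehlerMap_nilPull_coordForm (c : Coord M N) :
    kaehlerMap (nilPull M N ε) (coordForm k ε c) = coordForm k ε c.castSucc := by
  rw [coordForm, kaehlerMap_D, nilPull_mk, rename_X, coordForm]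

theorem kaehlerMap_nilPull_smul (p : MvPolynomial (Coord M N) k) (η : Ω[NilRing k M N ε⁄k]) :
    kaehlerMap (nilPull M N ε) (p • η) =
      rename Coord.castSucc p • kaehlerMap (nilPull M N ε) η := by
  rw [← mk_smul_kaehler, kaehlerMap_smul, nilPull_mk, mk_smul_kaehler]

/-- The pull-back on the rings of coefficients of forms. -/
noncomputable def lowPull (k : Type u) [Field k] (M : ℕ) {N : ℕ} (ε : Fin N → ℕ) :
    LowRing k M ε →+* LowRing k (M + 1) ε :=
  Ideal.quotientMap _ (rename Coord.castSucc).toRingHom <| by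
    refine Ideal.span_le.2 ?_
    rintro _ ⟨n, rfl⟩
    refine Ideal.subset_span ⟨n, ?_⟩
    simp [Coord.castSucc]

theorem lowPull_mk (p : MvPolynomial (Coord M N) k) :
    lowPull k M ε (Ideal.Quotient.mk _ p) = Ideal.Quotient.mk _ (rename Coord.castSucc p) := rfl

theorem lowPull_smul (p : MvPolynomial (Coord M N) k) (q : LowRing k M ε) :
    lowPull k M ε (p • q) = rename Coord.castSucc p • lowPull k M ε q :=
  map_mul (lowPull k M ε) (Ideal.Quotient.mk _ p) q

theorem formCoeff_castSucc_kaehlerMap (c : Coord M N) (η : Ω[NilRing k M N ε⁄k]) :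
    formCoeff ε c.castSucc (kaehlerMap (nilPull M N ε) η) = lowPull k M ε (formCoeff ε c η) := by
  classical
  have hη : η ∈ Submodule.span (MvPolynomial (Coord M N) k) (Set.range (coordForm k (M := M) ε)) :=
    span_coordForm (k := k) (M := M) (ε := ε) ▸ Submodule.mem_top
  induction hη using Submodule.span_induction with
  | mem x hx =>
    obtain ⟨d, rfl⟩ := hx
    rw [kaehlerMap_nilPull_coordForm, formCoeff_coordForm, formCoeff_coordForm, lowPull_mk]
    simp only [Coord.castSucc_injective.eq_iff]
    congr 1
    split_ifs <;> simp
  | zero => simp only [map_zero]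
  | add x y _ _ hx hy => simp only [map_add, hx, hy]
  | smul p x _ hx => rw [kaehlerMap_nilPull_smul, map_smul, map_smul, hx, lowPull_smul]

theorem formCoeff_last_kaehlerMap (η : Ω[NilRing k M N ε⁄k]) :
    formCoeff ε (Sum.inl (Fin.last (M + 1))) (kaehlerMap (nilPull M N ε) η) = 0 := by
  classical
  have hη : η ∈ Submodule.span (MvPolynomial (Coord M N) k) (Set.range (coordForm k (M := M) ε)) :=
    span_coordForm (k := k) (M := M) (ε := ε) ▸ Submodule.mem_top
  induction hη using Submodule.span_induction with
  | mem x hx =>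
    obtain ⟨d, rfl⟩ := hx
    rw [kaehlerMap_nilPull_coordForm, formCoeff_coordForm, if_neg d.castSucc_ne_last, map_zero]
  | zero => simp only [map_zero]
  | add x y _ _ hx hy => simp only [map_add, hx, hy, add_zero]
  | smul p x _ hx => rw [kaehlerMap_nilPull_smul, map_smul, hx, smul_zero]

theorem Push.map_castSucc_smul (p : MvPolynomial (Coord M N) k) (v : Push k (Fin (M + 1)) (Fin N)) :
    Push.map Fin.castSuccEmb (Function.Embedding.refl _) (p • v) =
      (rename Coord.castSucc p : MvPolynomial (Coord (M + 1) N) k) •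
        Push.map Fin.castSuccEmb (Function.Embedding.refl _) v :=
  Push.map_smul_rename _ _ p v

theorem map_castSucc_mem_torsion_lowIdeal {v : Push k (Fin (M + 1)) (Fin N)}
    (hv : v ∈ Submodule.torsionBySet (MvPolynomial (Coord M N) k) (Push k (Fin (M + 1)) (Fin N))
      (lowIdeal k M ε : Set (MvPolynomial (Coord M N) k))) :
    Push.map Fin.castSuccEmb (Function.Embedding.refl _) v ∈
      Submodule.torsionBySet (MvPolynomial (Coord (M + 1) N) k)
        (Push k (Fin (M + 1 + 1)) (Fin N))
        (lowIdeal k (M + 1) ε : Set (MvPolynomial (Coord (M + 1) N) k)) := by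
  rw [mem_torsion_lowIdeal_iff] at hv ⊢
  intro n
  have := Push.map_castSucc_smul (X (Sum.inr n) ^ ε n) v
  rw [hv n, map_zero, map_pow, rename_X] at this
  exact this.symm

/-- The new vector field stands first, as in `ξ ↦ da ⊗ (∂ ∧ ξ)`. In the minor, the row of `da_{M+1}`
is then a unit vector, and for forms pulled back from `L^ε_M` the column of `∂_{M+1}` is zero. -/
theorem isPullback_elementary {j : ℕ} (e : Fin j → Coord M N) {v : Push k (Fin (M + 1)) (Fin N)}
    (hv : v ∈ Submodule.torsionBySet (MvPolynomial (Coord M N) k) (Push k (Fin (M + 1)) (Fin N))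
      (lowIdeal k M ε : Set (MvPolynomial (Coord M N) k))) :
    IsPullback (elementary e v hv)
      (elementary (Fin.cons (Sum.inl (Fin.last (M + 1))) fun r => (e r).castSucc) _
        (map_castSucc_mem_torsion_lowIdeal hv)) := by
  classical
  refine ⟨fun η => ?_, fun η => Subtype.ext ?_⟩
  · obtain ⟨q, hq⟩ := Ideal.Quotient.mk_surjective (formMinor ε e η)
    rw [elementary_apply e hv hq.symm, Push.map_castSucc_smul]
    refine elementary_apply _ _ ?_
    rw [← lowPull_mk, hq, formMinor_apply, formMinor_apply, Matrix.det_succ_row_zero,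
      Fin.sum_univ_succ, Finset.sum_eq_zero, add_zero, RingHom.map_det]
    · simp only [Fin.val_zero, pow_zero, one_mul, Matrix.of_apply, Fin.cons_zero,
        formCoeff_coordForm, if_true, map_one]
      congr 1
      ext s r
      simp [formCoeff_castSucc_kaehlerMap]
    · intro r _
      simp only [Matrix.of_apply, Fin.cons_zero, Fin.cons_succ, formCoeff_coordForm]
      rw [if_neg (Ne.symm (Coord.castSucc_ne_last _)), map_zero, mul_zero, zero_mul]
  · rw [elementary_apply (q := 0), zero_smul]
    · rfl
    rw [formMinor_apply, map_zero]
    refine Matrix.det_eq_zero_of_column_eq_zero 0 fun s => ?_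
    rw [Matrix.of_apply, Fin.cons_zero, formCoeff_last_kaehlerMap]

theorem polyRestrict_X_inr {N' : ℕ} (n : Fin N') :
    polyRestrict k M N N' (X (Sum.inr n)) =
      if hn : (n : ℕ) < N then X (Sum.inr ⟨n, hn⟩) else 0 := by
  simp [polyRestrict]

theorem polyRestrict_X_inl {N' : ℕ} (m : Fin (M + 1)) :
    polyRestrict k M N N' (X (Sum.inl m)) = X (Sum.inl m) := by
  simp [polyRestrict]

/-- Sections on `L^ε_M` are killed by `a_l^{1+ε_l}`, hence by `a_l^m`, the power that elementary
fields need at the larger stage. The new coordinates act by `0`, and `m ≠ 0` ensures `0 ^ m = 0`. -/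
theorem map_castLE_mem_torsion_lowIdeal {N' m : ℕ} (hN : N ≤ N') (hm : m ≠ 0)
    (hε : ∀ n, 1 + ε n ≤ m) {v : Push k (Fin (M + 1)) (Fin N)} (hv : v ∈ OmegaO k M N ε) :
    Push.map (Function.Embedding.refl _) (Fin.castLEEmb hN) v ∈
      Submodule.torsionBySet (MvPolynomial (Coord M N') k) (Push k (Fin (M + 1)) (Fin N'))
        (lowIdeal k M (fun _ : Fin N' => m) : Set (MvPolynomial (Coord M N') k)) := by
  rw [mem_torsion_lowIdeal_iff]
  rw [mem_OmegaO_iff] at hv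
  intro n
  rw [Push.smul_map_castLE, map_pow, polyRestrict_X_inr]
  split_ifs with hn
  · rw [← Nat.sub_add_cancel (hε ⟨n, hn⟩), pow_add, mul_smul, hv, smul_zero, map_zero]
  · rw [zero_pow hm, zero_smul, map_zero]

theorem DR.cls_eq_of_isPushforward {N' j : ℕ} {ε' : Fin N' → ℕ} {hN : N ≤ N'}
    {h : ∀ n, ε n ≤ ε' (Fin.castLE hN n)} {φ : PolyField k M N ε j} {φ' : PolyField k M N' ε' j}
    (hφ : IsPushforward hN h φ φ') : DR.cls φ = DR.cls φ' :=
  (Submodule.Quotient.eq _).2 (Submodule.subset_span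
    (Or.inl ⟨M, j, N, N', ε, ε', hN, h, φ, φ', hφ, rfl⟩))

theorem DR.cls_eq_of_isPullback {j : ℕ} {φ : PolyField k M N ε j}
    {φ' : PolyField k (M + 1) N ε (j + 1)} (hφ : IsPullback φ φ') : DR.cls φ = DR.cls φ' :=
  (Submodule.Quotient.eq _).2 (Submodule.subset_span
    (Or.inr ⟨M, j, N, ε, φ, φ', hφ, rfl⟩))

/-- The class of a polyvector field as a linear map. -/
noncomputable def DR.clsHom (k : Type u) [Field k] (M j N : ℕ) (ε : Fin N → ℕ) :
    PolyField k M N ε j →ₗ[k] DR k :=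
  (drRel k).mkQ ∘ₗ drIncl k M j N ε

theorem DR.clsHom_apply {j : ℕ} (φ : PolyField k M N ε j) :
    DR.clsHom k M j N ε φ = DR.cls φ := rfl

/-- The classes of the elementary polyvector fields at the stage `M = N = ε_l = m`. -/
noncomputable def DR.elementarySpan (k : Type u) [Field k] (m : ℕ) : Submodule k (DR k) :=
  Submodule.span k {x | ∃ (j : ℕ) (e : Fin j → Coord m m) (v : Push k (Fin (m + 1)) (Fin m))
    (hv : v ∈ Submodule.torsionBySet (MvPolynomial (Coord m m) k) (Push k (Fin (m + 1)) (Fin m))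
      (lowIdeal k m (fun _ : Fin m => m) : Set (MvPolynomial (Coord m m) k))),
    x = DR.cls (elementary e v hv)}

theorem DR.cls_elementary_mem {m j : ℕ} (hM : M ≤ m) (e : Fin j → Coord M m)
    {v : Push k (Fin (M + 1)) (Fin m)}
    (hv : v ∈ Submodule.torsionBySet (MvPolynomial (Coord M m) k) (Push k (Fin (M + 1)) (Fin m))
      (lowIdeal k M (fun _ : Fin m => m) : Set (MvPolynomial (Coord M m) k))) :
    DR.cls (elementary e v hv) ∈ DR.elementarySpan k m := by
  induction hd : m - M generalizing M j with
  | zero =>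
    obtain rfl : M = m := by omega
    exact Submodule.subset_span ⟨j, e, v, hv, rfl⟩
  | succ d ih =>
    rw [DR.cls_eq_of_isPullback (isPullback_elementary e hv)]
    exact ih (by omega) _ _ (by omega)

/-- Once `N` and all `ε_l` are raised to `m`, the values are `lowIdeal`-torsion, so the field is a
sum of elementary ones, whose pull-backs to `M = m` are explicit. Having this for all large `m`
allows sums to be treated at a common stage. -/
theorem DR.exists_mem_elementarySpan [CharZero k] (x : DR k) :
    ∃ m₀, ∀ m, m₀ ≤ m → x ∈ DR.elementarySpan k m := by
  classical
  obtain ⟨x, rfl⟩ := Submodule.mkQ_surjective _ x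
  induction x using DirectSum.induction_on with
  | zero => exact ⟨0, fun m _ => by rw [map_zero]; exact Submodule.zero_mem _⟩
  | add x y hx hy =>
    obtain ⟨a, ha⟩ := hx
    obtain ⟨b, hb⟩ := hy
    refine ⟨max a b, fun m hm => ?_⟩
    rw [map_add]
    exact Submodule.add_mem _ (ha m ((le_max_left _ _).trans hm))
      (hb m ((le_max_right _ _).trans hm))
  | of s φ =>
    obtain ⟨M, j, N, ε⟩ := s
    change PolyField k M N ε j at φ
    -- A crude bound that dominates `M`, `N` and every `1 + ε_l`, and makes `m` nonzero.
    refine ⟨M + N + (1 + ∑ n, ε n), fun m hm => ?_⟩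
    have hN : N ≤ m := by omega
    have hε (n : Fin N) : 1 + ε n ≤ m := by
      have := Finset.single_le_sum (f := ε) (fun _ _ => Nat.zero_le _) (Finset.mem_univ n)
      omega
    have hφ : DR.cls φ ∈ DR.elementarySpan k m := by
      rw [DR.cls_eq_of_isPushforward (PolyField.isPushforward_pushforward hN
        (ε' := fun _ => m) (fun n => (Nat.le_add_left _ 1).trans (hε n)) φ)]
      rw [PolyField.eq_sum_elementary (φ.pushforward hN _) fun e =>
        map_castLE_mem_torsion_lowIdeal hN (by omega) hε (Subtype.property _)]
      rw [← DR.clsHom_apply, map_smul, map_sum]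
      exact Submodule.smul_mem _ _ (Submodule.sum_mem _ fun e _ =>
        DR.cls_elementary_mem (by omega) e _)
    convert hφ using 1
    rfl

end Transition

/-! ### The map at one stage and its compatibilities -/

section StageMap

open MvPolynomial

variable {k : Type u} [Field k]

theorem neg_one_pow_sub_mul {j i : ℕ} (h : i ≤ j) :
    (-1 : ℤ) ^ (j - i) = (-1) ^ j * (-1) ^ i := by
  obtain ⟨d, rfl⟩ := Nat.exists_eq_add_of_le h
  rw [Nat.add_sub_cancel_left, pow_add, mul_right_comm, ← mul_pow]
  simp

/-- Used to compare a sum over `(j + 1)`-tuples with a marked position to `j + 1` copies of a sum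
over `j`-tuples. -/
theorem sum_ite_eq_insertNth {C A : Type*} [Fintype C] [DecidableEq C] [AddCommMonoid A] {j : ℕ}
    (i : Fin (j + 1)) (c : C) (f : (Fin (j + 1) → C) → A) :
    (∑ e : Fin (j + 1) → C, if e i = c then f e else 0) =
      ∑ e : Fin j → C, f (i.insertNth (α := fun _ => C) c e) := by
  rw [← (Fin.insertNthEquiv (fun _ => C) i).sum_comp, Fintype.sum_prod_type, Finset.sum_comm]
  refine Finset.sum_congr rfl fun e _ => ?_
  simp only [Fin.insertNthEquiv_apply, Fin.insertNth_apply_same, Finset.sum_ite_eq',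
    Finset.mem_univ, if_true]
  rfl

theorem comp_insertNth {C A : Type*} {j : ℕ} (f : C → A) (i : Fin (j + 1)) (c : C) (e : Fin j → C) :
    (fun r => f (i.insertNth (α := fun _ => C) c e r)) =
      i.insertNth (α := fun _ => A) (f c) fun r => f (e r) := by
  funext r
  refine Fin.succAboveCases i ?_ (fun r => ?_) r <;> simp

theorem AlternatingMap.map_insertNth_eq_map_snoc {R A B : Type*} [CommRing R] [AddCommGroup A]
    [Module R A] [AddCommGroup B] [Module R B] {j : ℕ} (φ : A [⋀^Fin (j + 1)]→ₗ[R] B)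
    (i : Fin (j + 1)) (a : A) (η : Fin j → A) :
    φ (i.insertNth (α := fun _ => A) a η) =
      (-1 : ℤ) ^ (j - (i : ℕ)) • φ (Fin.snoc (α := fun _ => A) η a) := by
  rw [← Fin.insertNth_last', φ.map_insertNth, φ.map_insertNth, Fin.val_last, smul_smul,
    neg_one_pow_sub_mul (Nat.le_of_lt_succ i.isLt), mul_right_comm, ← mul_pow]
  simp

theorem Vac.wedge_insertNth_eq {j : ℕ} (i : Fin (j + 1)) (c : ℤ) (e : Fin j → ℤ) (w : Vac k) :
    Vac.wedge k (i.insertNth (α := fun _ => ℤ) c e) w =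
      (-1 : ℤ) ^ (j - (i : ℕ)) • Vac.fermionV k c (Vac.wedge k e w) := by
  rw [← Vac.wedge_snoc, ← Fin.insertNth_last', Vac.wedge_insertNth, Vac.wedge_insertNth,
    Fin.val_last, smul_smul, neg_one_pow_sub_mul (Nat.le_of_lt_succ i.isLt), mul_right_comm,
    ← mul_pow]
  simp

theorem Vac.wedge_comp_perm {j : ℕ} (e : Fin j → ℤ) (σ : Equiv.Perm (Fin j)) (w : Vac k) :
    Vac.wedge k (e ∘ σ) w = (Equiv.Perm.sign σ : ℤ) • Vac.wedge k e w := by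
  have := (wedgeAlt k j).map_perm (fun i => HahnSeries.single (e i) 1) σ
  rw [Function.comp_def] at this
  rw [Vac.wedge, Vac.wedge]
  simp only [Function.comp_apply, this]
  rcases Int.units_eq_one_or (Equiv.Perm.sign σ) with h | h
  · simp [h]
  · simp [h, VacuumModule.mulRight_neg]

variable (k) in
/-- The term of `DR.stageMap` attached to a tuple of coordinates. -/
noncomputable def DR.stageTerm (M j N : ℕ) (ε : Fin N → ℕ) (e : Fin j → Coord M N) :
    PolyField k M N ε j →ₗ[k] Vac k :=
  Vac.wedge k (fun r => (e r).exponent) ∘ₗ Vac.fill k (M + 1) ∘ₗ Push.toVac k M N ∘ₗ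
    { toFun := fun φ => (φ fun r => coordForm k ε (e r) : Push k (Fin (M + 1)) (Fin N))
      map_add' := fun _ _ => rfl
      map_smul' := fun _ _ => rfl }

theorem DR.stageTerm_apply {M j N : ℕ} {ε : Fin N → ℕ} (e : Fin j → Coord M N)
    (φ : PolyField k M N ε j) :
    DR.stageTerm k M j N ε e φ = Vac.wedge k (fun r => (e r).exponent) (Vac.fill k (M + 1)
      (Push.toVac k M N (φ fun r => coordForm k ε (e r) : Push k (Fin (M + 1)) (Fin N)))) := rfl

variable (k) in
/-- The map from polyvector fields to the vacuum module. -/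
noncomputable def DR.stageMap (M j N : ℕ) (ε : Fin N → ℕ) : PolyField k M N ε j →ₗ[k] Vac k :=
  (j.factorial : k)⁻¹ • ∑ e, DR.stageTerm k M j N ε e

theorem DR.stageMap_apply {M j N : ℕ} {ε : Fin N → ℕ} (φ : PolyField k M N ε j) :
    DR.stageMap k M j N ε φ = (j.factorial : k)⁻¹ • ∑ e, DR.stageTerm k M j N ε e φ := by
  rw [DR.stageMap, LinearMap.smul_apply, LinearMap.sum_apply]

theorem inv_factorial_succ_smul [CharZero k] {A : Type*} [AddCommGroup A] [Module k A] (j : ℕ)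
    (a : A) : ((j + 1).factorial : k)⁻¹ • (j + 1) • a = (j.factorial : k)⁻¹ • a := by
  rw [← Nat.cast_smul_eq_nsmul k, smul_smul, Nat.factorial_succ, Nat.cast_mul, mul_inv,
    mul_right_comm, inv_mul_cancel₀ (Nat.cast_ne_zero.2 j.succ_ne_zero), one_mul]

variable {M j N : ℕ} {ε : Fin N → ℕ}

theorem DR.stageMap_X_smul (c : Coord M N) (φ : PolyField k M N ε j) :
    DR.stageMap k M j N ε ((X c : MvPolynomial (Coord M N) k) • φ) =
      Vac.bosonL k (-c.exponent - 1) (DR.stageMap k M j N ε φ) := by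
  rw [DR.stageMap_apply, DR.stageMap_apply, map_smul, map_sum]
  congr 1
  refine Finset.sum_congr rfl fun e _ => ?_
  rw [DR.stageTerm_apply, DR.stageTerm_apply, Vac.bosonL_wedge, Vac.bosonL_fill,
    ← Push.toVac_X_smul]
  rfl

theorem DR.stageMap_of_isDerivative {c : Coord M N} {φ φ' : PolyField k M N ε j}
    (h : IsDerivative c φ φ') :
    DR.stageMap k M j N ε φ' = -Vac.bosonV k c.exponent (DR.stageMap k M j N ε φ) := by
  rw [DR.stageMap_apply, DR.stageMap_apply, map_smul, map_sum, ← smul_neg, ← Finset.sum_neg_distrib]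
  congr 1
  refine Finset.sum_congr rfl fun e _ => ?_
  rw [DR.stageTerm_apply, DR.stageTerm_apply, Vac.bosonV_wedge, Vac.bosonV_fill, h e,
    Push.toVac_mulRight_d, map_neg, map_neg]

/-- By `Vac.fermionL_wedge` the operator removes an index `c` from some position `i` with sign
`(-1)^{j-i}`. The same sign moves `da_c` to the last argument of `φ`, so all `j + 1` positions
contribute equally, which turns `1/(j+1)!` into `1/j!`. -/
theorem DR.stageMap_of_isContraction [CharZero k] {c : Coord M N} {φ : PolyField k M N ε (j + 1)}
    {φ' : PolyField k M N ε j} (h : IsContraction c φ φ') :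
    DR.stageMap k M j N ε φ' =
      Vac.fermionL k (-c.exponent - 1) (DR.stageMap k M (j + 1) N ε φ) := by
  classical
  rw [DR.stageMap_apply, DR.stageMap_apply, map_smul, map_sum, ← inv_factorial_succ_smul]
  congr 1
  have h1 (e : Fin (j + 1) → Coord M N) :
      Vac.fermionL k (-c.exponent - 1) (DR.stageTerm k M (j + 1) N ε e φ) =
        ∑ i : Fin (j + 1), if e i = c then (-1 : ℤ) ^ (j - (i : ℕ)) •
          Vac.wedge k (fun r => (e (i.succAbove r)).exponent) (Vac.fill k (M + 1)
            (Push.toVac k M N (φ fun r => coordForm k ε (e r) :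
              Push k (Fin (M + 1)) (Fin N)))) else 0 := by
    rw [DR.stageTerm_apply, Vac.fermionL_wedge _ _
      (Vac.fermionL_fill (Push.isFermionVac_toVac _) _ _ c.exponent_le)]
    simp only [Coord.exponent_injective.eq_iff]
  simp only [h1]
  rw [Finset.sum_comm]
  simp only [sum_ite_eq_insertNth]
  refine Eq.trans (b := ∑ _i : Fin (j + 1), ∑ e, DR.stageTerm k M j N ε e φ')
    (by rw [Finset.sum_const, Finset.card_univ, Fintype.card_fin])
    (Finset.sum_congr rfl fun i _ => Finset.sum_congr rfl fun e _ => ?_)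
  rw [comp_insertNth, AlternatingMap.map_insertNth_eq_map_snoc, ← h, DR.stageTerm_apply]
  simp only [Fin.insertNth_apply_succAbove]
  rcases neg_one_pow_eq_or ℤ (j - (i : ℕ)) with h | h <;> simp [h]

/-- Dual to contraction: the sign in `IsWedge` cancels the one that moves `t^c` to the end of the
product. -/
theorem DR.stageMap_of_isWedge [CharZero k] {c : Coord M N} {φ : PolyField k M N ε j}
    {φ' : PolyField k M N ε (j + 1)} (h : IsWedge c φ φ') :
    DR.stageMap k M (j + 1) N ε φ' =
      Vac.fermionV k c.exponent (DR.stageMap k M j N ε φ) := by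
  classical
  rw [DR.stageMap_apply, DR.stageMap_apply, map_smul, map_sum,
    ← inv_factorial_succ_smul (k := k) j (∑ e, _)]
  congr 1
  have h1 (e : Fin (j + 1) → Coord M N) : DR.stageTerm k M (j + 1) N ε e φ' =
      ∑ i : Fin (j + 1), if e i = c then (-1 : ℤ) ^ (j - (i : ℕ)) •
        Vac.wedge k (fun r => (e r).exponent) (Vac.fill k (M + 1)
          (Push.toVac k M N (φ fun r => coordForm k ε (e (i.succAbove r)) :
            Push k (Fin (M + 1)) (Fin N)))) else 0 := by
    rw [DR.stageTerm_apply, h e, Submodule.coe_sum, map_sum, map_sum, map_sum]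
    refine Finset.sum_congr rfl fun i _ => ?_
    by_cases hi : e i = c
    · rw [if_pos hi, if_pos hi]
      rcases neg_one_pow_eq_or ℤ (j - (i : ℕ)) with h | h <;> simp [h]
    · rw [if_neg hi, if_neg hi]
      simp
  simp only [h1]
  rw [Finset.sum_comm]
  simp only [sum_ite_eq_insertNth]
  refine Eq.trans (b := ∑ _i : Fin (j + 1), ∑ e,
      Vac.fermionV k c.exponent (DR.stageTerm k M j N ε e φ))
    (Finset.sum_congr rfl fun i _ => Finset.sum_congr rfl fun e _ => ?_)
    (by rw [Finset.sum_const, Finset.card_univ, Fintype.card_fin])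
  rw [comp_insertNth, Vac.wedge_insertNth_eq, smul_smul, ← mul_pow, DR.stageTerm_apply]
  simp only [Fin.insertNth_apply_succAbove]
  simp

theorem kaehlerMap_nilRestrict_coordForm {N' : ℕ} {ε' : Fin N' → ℕ} (hN : N ≤ N')
    (h : ∀ n, ε n ≤ ε' (Fin.castLE hN n)) (c : Coord M N) :
    kaehlerMap (nilRestrict M ε ε' hN h) (coordForm k ε' (Sum.map id (Fin.castLE hN) c)) =
      coordForm k ε c := by
  rw [coordForm, kaehlerMap_D, nilRestrict_mk]
  rcases c with c | c
  · rw [Sum.map_inl, polyRestrict_X_inl, coordForm, id]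
  · rw [Sum.map_inr, polyRestrict_X_inr, dif_pos (show (Fin.castLE hN c : ℕ) < N from c.isLt),
      coordForm]
    rfl

theorem kaehlerMap_nilRestrict_coordForm_eq_zero {N' : ℕ} {ε' : Fin N' → ℕ} (hN : N ≤ N')
    (h : ∀ n, ε n ≤ ε' (Fin.castLE hN n)) {c : Coord M N'}
    (hc : c ∉ Set.range (Sum.map id (Fin.castLE hN) : Coord M N → Coord M N')) :
    kaehlerMap (nilRestrict (k := k) M ε ε' hN h) (coordForm k ε' c) = 0 := by
  rw [coordForm, kaehlerMap_D, nilRestrict_mk]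
  rcases c with c | c
  · exact (hc ⟨Sum.inl c, rfl⟩).elim
  · rw [polyRestrict_X_inr, dif_neg, map_zero, map_zero]
    exact fun hn => hc ⟨Sum.inr ⟨c, hn⟩, rfl⟩

/-- A tuple with some `a_l`, `l < -N`, contributes zero because `da_l` restricts to zero; the other
terms agree one by one. -/
theorem DR.stageMap_of_isPushforward {N' : ℕ} {ε' : Fin N' → ℕ} {hN : N ≤ N'}
    {h : ∀ n, ε n ≤ ε' (Fin.castLE hN n)} {φ : PolyField k M N ε j} {φ' : PolyField k M N' ε' j}
    (hφ : IsPushforward hN h φ φ') :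
    DR.stageMap k M j N ε φ = DR.stageMap k M j N' ε' φ' := by
  rw [DR.stageMap_apply, DR.stageMap_apply]
  congr 1
  have hinj : Function.Injective (Sum.map id (Fin.castLE hN) : Coord M N → Coord M N') :=
    Function.Injective.sumMap Function.injective_id (Fin.castLE_injective hN)
  refine Fintype.sum_of_injective (fun e r => Sum.map id (Fin.castLE hN) (e r))
    (fun e e' h => _root_.funext fun r => hinj (congrFun h r)) _ _ (fun e he => ?_) fun e => ?_
  · obtain ⟨r, hr⟩ : ∃ r, e r ∉ Set.range (Sum.map id (Fin.castLE hN) : Coord M N → Coord M N') := by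
      by_contra! hr
      choose f hf using hr
      exact he ⟨f, _root_.funext hf⟩
    rw [DR.stageTerm_apply, hφ, φ.map_coord_zero r
      (kaehlerMap_nilRestrict_coordForm_eq_zero hN h hr), Submodule.coe_zero]
    simp only [map_zero]
  · rw [DR.stageTerm_apply, DR.stageTerm_apply, hφ, Push.toVac_map _ _ (fun _ => rfl) fun _ => rfl]
    simp only [kaehlerMap_nilRestrict_coordForm]
    congr 2
    funext r
    rcases e r with c | c <;> rfl

theorem Coord.eq_castSucc_of_ne_last {c : Coord (M + 1) N} (hc : c ≠ Sum.inl (Fin.last (M + 1))) :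
    ∃ c', c = Coord.castSucc (M := M) c' := by
  rcases c with c | c
  · exact ⟨Sum.inl (c.castPred fun h => hc (congrArg _ h)), rfl⟩
  · exact ⟨Sum.inr c, rfl⟩

theorem DR.stageTerm_eq_zero_of_not_injective {e : Fin j → Coord M N} (he : ¬Function.Injective e)
    (φ : PolyField k M N ε j) : DR.stageTerm k M j N ε e φ = 0 := by
  rw [DR.stageTerm_apply, Vac.wedge_of_not_injective]
  exact fun h => he (Function.Injective.of_comp (f := Coord.exponent) h)

/-- The values of `φ` and the product of the `t^{e_i}` both alternate, so the signs cancel and the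
term does not depend on the position of `c`. -/
theorem DR.stageTerm_insertNth (i : Fin (j + 1)) (c : Coord M N) (e : Fin j → Coord M N)
    (φ : PolyField k M N ε (j + 1)) :
    DR.stageTerm k M (j + 1) N ε (i.insertNth (α := fun _ => Coord M N) c e) φ =
      DR.stageTerm k M (j + 1) N ε (Fin.cons (α := fun _ => Coord M N) c e) φ := by
  rw [DR.stageTerm_apply, DR.stageTerm_apply, ← Fin.insertNth_zero']
  simp only [comp_insertNth, Vac.wedge_insertNth_eq, AlternatingMap.map_insertNth_eq_map_snoc]
  have h (n : ℕ) (w : Push k (Fin (M + 1)) (Fin N)) : (-1 : ℤ) ^ n • Vac.fermionV k c.exponent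
      (Vac.wedge k (fun r => (e r).exponent) (Vac.fill k (M + 1) (Push.toVac k M N
        ((-1 : ℤ) ^ n • w)))) = Vac.fermionV k c.exponent
      (Vac.wedge k (fun r => (e r).exponent) (Vac.fill k (M + 1) (Push.toVac k M N w))) := by
    rcases neg_one_pow_eq_or ℤ n with h | h <;> simp [h]
  exact (h _ _).trans (h _ _).symm

/-- Only injective tuples that contain `a_{M+1}` contribute: repetition kills the product, and
absence of `a_{M+1}` kills the value of `φ'`. Once `a_{M+1}` is moved to the front, `t^{M+1}`
cancels the extra factor of `Vac.fill`. -/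
theorem DR.stageMap_of_isPullback [CharZero k] {φ : PolyField k M N ε j}
    {φ' : PolyField k (M + 1) N ε (j + 1)} (hφ : IsPullback φ φ') :
    DR.stageMap k M j N ε φ = DR.stageMap k (M + 1) (j + 1) N ε φ' := by
  classical
  rw [DR.stageMap_apply, DR.stageMap_apply, ← inv_factorial_succ_smul]
  congr 1
  -- An injective tuple has `a_{M+1}` in at most one position, so the right side counts a surviving
  -- term exactly once.
  have h1 (e : Fin (j + 1) → Coord (M + 1) N) : DR.stageTerm k (M + 1) (j + 1) N ε e φ' =
      ∑ i, if e i = Sum.inl (Fin.last (M + 1)) then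
        DR.stageTerm k (M + 1) (j + 1) N ε e φ' else 0 := by
    by_cases he : Function.Injective e
    · by_cases hi : ∃ i, e i = Sum.inl (Fin.last (M + 1))
      · obtain ⟨i, hi⟩ := hi
        rw [Finset.sum_eq_single i, if_pos hi]
        · exact fun i' _ hi' => if_neg fun h => hi' (he (h.trans hi.symm))
        · exact fun h => (h (Finset.mem_univ i)).elim
      · push Not at hi
        rw [Finset.sum_eq_zero fun i _ => if_neg (hi i)]
        choose e' he' using fun i => Coord.eq_castSucc_of_ne_last (hi i)
        obtain rfl : e = fun i => (e' i).castSucc := _root_.funext he'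
        have := hφ.2 fun r => coordForm k ε (e' r)
        simp only [kaehlerMap_nilPull_coordForm] at this
        rw [DR.stageTerm_apply, this, Submodule.coe_zero]
        simp only [map_zero]
    · simp [DR.stageTerm_eq_zero_of_not_injective he]
  rw [Finset.sum_congr rfl fun e _ => h1 e, Finset.sum_comm]
  simp only [sum_ite_eq_insertNth, DR.stageTerm_insertNth]
  rw [Finset.sum_const, Finset.card_univ, Fintype.card_fin]
  congr 1
  refine Fintype.sum_of_injective (fun (e : Fin j → Coord M N) r => (e r).castSucc)
    (fun e e' h => _root_.funext fun r => Coord.castSucc_injective (congrFun h r)) _ _ (fun e he => ?_)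
    fun e => ?_
  · refine DR.stageTerm_eq_zero_of_not_injective (fun hinj => he ?_) _
    have (r : Fin j) : e r ≠ Sum.inl (Fin.last (M + 1)) := fun h =>
      Fin.succ_ne_zero r (hinj (by rw [Fin.cons_succ, Fin.cons_zero, h]))
    choose e' he' using fun r => Coord.eq_castSucc_of_ne_last (this r)
    exact ⟨e', (_root_.funext he').symm⟩
  · rw [DR.stageTerm_apply, DR.stageTerm_apply]
    have h2 : (fun r => coordForm k ε (Fin.cons (α := fun _ => Coord (M + 1) N)
        (Sum.inl (Fin.last (M + 1))) (fun r => (e r).castSucc) r)) =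
        Fin.cons (α := fun _ => Ω[NilRing k (M + 1) N ε⁄k])
          (coordForm k ε (Sum.inl (Fin.last (M + 1))))
          fun r => kaehlerMap (nilPull M N ε) (coordForm k ε (e r)) := by
      funext r
      refine Fin.cases rfl (fun r => ?_) r
      simp only [Fin.cons_succ, kaehlerMap_nilPull_coordForm]
    rw [h2, hφ.1, Push.toVac_map _ _ (fun _ => rfl) fun _ => rfl, Vac.wedge_succ, Fin.cons_zero]
    have h3 : Coord.exponent (Sum.inl (Fin.last (M + 1)) : Coord (M + 1) N) = ((M + 1 : ℕ) : ℤ) :=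
      rfl
    rw [h3, Vac.fermionV_fill_succ (Push.isFermionVac_toVac _)]
    congr 2
    funext r
    exact (Coord.exponent_castSucc _).symm

/-- The `j!` permutations give equal contributions: the sign from the minor cancels that of the
reordered product. -/
theorem DR.stageMap_elementary [CharZero k] (e : Fin j → Coord M N)
    {v : Push k (Fin (M + 1)) (Fin N)}
    (hv : v ∈ Submodule.torsionBySet (MvPolynomial (Coord M N) k) (Push k (Fin (M + 1)) (Fin N))
      (lowIdeal k M ε : Set (MvPolynomial (Coord M N) k))) :
    DR.stageMap k M j N ε (elementary e v hv) =
      Vac.wedge k (fun r => (e r).exponent) (Vac.fill k (M + 1) (Push.toVac k M N v)) := by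
  classical
  have hj : (j.factorial : k) ≠ 0 := Nat.cast_ne_zero.2 j.factorial_ne_zero
  rw [DR.stageMap_apply, inv_smul_eq_iff₀ hj]
  simp only [DR.stageTerm_apply, elementary_coordForm, map_sum]
  rw [Finset.sum_comm]
  have h (σ : Equiv.Perm (Fin j)) (e' : Fin j → Coord M N) : e = e' ∘ σ ↔ e ∘ σ.symm = e' := by
    constructor
    · rintro rfl
      funext r
      simp
    · rintro rfl
      funext r
      simp
  have h' (σ : Equiv.Perm (Fin j)) : (∑ e' : Fin j → Coord M N,
      Vac.wedge k (fun r => (e' r).exponent) (Vac.fill k (M + 1) (Push.toVac k M N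
        (if e = e' ∘ σ then (Equiv.Perm.sign σ : ℤ) • v else 0)))) =
      Vac.wedge k (fun r => (e r).exponent) (Vac.fill k (M + 1) (Push.toVac k M N v)) := by
    rw [Finset.sum_eq_single (e ∘ σ.symm)]
    · rw [if_pos ((h _ _).2 rfl)]
      have := Vac.wedge_comp_perm (k := k) (fun r => (e r).exponent) σ.symm
      rw [Function.comp_def] at this
      simp only [Function.comp_apply, this, Equiv.Perm.sign_symm]
      rcases Int.units_eq_one_or (Equiv.Perm.sign σ) with h | h <;> simp [h]
    · intro e' _ he'
      rw [if_neg fun H => he' ((h _ _).1 H).symm]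
      simp only [map_zero]
    · exact fun h => (h (Finset.mem_univ _)).elim
  simp only [h', Finset.sum_const, Finset.card_univ, Fintype.card_perm, Fintype.card_fin]
  rw [← Nat.cast_smul_eq_nsmul k]

end StageMap

/-! ### The map from the de Rham complex to `Vac`; proof of (b) -/

section ToVac

open MvPolynomial

variable {k : Type u} [Field k]

open Classical in
/-- The map from the sum of all terms to the vacuum module. -/
noncomputable def DR.sumToVac (k : Type u) [Field k] : (⨁ x : Stage, DRTerm k x) →ₗ[k] Vac k :=
  DirectSum.toModule k Stage (Vac k) fun x => DR.stageMap k x.M x.j x.N x.ε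

theorem DR.sumToVac_drIncl {M j N : ℕ} {ε : Fin N → ℕ} (φ : PolyField k M N ε j) :
    DR.sumToVac k (drIncl k M j N ε φ) = DR.stageMap k M j N ε φ := by
  classical
  exact DirectSum.toModule_lof k (M := DRTerm k)
    (φ := fun x => DR.stageMap k x.M x.j x.N x.ε) (⟨M, j, N, ε⟩ : Stage) φ

variable (k) in
/-- The map from the de Rham complex to the vacuum module. -/
noncomputable def DR.toVac [CharZero k] : DR k →ₗ[k] Vac k :=
  (drRel k).liftQ (DR.sumToVac k) <| by
    refine Submodule.span_le.2 ?_
    rintro _ (⟨M, j, N, N', ε, ε', hN, h, φ, φ', hφ, rfl⟩ | ⟨M, j, N, ε, φ, φ', hφ, rfl⟩)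
    · rw [SetLike.mem_coe, LinearMap.mem_ker, map_sub, DR.sumToVac_drIncl, DR.sumToVac_drIncl,
        DR.stageMap_of_isPushforward hφ, sub_self]
    · rw [SetLike.mem_coe, LinearMap.mem_ker, map_sub, DR.sumToVac_drIncl, DR.sumToVac_drIncl,
        DR.stageMap_of_isPullback hφ, sub_self]

theorem DR.toVac_cls [CharZero k] {M j N : ℕ} {ε : Fin N → ℕ} (φ : PolyField k M N ε j) :
    DR.toVac k (DR.cls φ) = DR.stageMap k M j N ε φ :=
  DR.sumToVac_drIncl φ

variable {M N : ℕ} {ε : Fin N → ℕ}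

theorem DR.stageMap_zero_apply (φ : PolyField k M N ε 0) :
    DR.stageMap k M 0 N ε φ = Vac.fill k (M + 1) (Push.toVac k M N
      (φ ![] : Push k (Fin (M + 1)) (Fin N))) := by
  rw [DR.stageMap_apply, Fintype.sum_unique, DR.stageTerm_apply, Vac.wedge_zero]
  simp only [Nat.factorial_zero, Nat.cast_one, inv_one, one_smul]
  congr! 4

theorem DR.fermionL_stageMap_zero (c : Coord M N) (φ : PolyField k M N ε 0) :
    Vac.fermionL k (-c.exponent - 1) (DR.stageMap k M 0 N ε φ) = 0 := by
  rw [DR.stageMap_zero_apply, Vac.fermionL_fill (Push.isFermionVac_toVac _) _ _ c.exponent_le]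

theorem PolyField.eq_zero_of_contract {j : ℕ} {φ : PolyField k M N ε (j + 1)}
    (h : ∀ c, φ.contract c = 0) : φ = 0 := by
  refine PolyField.ext fun e => ?_
  have h1 := PolyField.isContraction_contract (e (Fin.last j)) φ
    fun r => coordForm k ε (e r.castSucc)
  rw [h, AlternatingMap.zero_apply] at h1
  rw [AlternatingMap.zero_apply, h1]
  congr 1
  exact (Fin.snoc_init_self fun r => coordForm k ε (e r)).symm

/-- Contraction with each `da_c` lowers the degrees by one and kills the term of degree zero, so by
induction all contractions of the other terms vanish, and with them those terms. This separates the
degrees without a grading on `Vac`. In degree zero, `Vac.fill` and `Push.toVac` are injective on the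
vectors in question. -/
theorem DR.eq_zero_of_sum_stageMap_eq_zero [CharZero k] (J : ℕ) (φ : ∀ j, PolyField k M N ε j)
    (h : ∑ j ∈ Finset.range J, DR.stageMap k M j N ε (φ j) = 0) (j : ℕ) (hj : j < J) : φ j = 0 := by
  induction J generalizing φ j with
  | zero => omega
  | succ J ih =>
    rw [Finset.sum_range_succ'] at h
    have hpos (j : ℕ) (hj : j < J) : φ (j + 1) = 0 := by
      refine PolyField.eq_zero_of_contract fun c => ih (fun j => (φ (j + 1)).contract c) ?_ j hj
      have := congrArg (Vac.fermionL k (-c.exponent - 1)) h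
      rw [map_add, map_sum, DR.fermionL_stageMap_zero, add_zero, map_zero] at this
      rw [← this]
      exact Finset.sum_congr rfl fun j _ =>
        DR.stageMap_of_isContraction (PolyField.isContraction_contract c _)
    rcases j with _ | j
    · rw [Finset.sum_eq_zero fun j hj => by rw [hpos j (Finset.mem_range.1 hj), map_zero],
        zero_add, DR.stageMap_zero_apply] at h
      have h0 := Vac.eq_zero_of_fill_eq_zero (Push.isFermionVac_toVac _) h
      rw [← map_zero (Push.toVac k M N)] at h0
      refine AlternatingMap.ext fun η => Subtype.ext ?_
      rw [Subsingleton.elim η ![], Push.toVac_injective h0]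
      rfl
    · exact hpos j (by omega)

/-- Allowing every larger bound `J'` makes expressions with different numbers of degrees addable. -/
theorem DR.exists_eq_sum_of_mem_elementarySpan {m : ℕ} {x : DR k}
    (hx : x ∈ DR.elementarySpan k m) :
    ∃ (φ : ∀ j, PolyField k m m (fun _ => m) j) (J : ℕ), ∀ J', J ≤ J' →
      x = ∑ j ∈ Finset.range J', DR.cls (φ j) := by
  induction hx using Submodule.span_induction with
  | mem x hx =>
    obtain ⟨j, e, v, hv, rfl⟩ := hx
    refine ⟨Function.update 0 j (elementary e v hv), j + 1, fun J' hJ' => ?_⟩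
    rw [Finset.sum_eq_single j]
    · rw [Function.update_self]
    · intro i _ hi
      rw [Function.update_of_ne hi, ← DR.clsHom_apply]
      exact map_zero _
    · intro h
      exact (h (Finset.mem_range.2 hJ')).elim
  | zero => exact ⟨0, 0, fun J' _ => (Finset.sum_eq_zero fun i _ => map_zero (DR.clsHom k _ _ _ _)).symm⟩
  | add x y _ _ hx hy =>
    obtain ⟨φ, J, hφ⟩ := hx
    obtain ⟨ψ, L, hψ⟩ := hy
    refine ⟨φ + ψ, max J L, fun J' hJ' => ?_⟩
    rw [hφ J' ((le_max_left _ _).trans hJ'), hψ J' ((le_max_right _ _).trans hJ'),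
      ← Finset.sum_add_distrib]
    exact Finset.sum_congr rfl fun i _ => (map_add (DR.clsHom k _ _ _ _) _ _).symm
  | smul a x _ hx =>
    obtain ⟨φ, J, hφ⟩ := hx
    refine ⟨a • φ, J, fun J' hJ' => ?_⟩
    rw [hφ J' hJ', Finset.smul_sum]
    exact Finset.sum_congr rfl fun i _ => (map_smul (DR.clsHom k _ _ _ _) _ _).symm

theorem DR.toVac_injective [CharZero k] : Function.Injective (DR.toVac k) := by
  refine (injective_iff_map_eq_zero _).2 fun x hx => ?_
  obtain ⟨m, hm⟩ := DR.exists_mem_elementarySpan x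
  obtain ⟨φ, J, hφ⟩ := DR.exists_eq_sum_of_mem_elementarySpan (hm m le_rfl)
  have h := hφ J le_rfl
  rw [h, map_sum] at hx
  simp only [DR.toVac_cls] at hx
  rw [h]
  refine Finset.sum_eq_zero fun j hj => ?_
  rw [DR.eq_zero_of_sum_stageMap_eq_zero J φ hx j (Finset.mem_range.1 hj)]
  exact map_zero (DR.clsHom k _ _ _ _)

theorem DR.toVac_elementary [CharZero k] {j : ℕ} (e : Fin j → Coord M N) {v : Push k (Fin (M + 1)) (Fin N)}
    (hv : v ∈ Submodule.torsionBySet (MvPolynomial (Coord M N) k) (Push k (Fin (M + 1)) (Fin N))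
      (lowIdeal k M ε : Set (MvPolynomial (Coord M N) k))) :
    DR.toVac k (DR.cls (elementary e v hv)) =
      Vac.wedge k (fun r => (e r).exponent) (Vac.fill k (M + 1) (Push.toVac k M N v)) := by
  rw [DR.toVac_cls, DR.stageMap_elementary]

/-- At the stage whose only coordinate is `a_0`, the field `gen ⊗ ∂_{a_0}` works: the factor
`t^{-1}dt` of `Vac.fill` is cancelled by `t^0`. -/
theorem DR.vac_mem_range [CharZero k] : Vac.vac k ∈ LinearMap.range (DR.toVac k) := by
  refine ⟨DR.cls (elementary (M := 0) (N := 0) (ε := Fin.elim0)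
    (fun _ : Fin 1 => Sum.inl 0) (Push.gen k _ _)
    (mem_torsion_lowIdeal_iff.2 fun n => n.elim0)), ?_⟩
  rw [DR.toVac_elementary, Push.toVac_gen, Vac.wedge_succ, Vac.wedge_zero]
  have := Vac.fermionV_fill_succ (Push.isFermionVac_toVac (Push.gen k (Fin (0 + 1)) (Fin 0))) 0
  rw [Push.toVac_gen] at this
  exact this

/-- Commuting a power of a coordinate past a derivation costs at most one power, so differentiation
requires raising `ε` by one. -/
theorem Push.pow_smul_mulRight_d {τ ν : Type*} (i j : τ ⊕ ν) {p : ℕ} {v : Push k τ ν}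
    (h : (X i : MvPolynomial (τ ⊕ ν) k) ^ p • v = 0) :
    (X i : MvPolynomial (τ ⊕ ν) k) ^ (p + 1) • Push.mulRight (Weyl.d j) v = 0 := by
  induction p generalizing v with
  | zero =>
    rw [pow_zero, one_smul] at h
    rw [h, map_zero, smul_zero]
  | succ p ih =>
    have h' : (X i : MvPolynomial (τ ⊕ ν) k) ^ p • Push.mulRight (Weyl.x i) v = 0 := by
      rw [← Push.X_smul, smul_smul, ← pow_succ, h]
    rw [pow_succ, mul_smul, Push.X_smul]
    by_cases hij : i = j
    · subst hij
      rw [Push.mulRight_x_d_self, smul_add, ih h', h, add_zero]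
    · rw [Push.mulRight_x_d_of_ne hij, ih h']

/-- A subspace of the de Rham complex that contains the elementary polyvector fields of all
sufficiently late stages is everything. -/
theorem DR.eq_top_of_elementary [CharZero k] (S : Submodule k (DR k)) (m₀ : ℕ)
    (h : ∀ (m j : ℕ) (e : Fin j → Coord m m) (v : Push k (Fin (m + 1)) (Fin m))
      (hv : v ∈ Submodule.torsionBySet (MvPolynomial (Coord m m) k) (Push k (Fin (m + 1)) (Fin m))
        (lowIdeal k m (fun _ : Fin m => m) : Set (MvPolynomial (Coord m m) k))),
      m₀ ≤ m → DR.cls (elementary e v hv) ∈ S) : S = ⊤ := by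
  refine eq_top_iff.2 fun x _ => ?_
  obtain ⟨m, hm⟩ := DR.exists_mem_elementarySpan x
  refine Submodule.span_le.2 ?_ (hm (max m m₀) (le_max_left _ _))
  rintro _ ⟨j, e, v, hv, rfl⟩
  exact h _ j e v hv (le_max_right _ _)

theorem DR.range_stable [CharZero k] (T : Module.End k (Vac k)) (m₀ : ℕ)
    (h : ∀ (m j : ℕ) (e : Fin j → Coord m m) (v : Push k (Fin (m + 1)) (Fin m))
      (hv : v ∈ Submodule.torsionBySet (MvPolynomial (Coord m m) k) (Push k (Fin (m + 1)) (Fin m))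
        (lowIdeal k m (fun _ : Fin m => m) : Set (MvPolynomial (Coord m m) k))),
      m₀ ≤ m → ∃ y, DR.toVac k y = T (DR.toVac k (DR.cls (elementary e v hv)))) :
    ∀ w ∈ LinearMap.range (DR.toVac k), T w ∈ LinearMap.range (DR.toVac k) := by
  rintro _ ⟨x, rfl⟩
  have htop : (LinearMap.range (DR.toVac k)).comap (T ∘ₗ DR.toVac k) = ⊤ :=
    DR.eq_top_of_elementary _ m₀ h
  exact htop.ge (Submodule.mem_top (x := x))

theorem DR.toVac_surjective [CharZero k] : Function.Surjective (DR.toVac k) := by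
  rw [← LinearMap.range_eq_top]
  refine Vac.eq_top_of_stable _ DR.vac_mem_range (fun n => ?_) (fun n => ?_) (fun n => ?_)
    fun n => ?_
  all_goals
    -- For `m > |n|` both `n` and `-n - 1` are exponents of coordinates at stage `m`; they serve
    -- `tⁿ` and `tⁿ dt` respectively.
    refine DR.range_stable _ (n.natAbs + 1) fun m j e v hv hm => ?_
  · obtain ⟨c, rfl⟩ := Coord.exists_exponent (M := m) (N := m) n (by omega) (by omega)
    -- The derivative is killed only by the powers `m + 1`, so it lives at a larger `ε`; the sign
    -- undoes `∂ ↦ -tⁿ`.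
    refine ⟨-DR.cls (elementary (ε := fun _ => m + 1) e (Push.mulRight (Weyl.d c) v)
      (mem_torsion_lowIdeal_iff.2 fun i =>
        Push.pow_smul_mulRight_d _ _ (mem_torsion_lowIdeal_iff.1 hv i))), ?_⟩
    rw [map_neg, DR.toVac_elementary, DR.toVac_elementary, Push.toVac_mulRight_d,
      Vac.bosonV_wedge, Vac.bosonV_fill, map_neg, map_neg, neg_neg]
  · obtain ⟨c, hc⟩ := Coord.exists_exponent (M := m) (N := m) (-n - 1) (by omega) (by omega)
    obtain rfl : n = -c.exponent - 1 := by omega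
    exact ⟨_, (DR.toVac_cls _).trans ((DR.stageMap_X_smul c _).trans
      (congrArg _ (DR.toVac_cls _).symm))⟩
  · obtain ⟨c, rfl⟩ := Coord.exists_exponent (M := m) (N := m) n (by omega) (by omega)
    refine ⟨DR.cls (elementary (Fin.snoc (α := fun _ => Coord m m) e c) v hv), ?_⟩
    rw [DR.toVac_elementary, DR.toVac_elementary, ← Vac.wedge_snoc]
    congr 2
    exact Fin.comp_snoc Coord.exponent e c
  · obtain ⟨c, hc⟩ := Coord.exists_exponent (M := m) (N := m) (-n - 1) (by omega) (by omega)
    obtain rfl : n = -c.exponent - 1 := by omega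
    rcases j with _ | j
    -- In degree zero there is nothing to contract, and the operator kills the image.
    · exact ⟨0, by rw [DR.toVac_cls, DR.fermionL_stageMap_zero, map_zero]⟩
    · exact ⟨_, (DR.toVac_cls _).trans ((DR.stageMap_of_isContraction
        (PolyField.isContraction_contract c _)).trans (congrArg _ (DR.toVac_cls _).symm))⟩

theorem DR.toVac_bijective [CharZero k] : Function.Bijective (DR.toVac k) :=
  ⟨DR.toVac_injective, DR.toVac_surjective⟩

end ToVac

end ChiralDeRham

theorem proposition5p4p3 (k : Type u) [Field k] [CharZero k] :
    Function.Bijective (ChiralDeRham.vacMap k) ∧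
      ∃ Φ : ChiralDeRham.DR k ≃ₗ[k] ChiralDeRham.Vac k,
        ∀ (M j N : ℕ) (ε : Fin N → ℕ) (c : ChiralDeRham.Coord M N),
          (∀ φ : ChiralDeRham.PolyField k M N ε j,
            Φ (ChiralDeRham.DR.cls ((MvPolynomial.X c : MvPolynomial (ChiralDeRham.Coord M N) k) • φ)) =
              ChiralDeRham.Vac.bosonL k (-c.exponent - 1) (Φ (ChiralDeRham.DR.cls φ))) ∧
          (∀ φ φ' : ChiralDeRham.PolyField k M N ε j, ChiralDeRham.IsDerivative c φ φ' →
            Φ (ChiralDeRham.DR.cls φ') = -ChiralDeRham.Vac.bosonV k c.exponent (Φ (ChiralDeRham.DR.cls φ))) ∧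
          (∀ (φ : ChiralDeRham.PolyField k M N ε (j + 1)) (φ' : ChiralDeRham.PolyField k M N ε j), ChiralDeRham.IsContraction c φ φ' →
            Φ (ChiralDeRham.DR.cls φ') = ChiralDeRham.Vac.fermionL k (-c.exponent - 1) (Φ (ChiralDeRham.DR.cls φ))) ∧
          (∀ (φ : ChiralDeRham.PolyField k M N ε j) (φ' : ChiralDeRham.PolyField k M N ε (j + 1)), ChiralDeRham.IsWedge c φ φ' →
            Φ (ChiralDeRham.DR.cls φ') = ChiralDeRham.Vac.fermionV k c.exponent (Φ (ChiralDeRham.DR.cls φ))) := by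
  refine ⟨ChiralDeRham.vacMap_bijective k,
    LinearEquiv.ofBijective (ChiralDeRham.DR.toVac k) ChiralDeRham.DR.toVac_bijective,
    fun M j N ε c => ⟨fun φ => ?_, fun φ φ' h => ?_, fun φ φ' h => ?_, fun φ φ' h => ?_⟩⟩ <;>
  rw [LinearEquiv.ofBijective_apply, LinearEquiv.ofBijective_apply, ChiralDeRham.DR.toVac_cls,
    ChiralDeRham.DR.toVac_cls]
  · exact ChiralDeRham.DR.stageMap_X_smul c φ
  · exact ChiralDeRham.DR.stageMap_of_isDerivative h
  · exact ChiralDeRham.DR.stageMap_of_isContraction h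
  · exact ChiralDeRham.DR.stageMap_of_isWedge h
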